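/- **Search structures.** A search structure stores a dictionary in a rooted directed acyclic graph. The initial graph is finite; every node (element) holds a key (a natural number, or $\pm\infty$ for sentinels), a value, and its list of outgoing edges, which carry labels from a fixed finite set; every state $G$ comes with a strict partial order $\prec_G$ on keys and a property $\mathbb P_G$ of pairs of keys that all edges respect. The operations are $\mathrm{insert}(k,v)$ (creates and links a new node and returns true if no node has key $k$, otherwise returns false), $\mathrm{delete}(k)$ (unlinks the node with key $k$ and returns true if there is one, otherwise returns false) and $\mathrm{find}(k)$ (returns the pointer to the node with key $k$, or false). The sequential code of an operation starts at the root; a traverse function, given the last visited node and the explored graph (and the operation's coin tosses), returns the next node to read or ends the traversal; insert and delete functions then determine the writes from the explored graph, and there are no writes in an unsuccessful operation. Run sequentially from the initial (empty) dictionary, operations terminate and meet this specification. The class $\mathcal D$ consists of the search structures such that: * *(traverse-update)* every operation is a read-only traverse phase followed by a write-only update phase, which is empty for find; the traversal of an operation with key $k$ is complete at the latest when the $k$-relevant graph (all paths from the root to $k$-relevant nodes) has been visited. If a node $a$ has key $k$, the $k$-relevant nodes are $a$, its predecessors and its successors; otherwise they are the nodes with smallest key $k'$ such that $k\prec_G k'$,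 and their predecessors; * *(proper traversals and updates)* the traverse function follows edges out of the last visited node; apart from the creation of the new node by an insert, updates modify only outgoing edges of $k$-relevant nodes; edges added by an insert are incident to the new node, edges added by a delete join nodes of the explored graph; the graph stays acyclic and respects $\mathbb P_G$; * *(non-triviality)* there are a key $k$ and a reachable state $G$ without a node with key $k$ such that for some $v$, in the state after $\mathrm{insert}(k,v)$ exactly one edge $(a,b)$ leads to a node $b$ with key $k$, and the distance from the root to $a$ is at least $2$. **Implementations.** Let $n\ge 2$ processes communicate by atomic primitives on base objects. In a concurrent implementation each process executes high-level operations by the sequential code, with the reads and writes of elements replaced by base-object algorithms; a read or write may abort (return $\bot$), in which case its operation aborts. The history exported by an execution consists of the invocations and responses of operations and of reads and writes, without the aborted reads and writes. A history is *LS-linearizable* if (1) the events of each operation (without $\bot$) are those it has in some history of the sequential code and (2) the high-level history of non-aborted operations is linearizable with respect to the dictionary. An implementation is LS-linearizable if all histories it exports are. It is *pessimistic* if nothing ever returns $\bot$, and *deadlock-free* if, provided that no process stops taking steps in the middle of an operation, whenever operations are executed some operation returns a matching (non-$\bot$) response. $\mathcal P$ is the class of deadlock-free pessimistic LS-linearizable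 implementations. A history is *strictly serializable* if its complete operations (those that returned a matching response) are equivalent to a legal sequential history (each read returns the latest written value) that preserves their real-time order. It is *safe-strict serializable* if moreover, for every operation $\pi$ (also aborted or incomplete), the sequence consisting of the events of some operations that are complete by the time of the last event of $\pi$, one operation after the other, followed by the events of $\pi$, is legal. $\mathcal{SM}$ is the class of optimistic (that is, reads and writes may abort) LS-linearizable implementations all of whose histories are safe-strict serializable. A *schedule* is a sequence of invocations and responses of operations, reads and writes, in which the values returned by reads and operations are not specified. An implementation *accepts* a schedule if it exports a history whose subsequence of events of operations that returned a matching response has exactly this order of events. A schedule is strictly serializable if it is the order of events of some complete LS-linearizable strictly serializable history. **Theorem.** Let $n\ge 2$. Every search structure in the class $\mathcal D$ has a strictly serializable schedule (for $n$ processes) that is accepted by no implementation in $\mathcal P$, but is accepted by some implementation in $\mathcal{SM}$. -/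

import Mathlib

namespace ConcSearch

/-! ### Nodes, operations, and the data of a search structure -/

/-- Keys of nodes: natural numbers, and `⊥`, `⊤` for sentinel nodes. -/
abbrev Key := WithBot (WithTop ℕ)

/-- A natural number, seen as the key of a node. -/
def natKey (k : ℕ) : Key := ((k : WithTop ℕ) : WithBot (WithTop ℕ))

/-- The elements that hold the nodes: the elements of the initial graph (indexed by `S`), and the
fresh element `new i` that the allocator gives to the operation instance with identifier `i`. -/
inductive Elem (S : Type) where
  | init (s : S)
  | new (i : ℕ)

/-- The content of an element: key, value (sentinels may have none), and the list of descendants,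
every outgoing edge carrying a local label. -/
structure Node (S L V : Type) where
  key : Key
  val : Option V
  succ : List (L × Elem S)

/-- The operations of a dictionary. -/
inductive Call (V : Type) where
  | insert (k : ℕ) (v : V)
  | delete (k : ℕ)
  | find (k : ℕ)

/-- The key parameter of an operation. -/
def Call.key {V : Type} : Call V → ℕ
  | .insert k _ => k
  | .delete k => k
  | .find k => k

/-- An operation instance: an identifier (no two operations of a history share it), the operation,
and the outcome of the coin tosses that it uses. -/
structure OpInst (V C : Type) where
  id : ℕ
  call : Call V
  coin : C

/-- Responses: a truth value, or a pointer to a node. -/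
inductive Resp (S : Type) where
  | bool (b : Bool)
  | ptr (x : Elem S)

/-- The sequence of reads done by an operation: elements visited and contents read, in order. -/
abbrev View (S L V : Type) := List (Elem S × Node S L V)

/-- A partially explored graph: the contents of the elements that have been visited. -/
abbrev PGraph (S L V : Type) := Elem S → Option (Node S L V)

/-- The contents of all elements. -/
abbrev Memory (S L V : Type) := Elem S → Node S L V

/-- The data of a search structure. `S` indexes the nodes of the initial graph, `V` are the values,
`L` the edge labels, `C` the outcomes of coin tosses (a one-point type for a deterministic
structure). -/
structure SearchData where
  S : Type
  V : Type
  L : Type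
  C : Type
  /-- the root -/
  root : S
  /-- keys, values and descendants of the initial nodes -/
  initKey : S → Key
  initVal : S → Option V
  initSucc : S → List (L × S)
  /-- the order `≺_G` on keys -/
  prec : Memory S L V → Key → Key → Prop
  /-- the property `P_G`: may there be an edge from a node with one key to a node with another -/
  edgeProp : Memory S L V → Key → Key → Prop
  /-- the traverse function: it is given the last visited node and the graph explored so far, and
  returns the next node to visit, or `none` if the search is complete -/
  trav : Call V → C → Elem S → PGraph S L V → Option (Elem S)
  /-- the insert function: from the key, the value, the explored graph and a new element, the writes
  that link the new node -/
  ins : ℕ → V → C → PGraph S L V → Elem S → List (Elem S × Node S L V)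
  /-- the delete function: from the key and the explored graph, the writes that unlink the node -/
  del : ℕ → C → PGraph S L V → List (Elem S × Node S L V)

namespace SearchData

variable (D : SearchData)

abbrev E := Elem D.S
abbrev N := Node D.S D.L D.V
abbrev Op := OpInst D.V D.C
abbrev R := Resp D.S
abbrev Vw := View D.S D.L D.V
abbrev PG := PGraph D.S D.L D.V
abbrev Mem := Memory D.S D.L D.V

end SearchData

/-! ### The graph stored in a memory -/

section Graph

variable {S L V : Type}

/-- There is an edge from `x` to `y`. -/
def Edge (M : Memory S L V) (x y : Elem S) : Prop := ∃ l, (l, y) ∈ (M x).succ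

/-- The graph explored by a sequence of reads. -/
noncomputable def explored (rs : View S L V) : PGraph S L V := by
  classical
  exact fun x => (rs.find? (fun e => decide (e.1 = x))).map Prod.snd

/-- The edges of an explored graph. -/
def PEdge (g : PGraph S L V) (x y : Elem S) : Prop := ∃ c, g x = some c ∧ ∃ l, (l, y) ∈ c.succ

/-- The nodes of an explored graph: the visited nodes and the endpoints of their edges. -/
def pnodes (g : PGraph S L V) : Set (Elem S) := {y | g y ≠ none ∨ ∃ x, PEdge g x y}

/-- An explored graph is acyclic. -/
def PAcyclic (g : PGraph S L V) : Prop := ∀ x, ¬ Relation.TransGen (PEdge g) x x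

/-- The first visited node with key `k`, if any. -/
noncomputable def lookup (rs : View S L V) (k : ℕ) : Option (Elem S) := by
  classical
  exact (rs.find? (fun e => decide (e.2.key = natKey k))).map Prod.fst

/-- The memory after a sequence of writes. -/
noncomputable def applyWrites (M : Memory S L V) (ws : List (Elem S × Node S L V)) :
    Memory S L V := by
  classical
  exact ws.foldl (fun M w => Function.update M w.1 w.2) M

end Graph

namespace SearchData

variable (D : SearchData)

/-- The initial memory. Elements outside the initial graph are blank. -/
def initMem : D.Mem
  | .init s => ⟨D.initKey s, D.initVal s, (D.initSucc s).map (fun e => (e.1, .init e.2))⟩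
  | .new _ => ⟨⊥, none, []⟩

/-- `x` is a node of the graph stored in `M`: it can be reached from the root. -/
def Linked (M : D.Mem) (x : D.E) : Prop := Relation.ReflTransGen (Edge M) (.init D.root) x

/-- The graph stored in `M` contains a node with key `k`. -/
def HasKey (M : D.Mem) (k : ℕ) : Prop := ∃ x, D.Linked M x ∧ (M x).key = natKey k

/-- `a` is a node whose key is smallest among the keys of the graph above `k`. -/
def NextAbove (M : D.Mem) (k : ℕ) (a : D.E) : Prop :=
  D.Linked M a ∧ D.prec M (natKey k) (M a).key ∧
    ∀ y, D.Linked M y → D.prec M (natKey k) (M y).key → ¬ D.prec M (M y).key (M a).key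

/-- The `k`-relevant set. -/
def relevant (M : D.Mem) (k : ℕ) : Set D.E :=
  {x | D.Linked M x ∧
    ((∃ a, D.Linked M a ∧ (M a).key = natKey k ∧ (x = a ∨ Edge M x a ∨ Edge M a x)) ∨
     (¬ D.HasKey M k ∧ ∃ a, D.NextAbove M k a ∧ (x = a ∨ Edge M x a)))}

/-- The nodes of the `k`-relevant graph: those on a path from the root to a `k`-relevant node. -/
def relevantGraph (M : D.Mem) (k : ℕ) : Set D.E :=
  {x | D.Linked M x ∧ ∃ y ∈ D.relevant M k, Relation.ReflTransGen (Edge M) x y}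

/-! ### The sequential implementation -/

/-- The next node to visit after the reads `rs`; every traversal starts at the root. -/
noncomputable def nextRead (π : D.Op) (rs : D.Vw) : Option D.E :=
  match rs.getLast? with
  | none => some (.init D.root)
  | some e => D.trav π.call π.coin e.1 (explored rs)

/-- The update phase after a traverse phase that did the reads `rs`. An `insert` writes only if no
node with its key was found, a `delete` only if one was found, a `find` never. -/
noncomputable def writes (π : D.Op) (rs : D.Vw) : List (D.E × D.N) :=
  match π.call with
  | .insert k v =>
    match lookup rs k with
    | none => D.ins k v π.coin (explored rs) (.new π.id)
    | some _ => []
  | .delete k =>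
    match lookup rs k with
    | none => []
    | some _ => D.del k π.coin (explored rs)
  | .find _ => []

/-- The response after a traverse phase that did the reads `rs`. -/
noncomputable def resp (π : D.Op) (rs : D.Vw) : D.R :=
  match π.call with
  | .insert k _ => .bool (lookup rs k).isNone
  | .delete k => .bool (lookup rs k).isSome
  | .find k =>
    match lookup rs k with
    | none => .bool false
    | some x => .ptr x

/-- What the sequential code can do next. -/
inductive Action where
  | read (x : D.E)
  | write (x : D.E) (c : D.N)
  | done (r : D.R)

/-- The sequential code of `π`: its next action after the reads `rs` and the first `w` writes. -/
noncomputable def next (π : D.Op) (rs : D.Vw) (w : ℕ) : D.Action :=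
  match D.nextRead π rs with
  | some x => .read x
  | none =>
    match (D.writes π rs)[w]? with
    | some xc => .write xc.1 xc.2
    | none => .done (D.resp π rs)

/-- `rs` are the first reads of `π` when it is run alone on the memory `M`. -/
def PartialTraversal (M : D.Mem) (π : D.Op) (rs : D.Vw) : Prop :=
  ∀ rs' e, (rs' ++ [e]) <+: rs → D.nextRead π rs' = some e.1 ∧ e.2 = M e.1

/-- `rs` are all the reads of `π` when it is run alone on the memory `M`. -/
def Traversal (M : D.Mem) (π : D.Op) (rs : D.Vw) : Prop :=
  D.PartialTraversal M π rs ∧ D.nextRead π rs = none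

/-- The identifier of `π` is not used in `l`. -/
def Fresh (l : List (D.Op × D.Vw)) (π : D.Op) : Prop := ∀ ρ ∈ l, ρ.1.id ≠ π.id

/-- `SeqRun l M`: executing the operations of `l` one after the other from the initial memory, they
do the reads recorded in `l` and lead to the memory `M`. -/
inductive SeqRun : List (D.Op × D.Vw) → D.Mem → Prop
  | nil : SeqRun [] D.initMem
  | snoc {l : List (D.Op × D.Vw)} {M : D.Mem} {π : D.Op} {rs : D.Vw} :
      SeqRun l M → D.Fresh l π → D.Traversal M π rs →
      SeqRun (l ++ [(π, rs)]) (applyWrites M (D.writes π rs))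

end SearchData

/-! ### Object types and the dictionary -/

/-- An object type: operations, responses, states, the initial state, the sequential
specification. -/
structure ObjType where
  Op : Type
  Res : Type
  St : Type
  init : St
  delta : St → Op → St → Res → Prop

/-- Sequences of operations and responses, starting in the initial state, that satisfy the
sequential specification, with the state they lead to. -/
inductive ObjType.Runs (T : ObjType) : List (T.Op × T.Res) → T.St → Prop
  | nil : Runs T [] T.init
  | snoc {l : List (T.Op × T.Res)} {q q' : T.St} {o : T.Op} {r : T.Res} :
      Runs T l q → T.delta q o q' r → Runs T (l ++ [(o, r)]) q'

/-- The dictionary: a state maps a key to the pointer to the node with that key, if present. -/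
def SearchData.dict (D : SearchData) : ObjType where
  Op := D.Op
  Res := D.R
  St := ℕ → Option D.E
  init := fun _ => none
  delta := fun q π q' r =>
    match π.call with
    | .insert k _ =>
      (q k = none ∧ q' = Function.update q k (some (.new π.id)) ∧ r = .bool true) ∨
        (q k ≠ none ∧ q' = q ∧ r = .bool false)
    | .delete k =>
      (q k ≠ none ∧ q' = Function.update q k none ∧ r = .bool true) ∨
        (q k = none ∧ q' = q ∧ r = .bool false)
    | .find k =>
      q' = q ∧ ((∃ x, q k = some x ∧ r = .ptr x) ∨ (q k = none ∧ r = .bool false))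

/-! ### The class of search structures -/

/-- The class of search structures. "State" means a memory reached by a sequential run. That every
operation is a read-only traverse phase followed by a write-only update phase, and that the update
phase of a `find` is empty, is built into `SearchData.next`. -/
structure IsSearchStructure (D : SearchData) : Prop where
  /-- the initial graph is finite, and labels come from a finite set -/
  finite_init : Finite D.S
  finite_label : Finite D.L
  /-- in every state, `≺_G` is a strict partial order -/
  prec_order : ∀ l M, D.SeqRun l M → IsStrictOrder Key (D.prec M)
  /-- in every state, the graph is acyclic, lists no edge twice, and respects `P_G` -/
  acyclic : ∀ l M, D.SeqRun l M → ∀ x, D.Linked M x → ¬ Relation.TransGen (Edge M) x x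
  nodup : ∀ l M, D.SeqRun l M → ∀ x, D.Linked M x → (M x).succ.Nodup
  respects : ∀ l M, D.SeqRun l M → ∀ x y, D.Linked M x → Edge M x y →
    D.edgeProp M (M x).key (M y).key
  /-- run sequentially, every operation terminates, the responses satisfy the dictionary
  specification, and the nodes with natural keys in the graph are those of the dictionary -/
  terminates : ∀ l M, D.SeqRun l M → ∀ π, D.Fresh l π → ∃ rs, D.Traversal M π rs
  correct : ∀ l M, D.SeqRun l M →
    ∃ q, D.dict.Runs (l.map (fun e => (e.1, D.resp e.1 e.2))) q ∧
      ∀ k x, q k = some x ↔ D.Linked M x ∧ (M x).key = natKey k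
  /-- traverse-update: the traversal of an operation with key `k` is complete at the latest when the
  `k`-relevant graph has been visited -/
  traverse_update : ∀ l M, D.SeqRun l M → ∀ π, D.Fresh l π → ∀ rs, D.PartialTraversal M π rs →
    (D.relevant M π.call.key).Nonempty →
    (∀ x ∈ D.relevantGraph M π.call.key, ∃ e ∈ rs, e.1 = x) → D.nextRead π rs = none
  /-- proper traversals: the traverse function follows edges -/
  proper_traversal : ∀ call coin (g : D.PG) a c b, PAcyclic g → g a = some c →
    D.trav call coin a g = some b → ∃ l, (l, b) ∈ c.succ
  /-- proper updates: apart from the creation of the new node by an `insert`, the update phase only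
  modifies outgoing edges of `k`-relevant nodes -/
  proper_update : ∀ l M, D.SeqRun l M → ∀ π, D.Fresh l π → ∀ rs, D.Traversal M π rs →
    ∀ w ∈ D.writes π rs,
      (w.1 = .new π.id ∧ ∃ k v, π.call = .insert k v) ∨
      (w.1 ∈ D.relevant M π.call.key ∧ w.2.key = (M w.1).key ∧ w.2.val = (M w.1).val)
  /-- the insert function creates a node with the given key and value, with edges into the explored
  graph; all other edges that it adds lead to the new node -/
  insert_update : ∀ l M, D.SeqRun l M → ∀ π, D.Fresh l π → ∀ rs, D.Traversal M π rs →
    ∀ k v, π.call = .insert k v → ∀ w ∈ D.writes π rs,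
      (w.1 = .new π.id → w.2.key = natKey k ∧ w.2.val = some v ∧
        ∀ e ∈ w.2.succ, e.2 ∈ pnodes (explored rs)) ∧
      (w.1 ≠ .new π.id → ∀ e ∈ w.2.succ, e.2 = .new π.id ∨ Edge M w.1 e.2)
  /-- edges added by the delete function lead to nodes of the explored graph -/
  delete_update : ∀ l M, D.SeqRun l M → ∀ π, D.Fresh l π → ∀ rs, D.Traversal M π rs →
    ∀ k, π.call = .delete k → ∀ w ∈ D.writes π rs, ∀ e ∈ w.2.succ, e.2 ∈ pnodes (explored rs)
  /-- non-triviality: some state contains no node with key `k`, and in the state `M'` that results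
  from some `insert k v` there is exactly one edge `(a, b)` to a node `b` with key `k`, and the
  distance from the root to `a` is at least `2` -/
  nontrivial : ∃ l M π rs k v, D.SeqRun l M ∧ D.Fresh l π ∧ π.call = .insert k v ∧
    D.Traversal M π rs ∧ ¬ D.HasKey M k ∧
    ∃ M', M' = applyWrites M (D.writes π rs) ∧
      ∃ a b, D.Linked M' a ∧ Edge M' a b ∧ (M' b).key = natKey k ∧
        (∀ x y, D.Linked M' x → Edge M' x y → (M' y).key = natKey k → x = a ∧ y = b) ∧
        a ≠ .init D.root ∧ ¬ Edge M' (.init D.root) a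

/-! ### Histories -/

/-- Kinds of events. `abort` is the response `⊥` of the pending read or write, and with it of the
operation. -/
inductive Kind (D : SearchData) where
  | inv
  | readInv (x : D.E)
  | readRes (x : D.E) (c : D.N)
  | writeInv (x : D.E) (c : D.N)
  | writeRes (x : D.E)
  | res (r : D.R)
  | abort

/-- An event of one of `n` processes, on behalf of an operation instance. -/
structure Event (D : SearchData) (n : ℕ) where
  proc : Fin n
  op : D.Op
  kind : Kind D

section Histories

variable {D : SearchData} {n : ℕ}

/-- The events of `π`. -/
noncomputable def opSub (H : List (Event D n)) (π : D.Op) : List (Event D n) := by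
  classical
  exact H.filter (fun e => decide (e.op = π))

/-- The events of process `p`. -/
noncomputable def procSub (H : List (Event D n)) (p : Fin n) : List (Event D n) :=
  H.filter (fun e => decide (e.proc = p))

/-- `π` has returned a matching response. -/
def Done (H : List (Event D n)) (π : D.Op) : Prop := ∃ e ∈ H, e.op = π ∧ ∃ r, e.kind = .res r

/-- `π` has been aborted. -/
def Aborted (H : List (Event D n)) (π : D.Op) : Prop := ∃ e ∈ H, e.op = π ∧ e.kind = .abort

/-- The events of the operations that have returned a matching response. -/
noncomputable def completePart (H : List (Event D n)) : List (Event D n) := by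
  classical
  exact H.filter (fun e => decide (Done H e.op))

/-- `π` precedes `ρ`: the response of `π` occurs before the invocation of `ρ`. -/
def Precedes (H : List (Event D n)) (π ρ : D.Op) : Prop :=
  ∃ e e', [e, e'].Sublist H ∧ e.op = π ∧ (∃ r, e.kind = .res r) ∧ e'.op = ρ ∧ e'.kind = .inv

/-- No two operations are concurrent. -/
def Sequential (H : List (Event D n)) : Prop :=
  ∀ e ∈ H, ∀ e' ∈ H, e.op ≠ e'.op → Precedes H e.op e'.op ∨ Precedes H e'.op e.op

/-- The memory as left by the writes of `H`. -/
noncomputable def memAfter (H : List (Event D n)) : D.Mem :=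
  applyWrites D.initMem (H.filterMap (fun e =>
    match e.kind with
    | .writeInv x c => some (x, c)
    | _ => none))

/-- Every read returns the latest written value (or the initial one). -/
def Legal (H : List (Event D n)) : Prop :=
  ∀ A e B x c, H = A ++ e :: B → e.kind = .readRes x c → c = memAfter A x

/-! ### LS-linearizability -/

/-- The events of `π` when process `p` executes it with the reads `rs`. -/
noncomputable def opEvents (p : Fin n) (π : D.Op) (rs : D.Vw) : List (Event D n) :=
  ([Kind.inv] ++ rs.flatMap (fun e : D.E × D.N => [Kind.readInv e.1, Kind.readRes e.1 e.2]) ++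
    (D.writes π rs).flatMap (fun w : D.E × D.N => [Kind.writeInv w.1 w.2, Kind.writeRes w.1]) ++
    [Kind.res (D.resp π rs)]).map (fun k => ⟨p, π, k⟩)

/-- The histories of the sequential implementation: complete operations run one after the other,
followed by an initial part of one more operation. -/
def IsSeqHistory (H : List (Event D n)) : Prop :=
  ∃ (l : List (Fin n × D.Op × D.Vw)) (M : D.Mem) (p : Fin n) (π : D.Op) (rs : D.Vw)
    (T : List (Event D n)),
    D.SeqRun (l.map Prod.snd) M ∧ D.Fresh (l.map Prod.snd) π ∧ D.Traversal M π rs ∧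
      T <+: opEvents p π rs ∧ H = l.flatMap (fun e => opEvents e.1 e.2.1 e.2.2) ++ T

/-- The events of `π`, without the response `⊥`. -/
noncomputable def localSub (H : List (Event D n)) (π : D.Op) : List (Event D n) := by
  classical
  exact H.filter (fun e => decide (e.op = π ∧ e.kind ≠ .abort))

/-- Local serializability: every operation sees what it sees in some sequential history. -/
def LocallySerializable (H : List (Event D n)) : Prop :=
  ∀ e ∈ H, ∃ S : List (Event D n), IsSeqHistory S ∧ localSub H e.op = opSub S e.op

/-- The high-level history: invocations and responses of operations that are not aborted. -/
noncomputable def highLevel (H : List (Event D n)) : List (Event D n) := by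
  classical
  exact H.filter (fun e =>
    decide (¬ Aborted H e.op ∧ (e.kind = .inv ∨ ∃ r, e.kind = .res r)))

/-- The sequential high-level history of a list of processes, operations and responses. -/
def highSeq (l : List (Fin n × D.Op × D.R)) : List (Event D n) :=
  l.flatMap (fun e => [⟨e.1, e.2.1, .inv⟩, ⟨e.1, e.2.1, .res e.2.2⟩])

/-- A complete high-level history is linearizable: it is equivalent to a sequential one that extends
its precedence order and satisfies the sequential specification. -/
def CompleteLinearizable (H : List (Event D n)) : Prop :=
  ∃ (l : List (Fin n × D.Op × D.R)) (q : D.dict.St),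
    D.dict.Runs (l.map Prod.snd) q ∧ (∀ p, procSub (highSeq l) p = procSub H p) ∧
      ∀ π ρ, Precedes H π ρ → Precedes (highSeq l) π ρ

/-- A high-level history is linearizable: responses `E` can be added to some incomplete operations,
and the other ones removed, so that the result is linearizable. -/
def Linearizable (H : List (Event D n)) : Prop :=
  ∃ E : List (Event D n), (E.map Event.op).Nodup ∧
    (∀ e ∈ E, (∃ r, e.kind = .res r) ∧ ¬ Done H e.op ∧
      ∃ e' ∈ H, e'.op = e.op ∧ e'.proc = e.proc) ∧
    CompleteLinearizable (completePart (H ++ E))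

/-- LS-linearizability of a history. -/
def LSL (H : List (Event D n)) : Prop := LocallySerializable H ∧ Linearizable (highLevel H)

/-! ### Strict serializability -/

/-- Strict serializability: the complete operations are equivalent to a legal sequential history
that extends their precedence order. -/
def StrictlySerializable (H : List (Event D n)) : Prop :=
  ∃ S : List (Event D n), Sequential S ∧ Legal S ∧
    (∀ p, procSub S p = procSub (completePart H) p) ∧
    ∀ π ρ, Precedes (completePart H) π ρ → Precedes S π ρ

/-- Safe-strict serializability: moreover, for each operation `π`, complete or not, and the prefix
of the history that ends with the last event of `π`, what `π` did is legal after some operations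
that are complete in this prefix. -/
def SafeStrictSerializable (H : List (Event D n)) : Prop :=
  StrictlySerializable H ∧
  ∀ A e B, H = A ++ e :: B → (∀ e' ∈ B, e'.op ≠ e.op) →
    ∃ l : List D.Op, l.Nodup ∧ e.op ∉ l ∧ (∀ ρ ∈ l, Done (A ++ [e]) ρ) ∧
      Legal (l.flatMap (opSub (A ++ [e])) ++ opSub (A ++ [e]) e.op)

/-! ### Schedules -/

/-- Kinds of events without the responses of reads and of operations. -/
inductive SKind (D : SearchData) where
  | inv
  | readInv (x : D.E)
  | readRes (x : D.E)
  | writeInv (x : D.E) (c : D.N)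
  | writeRes (x : D.E)
  | res
  | abort

/-- Forget the responses of reads and of operations. -/
def Kind.skel : Kind D → SKind D
  | .inv => .inv
  | .readInv x => .readInv x
  | .readRes x _ => .readRes x
  | .writeInv x c => .writeInv x c
  | .writeRes x => .writeRes x
  | .res _ => .res
  | .abort => .abort

/-- Schedules: sequences of events without the responses of reads and of operations. -/
abbrev Schedule (D : SearchData) (n : ℕ) := List (Fin n × D.Op × SKind D)

/-- The order of events in a history, as a schedule. -/
def skel (H : List (Event D n)) : Schedule D n := H.map (fun e => (e.proc, e.op, e.kind.skel))

/-- A schedule is strictly serializable: it is exported by a complete LS-linearizable history that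
is strictly serializable. -/
def StrictlySerializableSchedule (σ : Schedule D n) : Prop :=
  ∃ H : List (Event D n), (∀ e ∈ H, Done H e.op) ∧ skel H = σ ∧ LSL H ∧ StrictlySerializable H

/-! ### Concurrent implementations -/

/-- The state of a process: idle, or executing `π`, having completed the reads `rs` and the first
`w` writes, with a read or write pending or not. -/
inductive Status (D : SearchData) where
  | idle
  | running (π : D.Op) (rs : D.Vw) (w : ℕ) (pending : Bool)

/-- The effect of a step of the algorithm at the interface: none; invoke the next read or write of
the sequential code, or return if there is none; complete the pending read (returning `c`) or write;
abort the pending read or write. -/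
inductive Out (D : SearchData) where
  | silent
  | next
  | ret (c : D.N)
  | abort

/-- The events, and the new status, caused by an effect. -/
noncomputable def react (π : D.Op) (rs : D.Vw) (w : ℕ) (pending : Bool) (o : Out D) :
    List (Kind D) × Status D :=
  match pending, o, D.next π rs w with
  | false, .next, .read x => ([.readInv x], .running π rs w true)
  | false, .next, .write x c => ([.writeInv x c], .running π rs w true)
  | false, .next, .done r => ([.res r], .idle)
  | true, .ret c, .read x => ([.readRes x c], .running π (rs ++ [(x, c)]) w false)
  | true, .ret _, .write x _ => ([.writeRes x], .running π rs (w + 1) false)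
  | true, .abort, _ => ([.abort], .idle)
  | _, _, _ => ([], .running π rs w pending)

end Histories

/-- A concurrent implementation for `n` processes. Processes have local states and communicate by
atomic primitives on base objects: `prog p st s` is the base object to which `p` applies a primitive
in status `st` and local state `s`, and, for each value of the base object, the new value, the new
local state and the effect at the interface. High-level operations follow the sequential code; the
implementation determines the base-object code run before, in, between and after their reads and
writes, what the reads return, and which reads and writes abort. -/
structure Impl (D : SearchData) (n : ℕ) where
  Obj : Type
  Val : Obj → Type
  initVal : ∀ o, Val o
  Loc : Type
  initLoc : Fin n → Loc
  prog : Fin n → Status D → Loc → (o : Obj) × (Val o → Val o × Loc × Out D)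

namespace Impl

variable {D : SearchData} {n : ℕ}

/-- A configuration: values of base objects, local states, statuses. -/
structure Config (I : Impl D n) where
  mem : ∀ o, I.Val o
  loc : Fin n → I.Loc
  st : Fin n → Status D

/-- The initial configuration. -/
def initConfig (I : Impl D n) : I.Config := ⟨I.initVal, I.initLoc, fun _ => .idle⟩

/-- Steps: a process is given an operation to execute, or takes a step of its algorithm. -/
inductive Act (D : SearchData) (n : ℕ) where
  | invoke (p : Fin n) (π : D.Op)
  | step (p : Fin n)

/-- The configuration after `p`, executing an operation, takes a step, and the events of the
step. -/
noncomputable def stepResult (I : Impl D n) (c : I.Config) (p : Fin n)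
    (π : D.Op) (rs : D.Vw) (w : ℕ) (pending : Bool) : List (Event D n) × I.Config := by
  classical
  exact
    let a := I.prog p (.running π rs w pending) (c.loc p)
    let r := a.2 (c.mem a.1)
    let k := react π rs w pending r.2.2
    (k.1.map (fun k => ⟨p, π, k⟩),
      ⟨Function.update c.mem a.1 r.1, Function.update c.loc p r.2.1, Function.update c.st p k.2⟩)

/-- `Step H c a H' c'`: after the events `H`, in configuration `c`, the step `a` can be taken, and
leads to the events `H'` and the configuration `c'`. Only an idle process is given an operation,
with an unused identifier; only a process that executes an operation takes steps. -/
inductive Step (I : Impl D n) :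
    List (Event D n) → I.Config → Act D n → List (Event D n) → I.Config → Prop
  | invoke {H : List (Event D n)} {c : I.Config} {p : Fin n} {π : D.Op} :
      c.st p = .idle → (∀ e ∈ H, e.op.id ≠ π.id) →
      Step I H c (.invoke p π) (H ++ [⟨p, π, .inv⟩])
        ⟨c.mem, c.loc, Function.update c.st p (.running π [] 0 false)⟩
  | step {H : List (Event D n)} {c : I.Config} {p : Fin n} {π : D.Op} {rs : D.Vw} {w : ℕ}
      {b : Bool} :
      c.st p = .running π rs w b →
      Step I H c (.step p) (H ++ (I.stepResult c p π rs w b).1) (I.stepResult c p π rs w b).2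

/-- Finite executions: `Exec H c` says that an execution with events `H` leads to `c`. -/
inductive Exec (I : Impl D n) : List (Event D n) → I.Config → Prop
  | init : Exec I [] I.initConfig
  | snoc {H H' : List (Event D n)} {c c' : I.Config} {a : Act D n} :
      Exec I H c → I.Step H c a H' c' → Exec I H' c'

end Impl

section Classes

variable {D : SearchData} {n : ℕ}

/-- The history exported by an execution: reads and writes that abort are removed, that is, the
invocations whose next event of the same operation is the response `⊥`. -/
noncomputable def exported : List (Event D n) → List (Event D n) := by
  classical
  exact fun α => match α with
    | [] => []
    | e :: α =>
      if ∃ e', α.find? (fun f => decide (f.op = e.op)) = some e' ∧ e'.kind = .abort then exported α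
      else e :: exported α

namespace Impl

/-- The implementation accepts the schedule `σ`. -/
def Accepts (I : Impl D n) (σ : Schedule D n) : Prop :=
  ∃ α c, I.Exec α c ∧ skel (completePart (exported α)) = σ

/-- The implementation is LS-linearizable. -/
def IsLSL (I : Impl D n) : Prop := ∀ α c, I.Exec α c → LSL (exported α)

/-- The implementation is pessimistic: nothing ever returns `⊥`. -/
def Pessimistic (I : Impl D n) : Prop := ∀ α c, I.Exec α c → ∀ e ∈ α, e.kind ≠ .abort

/-- Deadlock-freedom: in every infinite execution in which no process stops taking steps in the
middle of an operation, whenever some process executes an operation, some operation later returns a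
matching response. (The infinite execution is given from an arbitrary reachable configuration on.) -/
def DeadlockFree (I : Impl D n) : Prop :=
  ∀ (H : ℕ → List (Event D n)) (c : ℕ → I.Config) (a : ℕ → Act D n),
    I.Exec (H 0) (c 0) →
    (∀ t, I.Step (H t) (c t) (a t) (H (t + 1)) (c (t + 1))) →
    (∀ p t, (c t).st p ≠ .idle → ∃ t' ≥ t, a t' = .step p) →
    ∀ p t, (c t).st p ≠ .idle →
      ∃ t' ≥ t, ∃ q π r, H (t' + 1) = H t' ++ [⟨q, π, .res r⟩]

/-- The class `P`: deadlock-free pessimistic LS-linearizable implementations. -/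
def ClassP (I : Impl D n) : Prop := I.IsLSL ∧ I.Pessimistic ∧ I.DeadlockFree

/-- The class `SM`: optimistic (that is, reads and writes may abort) safe-strict serializable
LS-linearizable implementations. -/
def ClassSM (I : Impl D n) : Prop :=
  I.IsLSL ∧ ∀ α c, I.Exec α c → SafeStrictSerializable (exported α)

end Impl

end Classes

end ConcSearch

/-!
The schedule overlaps two inserts of the same absent key `k`. Starting from the initial state,
insert `k` and delete it again, over and over. An insert adds to the graph only its new node, and
the delete that follows unlinks it while adding only edges to explored nodes; so whenever `k` is
absent the nodes of the graph are initial nodes, with their initial keys and values. As the labels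
come from a finite set and no edge is listed twice, there are finitely many such graphs, and some
state `M` recurs as a later state `M'` with the same graph
(`IsSearchStructure.exists_recurrent_state`). The schedule is as follows. From `M`, a process `q`
does all the reads of an insert `π` of `k` and invokes its first write; then a process `p` inserts
and deletes `k` until the graph is that of `M'`; then `q` completes `π`; finally every process
executes a `find`.

No pessimistic implementation accepts it (`Impl.ClassP.not_accepts`). Stop right after the first
insert of `p` after `M` has returned. The final operations show that nothing but `π` is in progress at this
point, since a process invokes an operation only after its previous ones have ended. By
deadlock-freedom and the absence of aborts, `π` completes when `q` runs alone
(`Impl.exists_solo_completion`). Having started to write, it can only return `true`, by local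
serializability (`LocallySerializable.resp_eq_true`). Then the successful inserts of `k` exceed the
successful deletes by two, which no dictionary allows (`Linearizable.count_le`).

The implementation that accepts the schedule is the optimistic one that validates by value
(`optimistic`): every read or write checks that all earlier reads of its operation still agree with
the current memory, and aborts otherwise, or if another process holds the commit lock. The last
access of an operation that can abort takes this lock, and the writes are applied, and the lock
released, when the operation returns. Hence the complete operations are serialized in the order of their responses, and an operation that is
aborted or incomplete has seen a single state among those left by complete operations; these facts
are kept as an invariant (`Serialization`, `OptimisticInv`), from which safe-strict serializability
and LS-linearizability follow (`optimistic_classSM`). In the schedule, the graph of `M'` is that of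
`M`, and the reads of `π` were confined to this graph; so they are still current when `π` goes on,
and nothing aborts.
-/

namespace ConcSearch

/-! ### Traversals of a state -/

section Sequential

variable {D : SearchData}

theorem explored_eq_some {M : D.Mem} {rs : D.Vw} (h : ∀ e ∈ rs, e.2 = M e.1) {x : D.E} {c : D.N}
    (hx : explored rs x = some c) : c = M x ∧ ∃ e ∈ rs, e.1 = x := by
  classical
  simp only [explored, Option.map_eq_some_iff] at hx
  obtain ⟨e, he, rfl⟩ := hx
  have h1 := List.find?_some he
  have h2 := List.mem_of_find?_eq_some he
  simp only [decide_eq_true_eq] at h1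
  subst h1
  exact ⟨h e h2, e, h2, rfl⟩

theorem explored_of_mem {M : D.Mem} {rs : D.Vw} (h : ∀ e ∈ rs, e.2 = M e.1) {e : D.E × D.N}
    (he : e ∈ rs) : explored rs e.1 = some (M e.1) := by
  classical
  cases hx : explored rs e.1 with
  | some c => rw [(explored_eq_some h hx).1]
  | none =>
    simp only [explored, Option.map_eq_none_iff, List.find?_eq_none] at hx
    simpa using hx e he

theorem SearchData.PartialTraversal.of_prefix {M : D.Mem} {π : D.Op} {rs rs' : D.Vw}
    (h : D.PartialTraversal M π rs) (hp : rs' <+: rs) : D.PartialTraversal M π rs' :=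
  fun r e hr => h r e (hr.trans hp)

theorem SearchData.PartialTraversal.nil (M : D.Mem) (π : D.Op) : D.PartialTraversal M π [] := by
  intro r e hr
  simp at hr

theorem SearchData.PartialTraversal.snoc {M : D.Mem} {π : D.Op} {rs : D.Vw} {e : D.E × D.N}
    (h : D.PartialTraversal M π rs) (h1 : D.nextRead π rs = some e.1) (h2 : e.2 = M e.1) :
    D.PartialTraversal M π (rs ++ [e]) := by
  intro r e' hr
  rw [List.prefix_concat_iff] at hr
  rcases hr with hr | hr
  · obtain ⟨rfl, h3⟩ := List.append_inj' hr rfl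
    simp only [List.cons.injEq, and_true] at h3
    subst h3
    exact ⟨h1, h2⟩
  · exact h r e' hr

theorem SearchData.PartialTraversal.val {M : D.Mem} {π : D.Op} {rs : D.Vw}
    (h : D.PartialTraversal M π rs) : ∀ e ∈ rs, e.2 = M e.1 := by
  intro e he
  obtain ⟨s, t, rfl⟩ := List.append_of_mem he
  exact (h s e ⟨t, by simp⟩).2

/-- The reads of a partial traversal of `M` also form a partial traversal of every memory in which
the elements read have the same contents. -/
theorem SearchData.PartialTraversal.congr {M M' : D.Mem} {π : D.Op} {rs : D.Vw}
    (h : D.PartialTraversal M π rs) (hv : ∀ e ∈ rs, e.2 = M' e.1) :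
    D.PartialTraversal M' π rs :=
  fun r e hr => ⟨(h r e hr).1, hv e (hr.subset (by simp))⟩

/-- The sequential code is deterministic. -/
theorem SearchData.PartialTraversal.prefix_traversal {M : D.Mem} {π : D.Op} {rs rs' : D.Vw}
    (h : D.PartialTraversal M π rs) (h' : D.Traversal M π rs') : rs <+: rs' := by
  induction rs using List.reverseRecOn with
  | nil => exact List.nil_prefix
  | append_singleton r e ih =>
    obtain ⟨t, rfl⟩ := ih (h.of_prefix (List.prefix_append _ _))
    have h1 := h r e (List.prefix_refl _)
    cases t with
    | nil =>
      have h2 := h'.2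
      rw [List.append_nil, h1.1] at h2
      exact absurd h2 (by simp)
    | cons e' t =>
      have h2 := h'.1 r e' ⟨t, by simp⟩
      have h3 : e = e' := by
        have h4 : e.1 = e'.1 := by simpa [h1.1] using h2.1
        exact Prod.ext h4 (by rw [h1.2, h2.2, h4])
      subst h3
      exact ⟨t, by simp⟩

theorem SearchData.nextRead_nil (π : D.Op) : D.nextRead π [] = some (.init D.root) := rfl

theorem SearchData.nextRead_concat (π : D.Op) (rs : D.Vw) (e : D.E × D.N) :
    D.nextRead π (rs ++ [e]) = D.trav π.call π.coin e.1 (explored (rs ++ [e])) := by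
  simp [SearchData.nextRead]

theorem SearchData.Traversal.ne_nil {M : D.Mem} {π : D.Op} {rs : D.Vw} (h : D.Traversal M π rs) :
    rs ≠ [] := by
  rintro rfl
  simpa [SearchData.nextRead_nil] using h.2

theorem pedge_explored {M : D.Mem} {rs : D.Vw} (hv : ∀ e ∈ rs, e.2 = M e.1)
    (hl : ∀ e ∈ rs, D.Linked M e.1) {x y : D.E} (h : PEdge (explored rs) x y) :
    D.Linked M x ∧ Edge M x y := by
  obtain ⟨c, hc, l, hl'⟩ := h
  obtain ⟨rfl, e, he, rfl⟩ := explored_eq_some hv hc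
  exact ⟨hl e he, l, hl'⟩

theorem pnodes_explored_linked {M : D.Mem} {rs : D.Vw} (hv : ∀ e ∈ rs, e.2 = M e.1)
    (hl : ∀ e ∈ rs, D.Linked M e.1) {y : D.E} (h : y ∈ pnodes (explored rs)) : D.Linked M y := by
  rcases h with h | ⟨x, h⟩
  · obtain ⟨c, hc⟩ := Option.ne_none_iff_exists'.1 h
    obtain ⟨-, e, he, rfl⟩ := explored_eq_some hv hc
    exact hl e he
  · obtain ⟨h1, h2⟩ := pedge_explored hv hl h
    exact h1.tail h2

/-- A sequential operation reads only nodes of the graph. -/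
theorem IsSearchStructure.linked_of_read (hD : IsSearchStructure D) {l : List (D.Op × D.Vw)}
    {M : D.Mem} (hM : D.SeqRun l M) {π : D.Op} {rs : D.Vw} (h : D.PartialTraversal M π rs) :
    ∀ e ∈ rs, D.Linked M e.1 := by
  induction rs using List.reverseRecOn with
  | nil => simp
  | append_singleton r e ih =>
    have ih := ih (h.of_prefix (List.prefix_append _ _))
    have hv := (h.of_prefix (List.prefix_append _ [e])).val
    have h1 := h r e (List.prefix_refl _)
    suffices D.Linked M e.1 by
      intro e' he'
      rcases List.mem_append.1 he' with he' | he'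
      · exact ih e' he'
      · rw [List.mem_singleton.1 he']; exact this
    rcases List.eq_nil_or_concat' r with rfl | ⟨r, f, rfl⟩
    · rw [SearchData.nextRead_nil, Option.some.injEq] at h1
      rw [← h1.1]
      exact Relation.ReflTransGen.refl
    · rw [SearchData.nextRead_concat] at h1
      have hf : f ∈ r ++ [f] := by simp
      have hacyc : PAcyclic (explored (r ++ [f])) := by
        intro x hx
        have h2 : D.Linked M x := by
          obtain ⟨y, hy, -⟩ := Relation.TransGen.head'_iff.1 hx
          exact (pedge_explored hv ih hy).1
        exact hD.acyclic l M hM x h2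
          (hx.lift id fun _ _ hab => (pedge_explored hv ih hab).2)
      obtain ⟨lab, hlab⟩ := hD.proper_traversal _ _ _ _ _ _ hacyc (explored_of_mem hv hf) h1.1
      exact (ih f hf).tail ⟨lab, hlab⟩

/-- A traversal depends only on the contents of the nodes of the graph. -/
theorem IsSearchStructure.traversal_congr (hD : IsSearchStructure D) {l : List (D.Op × D.Vw)}
    {M M' : D.Mem} (hM : D.SeqRun l M) (hMM : ∀ x, D.Linked M x → M' x = M x) {π : D.Op}
    {rs : D.Vw} (h : D.Traversal M π rs) : D.Traversal M' π rs :=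
  ⟨h.1.congr fun e he => by rw [hMM _ (hD.linked_of_read hM h.1 e he), h.1.val e he], h.2⟩

theorem applyWrites_apply {S L V : Type} (M : Memory S L V) (ws : List (Elem S × Node S L V))
    (x : Elem S) : applyWrites M ws x = M x ∨
      ∃ w ∈ ws, w.1 = x ∧ applyWrites M ws x = w.2 := by
  classical
  induction ws using List.reverseRecOn with
  | nil => exact Or.inl rfl
  | append_singleton ws w ih =>
    simp only [applyWrites, List.foldl_append, List.foldl_cons, List.foldl_nil] at ih ⊢
    by_cases hx : x = w.1
    · subst hx
      exact Or.inr ⟨w, by simp, rfl, by simp⟩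
    · rw [Function.update_of_ne hx]
      rcases ih with ih | ⟨w', h1, h2, h3⟩
      · exact Or.inl ih
      · exact Or.inr ⟨w', by simp [h1], h2, h3⟩

@[simp]
theorem applyWrites_nil {S L V : Type} (M : Memory S L V) : applyWrites M [] = M := rfl

theorem applyWrites_append {S L V : Type} (M : Memory S L V)
    (ws ws' : List (Elem S × Node S L V)) :
    applyWrites M (ws ++ ws') = applyWrites (applyWrites M ws) ws' := by
  simp [applyWrites]

theorem SearchData.SeqRun.eq_of_id_eq {l : List (D.Op × D.Vw)} {M : D.Mem} (h : D.SeqRun l M) :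
    ∀ x ∈ l, ∀ y ∈ l, x.1.id = y.1.id → x = y := by
  induction h with
  | nil => simp
  | snoc _ hf _ ih =>
    intro x hx y hy hxy
    rcases List.mem_append.1 hx with hx | hx <;> rcases List.mem_append.1 hy with hy | hy
    · exact ih x hx y hy hxy
    · rw [List.mem_singleton.1 hy] at hxy
      exact absurd hxy (hf x hx)
    · rw [List.mem_singleton.1 hx] at hxy
      exact absurd hxy.symm (hf y hy)
    · rw [List.mem_singleton.1 hx, List.mem_singleton.1 hy]

theorem SearchData.SeqRun.nodup {l : List (D.Op × D.Vw)} {M : D.Mem} (h : D.SeqRun l M) :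
    (l.map Prod.fst).Nodup := by
  induction h with
  | nil => simp
  | snoc _ hf _ ih =>
    rw [List.map_append, List.nodup_append]
    refine ⟨ih, by simp, ?_⟩
    intro a ha b hb hab
    simp only [List.map_cons, List.map_nil, List.mem_singleton] at hb
    obtain ⟨x, hx, rfl⟩ := List.mem_map.1 ha
    exact hf x hx (by rw [hab, hb])

/-! ### Executing an insert and a delete of an absent key -/

theorem ObjType.Runs.of_concat {T : ObjType} {l : List (T.Op × T.Res)} {o : T.Op} {r : T.Res}
    {q : T.St} (h : T.Runs (l ++ [(o, r)]) q) : ∃ q', T.Runs l q' ∧ T.delta q' o q r := by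
  generalize hl : l ++ [(o, r)] = l' at h
  induction h with
  | nil => simp at hl
  | @snoc l₁ q₁ q₂ o' r' hr hd _ =>
    obtain ⟨rfl, h2⟩ := List.append_inj' hl rfl
    simp only [List.cons.injEq, Prod.mk.injEq, and_true] at h2
    obtain ⟨rfl, rfl⟩ := h2
    exact ⟨q₁, hr, hd⟩

theorem ObjType.Runs.of_nil {T : ObjType} {q : T.St} (h : T.Runs [] q) : q = T.init := by
  generalize hl : ([] : List (T.Op × T.Res)) = l' at h
  induction h with
  | nil => rfl
  | snoc => simp at hl

theorem ObjType.Runs.unique {l : List (D.dict.Op × D.dict.Res)} {q q' : D.dict.St}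
    (h : D.dict.Runs l q) (h' : D.dict.Runs l q') : q = q' := by
  induction h generalizing q' with
  | nil => exact h'.of_nil.symm
  | snoc hr hd ih =>
    obtain ⟨q₂, hr', hd'⟩ := h'.of_concat
    obtain rfl := ih hr'
    simp only [SearchData.dict] at hd hd'
    split at hd <;> grind

/-- The state of the dictionary after a sequential run, before and after one more operation. -/
theorem IsSearchStructure.dict_step (hD : IsSearchStructure D) {l : List (D.Op × D.Vw)}
    {M : D.Mem} (hM : D.SeqRun l M) {π : D.Op} (hf : D.Fresh l π) {rs : D.Vw}
    (ht : D.Traversal M π rs) :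
    ∃ q q' : ℕ → Option D.E, D.dict.delta q π q' (D.resp π rs) ∧
      (∀ k x, q k = some x ↔ D.Linked M x ∧ (M x).key = natKey k) ∧
      ∀ k x, q' k = some x ↔ D.Linked (applyWrites M (D.writes π rs)) x ∧
        (applyWrites M (D.writes π rs) x).key = natKey k := by
  obtain ⟨q, hq, hq'⟩ := hD.correct l M hM
  obtain ⟨q₁, hq₁, hq₁'⟩ := hD.correct _ _ (hM.snoc hf ht)
  refine ⟨q, q₁, ?_, hq', hq₁'⟩
  rw [List.map_append] at hq₁
  obtain ⟨q₂, hr', hd'⟩ := hq₁.of_concat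
  rw [ObjType.Runs.unique hq hr']
  exact hd'

/-- An update that writes something is successful. -/
theorem SearchData.resp_of_writes_ne_nil {π : D.Op} {rs : D.Vw} (h : D.writes π rs ≠ []) :
    D.resp π rs = .bool true := by
  unfold SearchData.writes at h
  unfold SearchData.resp
  split <;> simp_all <;> split at h <;> simp_all

theorem IsSearchStructure.insert_step (hD : IsSearchStructure D) {l : List (D.Op × D.Vw)}
    {M : D.Mem} (hM : D.SeqRun l M) {π : D.Op} (hf : D.Fresh l π) {rs : D.Vw}
    (ht : D.Traversal M π rs) {k : ℕ} {v : D.V} (hc : π.call = .insert k v)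
    (hk : ¬ D.HasKey M k) :
    D.writes π rs ≠ [] ∧
      D.Linked (applyWrites M (D.writes π rs)) (.new π.id) ∧
      (applyWrites M (D.writes π rs) (.new π.id)).key = natKey k := by
  obtain ⟨q, q', hd, hq, hq'⟩ := hD.dict_step hM hf ht
  have h1 : q k = none := by
    by_contra hne
    obtain ⟨x, hx⟩ := Option.ne_none_iff_exists'.1 hne
    exact hk ⟨x, (hq k x).1 hx⟩
  simp only [SearchData.dict, hc, h1, ne_eq, not_true_eq_false, false_and, or_false,
    true_and] at hd
  have h2 := (hq' k (.new π.id)).1 (by rw [hd.1]; simp)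
  refine ⟨fun hw => hk ?_, h2⟩
  rw [hw] at h2
  exact ⟨_, h2⟩

theorem IsSearchStructure.delete_step (hD : IsSearchStructure D) {l : List (D.Op × D.Vw)}
    {M : D.Mem} (hM : D.SeqRun l M) {π : D.Op} (hf : D.Fresh l π) {rs : D.Vw}
    (ht : D.Traversal M π rs) {k : ℕ} (hc : π.call = .delete k) (hk : D.HasKey M k) :
    D.writes π rs ≠ [] ∧ ¬ D.HasKey (applyWrites M (D.writes π rs)) k := by
  obtain ⟨q, q', hd, hq, hq'⟩ := hD.dict_step hM hf ht
  have h1 : q k ≠ none := by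
    obtain ⟨x, hx⟩ := hk
    rw [(hq k x).2 hx]
    simp
  simp only [SearchData.dict, hc, ne_eq, h1, not_false_eq_true, true_and, false_and,
    or_false] at hd
  have h2 : ¬ D.HasKey (applyWrites M (D.writes π rs)) k := by
    rintro ⟨x, hx⟩
    have h3 := (hq' k x).2 hx
    rw [hd.1] at h3
    simp at h3
  refine ⟨fun hw => h2 ?_, h2⟩
  rw [hw]
  exact hk

/-! ### A state that recurs -/

/-- The operation is an insert. -/
def Call.isInsert {V : Type} : Call V → Bool
  | .insert _ _ => true
  | _ => false

/-- The operation is a delete. -/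
def Call.isDelete {V : Type} : Call V → Bool
  | .delete _ => true
  | _ => false

/-- `l` is a sequential run of successful inserts and deletes of `k`, equally many, that leads to a
state `M` without `k`. The graph of `M` has no new nodes, and its nodes have the keys and values of
the initial graph, so that only the lists of descendants may differ from those of the initial
graph. Identifiers lie between `1` and the length of `l`, which keeps `0` and all larger numbers
available for other operations. -/
structure BalancedRun (D : SearchData) (k : ℕ) (l : List (D.Op × D.Vw)) (M : D.Mem) : Prop where
  run : D.SeqRun l M
  absent : ¬ D.HasKey M k
  linked_init : ∀ x, D.Linked M x → ∃ s, x = .init s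
  key_eq : ∀ s, (M (.init s)).key = D.initKey s ∧ (M (.init s)).val = D.initVal s
  blank : ∀ i, (∀ ρ ∈ l, ρ.1.id ≠ i) → M (.new i) = D.initMem (.new i)
  ids : ∀ ρ ∈ l, 1 ≤ ρ.1.id ∧ ρ.1.id ≤ l.length
  writes_ne : ∀ ρ ∈ l, D.writes ρ.1 ρ.2 ≠ []
  calls : ∀ ρ ∈ l, (∃ v, ρ.1.call = .insert k v) ∨ ρ.1.call = .delete k
  balanced : l.countP (fun ρ => ρ.1.call.isInsert) = l.countP (fun ρ => ρ.1.call.isDelete)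

theorem IsSearchStructure.balancedRun_nil (hD : IsSearchStructure D) (k : ℕ) :
    BalancedRun D k [] D.initMem where
  run := .nil
  absent := by
    rintro ⟨x, hx⟩
    obtain ⟨q, hq, hq'⟩ := hD.correct _ _ .nil
    have h1 := (hq' k x).2 hx
    rw [hq.of_nil] at h1
    simp [SearchData.dict] at h1
  linked_init := by
    intro x hx
    induction hx with
    | refl => exact ⟨_, rfl⟩
    | tail _ he ih =>
      obtain ⟨s, rfl⟩ := ih
      obtain ⟨lab, hlab⟩ := he
      simp only [SearchData.initMem, List.mem_map, Prod.mk.injEq] at hlab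
      obtain ⟨e, -, -, rfl⟩ := hlab
      exact ⟨_, rfl⟩
  key_eq := fun _ => ⟨rfl, rfl⟩
  blank := fun _ _ => rfl
  ids := by simp
  writes_ne := by simp
  calls := by simp
  balanced := rfl

/-- Inserting `k` and deleting it again adds no node to the graph: the insert adds only its new
node, and the delete adds only edges to explored nodes and unlinks the new node, as `k` is absent
afterwards. -/
theorem BalancedRun.insert_delete (hD : IsSearchStructure D) {k : ℕ} {l : List (D.Op × D.Vw)}
    {M : D.Mem} (h : BalancedRun D k l M) (v : D.V) (coin : D.C) :
    ∃ a d M', a.1.call = .insert k v ∧ BalancedRun D k (l ++ [a, d]) M' := by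
  obtain ⟨π, hπ⟩ : ∃ π : D.Op, π = ⟨l.length + 1, .insert k v, coin⟩ := ⟨_, rfl⟩
  obtain ⟨ρ, hρ⟩ : ∃ ρ : D.Op, ρ = ⟨l.length + 2, .delete k, coin⟩ := ⟨_, rfl⟩
  have hπid : π.id = l.length + 1 := by rw [hπ]
  have hρid : ρ.id = l.length + 2 := by rw [hρ]
  have hπc : π.call = .insert k v := by rw [hπ]
  have hρc : ρ.call = .delete k := by rw [hρ]
  have hf : D.Fresh l π := fun x hx => by have := (h.ids x hx).2; omega
  obtain ⟨rs, ht⟩ := hD.terminates l M h.run π hf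
  obtain ⟨hw, hlink, hkey⟩ := hD.insert_step h.run hf ht hπc h.absent
  have hupd := hD.proper_update l M h.run π hf rs ht
  have hins := fun w hw => hD.insert_update l M h.run π hf rs ht k v hπc w hw
  have hrun1 := h.run.snoc hf ht
  have happ := applyWrites_apply M (D.writes π rs)
  obtain ⟨M₁, hM₁⟩ : ∃ M₁, M₁ = applyWrites M (D.writes π rs) := ⟨_, rfl⟩
  rw [← hM₁] at hlink hkey hrun1 happ
  have hnew : ∀ x, D.Linked M x → x ≠ .new π.id := by
    rintro x hx rfl
    obtain ⟨s, hs⟩ := h.linked_init _ hx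
    cases hs
  have hblank : M (.new π.id) = D.initMem (.new π.id) := h.blank _ (fun x hx => hf x hx)
  -- the insert adds no edges from old nodes to elements other than the new node
  have hlinked1 : ∀ x, D.Linked M₁ x → x = .new π.id ∨ D.Linked M x := by
    intro x hx
    induction hx with
    | refl => exact Or.inr Relation.ReflTransGen.refl
    | @tail x y _ he ih =>
      obtain ⟨lab, hlab⟩ := he
      rcases happ x with h1 | ⟨w, hw1, rfl, h1⟩
      · rw [h1] at hlab
        rcases ih with rfl | ih
        · rw [hblank] at hlab
          simp [SearchData.initMem] at hlab
        · exact Or.inr (ih.tail ⟨lab, hlab⟩)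
      · rw [h1] at hlab
        rcases ih with ih | ih
        · exact Or.inr (pnodes_explored_linked ht.1.val (hD.linked_of_read h.run ht.1)
            (((hins w hw1).1 ih).2.2 _ hlab))
        · rcases (hins w hw1).2 (hnew _ ih) _ hlab with h2 | h2
          · exact Or.inl h2
          · exact Or.inr (ih.tail h2)
  have hfρ : D.Fresh (l ++ [(π, rs)]) ρ := by
    intro x hx
    rcases List.mem_append.1 hx with hx | hx
    · have := (h.ids x hx).2; omega
    · rw [List.mem_singleton.1 hx]; simp only; omega
  obtain ⟨rs', ht'⟩ := hD.terminates _ M₁ hrun1 ρ hfρ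
  obtain ⟨hw', habs⟩ := hD.delete_step hrun1 hfρ ht' hρc ⟨_, hlink, hkey⟩
  have hupd' := hD.proper_update _ M₁ hrun1 ρ hfρ rs' ht'
  have hdel := fun w hw => hD.delete_update _ M₁ hrun1 ρ hfρ rs' ht' k hρc w hw
  have hrun2 := hrun1.snoc hfρ ht'
  have happ' := applyWrites_apply M₁ (D.writes ρ rs')
  obtain ⟨M₂, hM₂⟩ : ∃ M₂, M₂ = applyWrites M₁ (D.writes ρ rs') := ⟨_, rfl⟩
  rw [← hM₂] at habs hrun2 happ'
  have hupd'' : ∀ w ∈ D.writes ρ rs', D.Linked M₁ w.1 ∧ w.2.key = (M₁ w.1).key ∧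
      w.2.val = (M₁ w.1).val := by
    intro w hw
    rcases hupd' w hw with ⟨-, k', v', h1⟩ | h1
    · rw [hρc] at h1
      cases h1
    · exact ⟨h1.1.1, h1.2⟩
  -- the delete adds edges to explored nodes only
  have hlinked2 : ∀ x, D.Linked M₂ x → D.Linked M₁ x := by
    intro x hx
    induction hx with
    | refl => exact Relation.ReflTransGen.refl
    | @tail x y _ he ih =>
      obtain ⟨lab, hlab⟩ := he
      rcases happ' x with h1 | ⟨w, hw1, rfl, h1⟩
      · rw [h1] at hlab
        exact ih.tail ⟨lab, hlab⟩
      · rw [h1] at hlab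
        exact pnodes_explored_linked ht'.1.val (hD.linked_of_read hrun1 ht'.1) (hdel w hw1 _ hlab)
  have hkey2 : ∀ x, (M₂ x).key = (M₁ x).key ∧ (M₂ x).val = (M₁ x).val := by
    intro x
    rcases happ' x with h1 | ⟨w, hw1, rfl, h1⟩
    · rw [h1]; exact ⟨rfl, rfl⟩
    · rw [h1]; exact (hupd'' w hw1).2
  have hll : l ++ [(π, rs), (ρ, rs')] = l ++ [(π, rs)] ++ [(ρ, rs')] := by simp
  refine ⟨(π, rs), (ρ, rs'), M₂, hπc, ?_⟩
  constructor
  · rw [hll]; exact hrun2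
  · exact habs
  · intro x hx
    rcases hlinked1 x (hlinked2 x hx) with rfl | h1
    -- the delete keeps the key of the new node, so it must have unlinked it
    · exact absurd ⟨_, hx, by rw [(hkey2 _).1, hkey]⟩ habs
    · exact h.linked_init x h1
  · intro s
    rw [(hkey2 _).1, (hkey2 _).2, ← (h.key_eq s).1, ← (h.key_eq s).2]
    rcases happ (.init s) with h1 | ⟨w, hw1, hws, h1⟩
    · rw [h1]; exact ⟨rfl, rfl⟩
    · rw [h1]
      rcases hupd w hw1 with ⟨h2, -⟩ | h2
      · rw [hws] at h2; cases h2
      · rw [← hws]; exact h2.2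
  · intro i hi
    have hiπ : π.id ≠ i := hi (π, rs) (by simp)
    rw [← h.blank i fun x hx => hi x (by simp [hx])]
    have h1 : M₁ (.new i) = M (.new i) := by
      rcases happ (.new i) with h1 | ⟨w, hw1, hws, -⟩
      · exact h1
      · rcases hupd w hw1 with ⟨h2, -⟩ | ⟨h2, -⟩
        · rw [hws, Elem.new.injEq] at h2
          exact absurd h2.symm hiπ
        · obtain ⟨s, hs⟩ := h.linked_init _ h2.1
          rw [hws] at hs
          cases hs
    rw [← h1]
    rcases happ' (.new i) with h2 | ⟨w, hw1, hws, -⟩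
    · exact h2
    · have h3 := (hupd'' w hw1).1
      rw [hws] at h3
      rcases hlinked1 _ h3 with h4 | h4
      · rw [Elem.new.injEq] at h4
        exact absurd h4.symm hiπ
      · obtain ⟨s, hs⟩ := h.linked_init _ h4
        cases hs
  · intro x hx
    simp only [List.mem_append, List.mem_cons, List.not_mem_nil, or_false, List.length_append,
      List.length_cons, List.length_nil] at hx ⊢
    rcases hx with hx | rfl | rfl
    · have := h.ids x hx; omega
    · simp only; omega
    · simp only; omega
  · intro x hx
    simp only [List.mem_append, List.mem_cons, List.not_mem_nil, or_false] at hx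
    rcases hx with hx | rfl | rfl
    · exact h.writes_ne x hx
    · exact hw
    · exact hw'
  · intro x hx
    simp only [List.mem_append, List.mem_cons, List.not_mem_nil, or_false] at hx
    rcases hx with hx | rfl | rfl
    · exact h.calls x hx
    · exact Or.inl ⟨v, hπc⟩
    · exact Or.inr hρc
  · rw [List.countP_append, List.countP_append, h.balanced]
    simp [hπc, hρc, Call.isInsert, Call.isDelete]

/-- Alternating inserts and deletes of a key, two states with the same graph are met: there are
finitely many graphs on the initial nodes, as labels come from a finite set and lists of descendants
have no repetitions. -/
theorem IsSearchStructure.exists_recurrent_state (hD : IsSearchStructure D) (k : ℕ) (v : D.V)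
    (coin : D.C) : ∃ l₁ a d l₂ M M', BalancedRun D k l₁ M ∧ a.1.call = .insert k v ∧
      BalancedRun D k (l₁ ++ a :: d :: l₂) M' ∧ ∀ x, D.Linked M x → M' x = M x := by
  classical
  have := hD.finite_init
  have := hD.finite_label
  have := Fintype.ofFinite D.S
  have := Fintype.ofFinite D.L
  choose a d M' ha hd using fun (s : {s : List (D.Op × D.Vw) × D.Mem // BalancedRun D k s.1 s.2}) =>
    s.2.insert_delete hD v coin
  let next : {s : List (D.Op × D.Vw) × D.Mem // BalancedRun D k s.1 s.2} →
      {s : List (D.Op × D.Vw) × D.Mem // BalancedRun D k s.1 s.2} :=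
    fun s => ⟨(s.1.1 ++ [a s, d s], M' s), hd s⟩
  let st : ℕ → {s : List (D.Op × D.Vw) × D.Mem // BalancedRun D k s.1 s.2} :=
    fun m => next^[m] ⟨([], D.initMem), hD.balancedRun_nil k⟩
  have hst : ∀ m, st (m + 1) = next (st m) := fun m => Function.iterate_succ_apply' _ _ _
  have hext : ∀ i m, ∃ l₂, (st (i + 1 + m)).1.1 =
      (st i).1.1 ++ a (st i) :: d (st i) :: l₂ := by
    intro i m
    induction m with
    | zero => exact ⟨[], by rw [Nat.add_zero, hst]⟩
    | succ m ih =>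
      obtain ⟨l₂, h2⟩ := ih
      refine ⟨l₂ ++ [a (st (i + 1 + m)), d (st (i + 1 + m))], ?_⟩
      rw [← Nat.add_assoc, hst]
      simp only [next]
      rw [h2]
      simp
  -- the lists of descendants of the initial nodes in the `m`-th state, where they are lists without
  -- repetitions of initial nodes, as for all nodes of the graph; `G` has finitely many values
  let G : ℕ → D.S → Option {l : List (D.L × D.E) // ∃ l' : {l : List (D.L × D.S) // l.Nodup},
      l = l'.1.map fun e => (e.1, Elem.init e.2)} := fun m s =>
    if h : ∃ l' : {l : List (D.L × D.S) // l.Nodup},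
        ((st m).1.2 (.init s)).succ = l'.1.map fun e => (e.1, Elem.init e.2)
    then some ⟨((st m).1.2 (.init s)).succ, h⟩ else none
  have hfin : Finite {l : List (D.L × D.E) // ∃ l' : {l : List (D.L × D.S) // l.Nodup},
      l = l'.1.map fun e => (e.1, Elem.init e.2)} := by
    refine Finite.of_surjective (fun l' : {l : List (D.L × D.S) // l.Nodup} =>
      ⟨l'.1.map fun e => (e.1, Elem.init e.2), l', rfl⟩) ?_
    rintro ⟨_, l', rfl⟩
    exact ⟨l', rfl⟩
  have hsucc : ∀ m s, D.Linked (st m).1.2 (.init s) →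
      ∃ l' : {l : List (D.L × D.S) // l.Nodup},
        ((st m).1.2 (.init s)).succ = l'.1.map fun e => (e.1, Elem.init e.2) := by
    intro m s hs
    have hb := (st m).2
    have h1 : ∀ e ∈ ((st m).1.2 (.init s)).succ, ∃ t, e.2 = .init t :=
      fun e he => hb.linked_init e.2 (hs.tail ⟨e.1, he⟩)
    have h2 := hD.nodup _ _ hb.run _ hs
    obtain ⟨l', hl'⟩ : ∃ l' : List (D.L × D.S),
        ((st m).1.2 (.init s)).succ = l'.map fun e => (e.1, Elem.init e.2) := by
      generalize ((st m).1.2 (.init s)).succ = l at h1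
      clear h2
      induction l with
      | nil => exact ⟨[], rfl⟩
      | cons e l ih =>
        obtain ⟨l', rfl⟩ := ih fun e he => h1 e (by simp [he])
        obtain ⟨t, ht⟩ := h1 e (by simp)
        exact ⟨(e.1, t) :: l', by rw [List.map_cons, ← ht]⟩
    rw [hl'] at h2
    exact ⟨⟨l', h2.of_map⟩, hl'⟩
  obtain ⟨i, j, hij, hG⟩ := Finite.exists_ne_map_eq_of_infinite G
  wlog hlt : i < j generalizing i j
  · exact this j i hij.symm hG.symm (by omega)
  obtain ⟨l₂, hl₂⟩ := hext i (j - (i + 1))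
  rw [show i + 1 + (j - (i + 1)) = j by omega] at hl₂
  refine ⟨(st i).1.1, a (st i), d (st i), l₂, (st i).1.2, (st j).1.2, (st i).2, ha _,
    by rw [← hl₂]; exact (st j).2, ?_⟩
  intro x hx
  obtain ⟨s, rfl⟩ := (st i).2.linked_init x hx
  have h1 := congrFun hG s
  simp only [G] at h1
  rw [dif_pos (hsucc i s hx)] at h1
  split at h1
  · simp only [Option.some.injEq, Subtype.mk.injEq] at h1
    have h2 := (st i).2.key_eq s
    have h3 := (st j).2.key_eq s
    generalize (st i).1.2 (.init s) = c at *
    generalize (st j).1.2 (.init s) = c' at *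
    cases c; cases c'
    simp_all
  · cases h1

end Sequential

/-! ### Executions of an implementation -/

section Executions

variable {D : SearchData} {n : ℕ}

theorem Done.mono {H H' : List (Event D n)} (h : H ⊆ H') {π : D.Op} (hd : Done H π) : Done H' π := by
  obtain ⟨e, he, h1⟩ := hd
  exact ⟨e, h he, h1⟩

theorem Aborted.mono {H H' : List (Event D n)} (h : H ⊆ H') {π : D.Op} (hd : Aborted H π) :
    Aborted H' π := by
  obtain ⟨e, he, h1⟩ := hd
  exact ⟨e, h he, h1⟩

theorem react_cases (π : D.Op) (rs : D.Vw) (w : ℕ) (b : Bool) (o : Out D) :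
    ((react π rs w b o).2 = .idle ∧
      ((∃ r, (react π rs w b o).1 = [.res r]) ∨ (react π rs w b o).1 = [.abort])) ∨
    ((∃ rs' w' b', (react π rs w b o).2 = .running π rs' w' b') ∧
      ((react π rs w b o).1 = [] ∨ ∃ k, (react π rs w b o).1 = [k] ∧ k ≠ .inv ∧ k ≠ .abort ∧
        ∀ r, k ≠ .res r)) := by
  unfold react
  split <;> simp

namespace Impl

theorem stepResult_fst (I : Impl D n) (c : I.Config) (p : Fin n) (π : D.Op) (rs : D.Vw) (w : ℕ)
    (b : Bool) : ∃ o, (I.stepResult c p π rs w b).1 =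
        (react π rs w b o).1.map (fun k => ⟨p, π, k⟩) ∧
      (I.stepResult c p π rs w b).2.st = Function.update c.st p (react π rs w b o).2 := by
  exact ⟨_, rfl, rfl⟩

/-- The effects of a step on the history and on the statuses: an invocation by an idle process; a
response, normal or `⊥`, after which the process is idle; or at most one event in the middle of an
operation. -/
theorem Step.cases {I : Impl D n} {H H' : List (Event D n)} {c c' : I.Config} {a : Act D n}
    (h : I.Step H c a H' c') : ∃ p π s, c'.st = Function.update c.st p s ∧
      ((c.st p = .idle ∧ (∀ e ∈ H, e.op.id ≠ π.id) ∧ s = .running π [] 0 false ∧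
          H' = H ++ [⟨p, π, .inv⟩]) ∨
       ((∃ rs w b, c.st p = .running π rs w b) ∧
         ((s = .idle ∧ ((∃ r, H' = H ++ [⟨p, π, .res r⟩]) ∨ H' = H ++ [⟨p, π, .abort⟩])) ∨
          ((∃ rs w b, s = .running π rs w b) ∧ (H' = H ∨ ∃ k, H' = H ++ [⟨p, π, k⟩] ∧ k ≠ .inv ∧
            k ≠ .abort ∧ ∀ r, k ≠ .res r))))) := by
  cases h with
  | @invoke p π hi hf => exact ⟨p, π, _, rfl, Or.inl ⟨hi, hf, rfl, rfl⟩⟩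
  | @step p π rs w b hs =>
    obtain ⟨o, h1, h2⟩ := I.stepResult_fst c p π rs w b
    refine ⟨p, π, _, h2, Or.inr ⟨⟨_, _, _, hs⟩, ?_⟩⟩
    rw [h1]
    rcases react_cases π rs w b o with ⟨h3, h4⟩ | ⟨h3, h4⟩
    · refine Or.inl ⟨h3, ?_⟩
      rcases h4 with ⟨r, h4⟩ | h4
      · exact Or.inl ⟨r, by rw [h4]; rfl⟩
      · exact Or.inr (by rw [h4]; rfl)
    · refine Or.inr ⟨h3, ?_⟩
      rcases h4 with h4 | ⟨k, h4, h5⟩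
      · exact Or.inl (by rw [h4]; simp)
      · exact Or.inr ⟨k, by rw [h4]; rfl, h5⟩

theorem Step.append {I : Impl D n} {H H' : List (Event D n)} {c c' : I.Config} {a : Act D n}
    (h : I.Step H c a H' c') : H' = H ∨ ∃ e, H' = H ++ [e] := by
  obtain ⟨p, π, s, -, h | h⟩ := h.cases
  · exact Or.inr ⟨_, h.2.2.2⟩
  · rcases h.2 with ⟨-, ⟨r, h⟩ | h⟩ | ⟨-, h | ⟨k, h, -⟩⟩
    exacts [Or.inr ⟨_, h⟩, Or.inr ⟨_, h⟩, Or.inl h, Or.inr ⟨_, h⟩]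

theorem Exec.of_prefix {I : Impl D n} {α : List (Event D n)} {c : I.Config} (h : I.Exec α c) :
    ∀ β, β <+: α → ∃ c', I.Exec β c' := by
  induction h with
  | init =>
    intro β hβ
    rw [List.prefix_nil.1 hβ]
    exact ⟨_, .init⟩
  | snoc he hs ih =>
    intro β hβ
    rcases hs.append with h1 | ⟨e, h1⟩
    · exact ih β (h1 ▸ hβ)
    · rw [h1, List.prefix_concat_iff] at hβ
      rcases hβ with rfl | hβ
      · exact ⟨_, h1 ▸ he.snoc hs⟩
      · exact ih β hβ

/-- How the statuses of the processes are reflected in the history. -/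
structure StatusInv (α : List (Event D n)) (st : Fin n → Status D) : Prop where
  ended : ∀ e ∈ α, (∃ rs w b, st e.proc = .running e.op rs w b) ∨ Done α e.op ∨ Aborted α e.op
  running : ∀ q π rs w b, st q = .running π rs w b →
    (∃ e ∈ α, e.proc = q ∧ e.op = π) ∧ ¬ Done α π
  proc_eq : ∀ e ∈ α, ∀ e' ∈ α, e.op = e'.op → e.proc = e'.proc

theorem Exec.statusInv {I : Impl D n} {α : List (Event D n)} {c : I.Config} (h : I.Exec α c) :
    StatusInv α c.st := by
  induction h with
  | init => exact ⟨by simp, by simp [initConfig], by simp⟩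
  | @snoc H H' c c' a he hs ih =>
    have hdone : ∀ {x : Event D n} {ρ : D.Op}, Done (H ++ [x]) ρ →
        Done H ρ ∨ (x.op = ρ ∧ ∃ r, x.kind = .res r) := by
      rintro x ρ ⟨y, hy, h1, h2⟩
      rcases List.mem_append.1 hy with hy | hy
      · exact Or.inl ⟨y, hy, h1, h2⟩
      · rw [List.mem_singleton.1 hy] at h1 h2
        exact Or.inr ⟨h1, h2⟩
    obtain ⟨p, π, s, hst, ⟨h1, hf, rfl, rfl⟩ | ⟨⟨rs, w, b, h1⟩, h2⟩⟩ := hs.cases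
    · rw [hst]
      refine ⟨?_, ?_, ?_⟩
      · intro e he
        rcases List.mem_append.1 he with he | he
        · rcases ih.ended e he with h2 | h2 | h2
          · by_cases hp : e.proc = p
            · rw [hp, h1] at h2
              simp at h2
            · exact Or.inl (by rwa [Function.update_of_ne hp])
          · exact Or.inr (Or.inl (h2.mono (List.subset_append_left _ _)))
          · exact Or.inr (Or.inr (h2.mono (List.subset_append_left _ _)))
        · rw [List.mem_singleton.1 he]
          exact Or.inl ⟨_, _, _, Function.update_self _ _ _⟩
      · intro q ρ rs w b hq
        by_cases hp : q = p
        · subst hp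
          rw [Function.update_self] at hq
          cases hq
          refine ⟨⟨⟨q, π, .inv⟩, by simp⟩, fun hd => ?_⟩
          rcases hdone hd with ⟨y, hy, h3, -⟩ | ⟨-, r, h3⟩
          · exact hf y hy (by rw [h3])
          · cases h3
        · rw [Function.update_of_ne hp] at hq
          obtain ⟨⟨e, h2, h3⟩, h4⟩ := ih.running q ρ rs w b hq
          refine ⟨⟨e, List.mem_append_left _ h2, h3⟩, fun hd => ?_⟩
          rcases hdone hd with h5 | ⟨-, r, h3⟩
          · exact h4 h5
          · cases h3
      · intro e he e' he' hee
        rcases List.mem_append.1 he with he | he <;> rcases List.mem_append.1 he' with he' | he'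
        · exact ih.proc_eq e he e' he' hee
        · rw [List.mem_singleton.1 he'] at hee
          exact absurd (by rw [hee]) (hf e he)
        · rw [List.mem_singleton.1 he] at hee
          exact absurd (by rw [← hee]) (hf e' he')
        · rw [List.mem_singleton.1 he, List.mem_singleton.1 he']
    · obtain ⟨⟨e₀, he₀, hp₀, ho₀⟩, hnd⟩ := ih.running p π rs w b h1
      have hproc : ∀ k : Kind D, ∀ e ∈ H ++ [(⟨p, π, k⟩ : Event D n)],
          ∀ e' ∈ H ++ [(⟨p, π, k⟩ : Event D n)], e.op = e'.op → e.proc = e'.proc := by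
        intro k e he e' he' hee
        rcases List.mem_append.1 he with he | he <;> rcases List.mem_append.1 he' with he' | he'
        · exact ih.proc_eq e he e' he' hee
        · rw [List.mem_singleton.1 he'] at hee ⊢
          rw [ih.proc_eq e he e₀ he₀ (by rw [hee, ho₀]), hp₀]
        · rw [List.mem_singleton.1 he] at hee ⊢
          rw [ih.proc_eq e' he' e₀ he₀ (by rw [← hee, ho₀]), hp₀]
        · rw [List.mem_singleton.1 he, List.mem_singleton.1 he']
      have hother : ∀ q ρ rs w b, q ≠ p → c.st q = .running ρ rs w b → ρ ≠ π := by
        rintro q ρ rs w b hq h3 rfl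
        obtain ⟨⟨e, h4, h5, h6⟩, -⟩ := ih.running q ρ rs w b h3
        exact hq (by rw [← h5, ih.proc_eq e h4 e₀ he₀ (by rw [h6, ho₀]), hp₀])
      have hother' : ∀ k : Kind D, ∀ q ρ rs w b, q ≠ p → c.st q = .running ρ rs w b →
          (∃ e ∈ H ++ [(⟨p, π, k⟩ : Event D n)], e.proc = q ∧ e.op = ρ) ∧
            ¬ Done (H ++ [(⟨p, π, k⟩ : Event D n)]) ρ := by
        intro k q ρ rs w b hq h3
        obtain ⟨⟨e, h4, h5⟩, h6⟩ := ih.running q ρ rs w b h3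
        refine ⟨⟨e, List.mem_append_left _ h4, h5⟩, fun hd => ?_⟩
        rcases hdone hd with h7 | ⟨h7, -⟩
        · exact h6 h7
        · exact hother q ρ rs w b hq h3 h7.symm
      have hended : ∀ k : Kind D, ((∃ rs w b, s = .running π rs w b) ∨ k = .abort ∨
          ∃ r, k = .res r) → ∀ e ∈ H ++ [(⟨p, π, k⟩ : Event D n)],
          (∃ rs w b, Function.update c.st p s e.proc = .running e.op rs w b) ∨
          Done (H ++ [(⟨p, π, k⟩ : Event D n)]) e.op ∨
            Aborted (H ++ [(⟨p, π, k⟩ : Event D n)]) e.op := by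
        intro k hk
        have hπ : (∃ rs w b, Function.update c.st p s p = .running π rs w b) ∨
            Done (H ++ [(⟨p, π, k⟩ : Event D n)]) π ∨
            Aborted (H ++ [(⟨p, π, k⟩ : Event D n)]) π := by
          rw [Function.update_self]
          rcases hk with hk | rfl | ⟨r, rfl⟩
          · exact Or.inl hk
          · exact Or.inr (Or.inr ⟨_, List.mem_append_right _ (List.mem_singleton_self _), rfl, rfl⟩)
          · exact Or.inr (Or.inl ⟨_, List.mem_append_right _ (List.mem_singleton_self _), rfl,
              r, rfl⟩)
        intro e he
        rcases List.mem_append.1 he with he | he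
        · rcases ih.ended e he with h2 | h2 | h2
          · by_cases hp : e.proc = p
            · rw [hp, h1] at h2
              obtain ⟨_, _, _, h2⟩ := h2
              cases h2
              rw [hp]
              exact hπ
            · exact Or.inl (by rwa [Function.update_of_ne hp])
          · exact Or.inr (Or.inl (h2.mono (List.subset_append_left _ _)))
          · exact Or.inr (Or.inr (h2.mono (List.subset_append_left _ _)))
        · rw [List.mem_singleton.1 he]
          exact hπ
      rw [hst]
      rcases h2 with ⟨rfl, h2⟩ | ⟨⟨rs', w', b', rfl⟩, h2⟩
      · have : ∃ k : Kind D, H' = H ++ [⟨p, π, k⟩] ∧ (k = .abort ∨ ∃ r, k = .res r) := by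
          rcases h2 with ⟨r, h2⟩ | h2
          exacts [⟨_, h2, Or.inr ⟨r, rfl⟩⟩, ⟨_, h2, Or.inl rfl⟩]
        obtain ⟨k, rfl, hk⟩ := this
        refine ⟨hended k (Or.inr hk), ?_, hproc k⟩
        intro q ρ rs w b hq
        by_cases hp : q = p
        · subst hp
          rw [Function.update_self] at hq
          cases hq
        · rw [Function.update_of_ne hp] at hq
          exact hother' k q ρ rs w b hp hq
      · rcases h2 with rfl | ⟨k, rfl, -, -, h3⟩
        · refine ⟨?_, ?_, ih.proc_eq⟩
          · intro e he
            rcases ih.ended e he with h2 | h2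
            · by_cases hp : e.proc = p
              · rw [hp, h1] at h2
                obtain ⟨_, _, _, h2⟩ := h2
                cases h2
                exact Or.inl ⟨_, _, _, by rw [hp, Function.update_self]⟩
              · exact Or.inl (by rwa [Function.update_of_ne hp])
            · exact Or.inr h2
          · intro q ρ rs w b hq
            by_cases hp : q = p
            · subst hp
              rw [Function.update_self] at hq
              cases hq
              exact ⟨⟨e₀, he₀, hp₀, ho₀⟩, hnd⟩
            · rw [Function.update_of_ne hp] at hq
              exact ih.running q ρ rs w b hq
        · refine ⟨hended k (Or.inl ⟨_, _, _, rfl⟩), ?_, hproc k⟩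
          intro q ρ rs w b hq
          by_cases hp : q = p
          · subst hp
            rw [Function.update_self] at hq
            cases hq
            refine ⟨⟨e₀, List.mem_append_left _ he₀, hp₀, ho₀⟩, fun hd => ?_⟩
            rcases hdone hd with h7 | ⟨-, r, h7⟩
            · exact hnd h7
            · exact h3 r h7
          · rw [Function.update_of_ne hp] at hq
            exact hother' k q ρ rs w b hp hq

/-- When a process invokes an operation, its earlier operations have ended. -/
theorem Exec.ended_of_inv {I : Impl D n} {α : List (Event D n)} {c : I.Config} (h : I.Exec α c) :
    ∀ A f B, α = A ++ f :: B → f.kind = .inv → ∀ e ∈ A, e.proc = f.proc →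
      Done α e.op ∨ Aborted α e.op := by
  induction h with
  | init => simp
  | @snoc H H' c c' a he hs ih =>
    intro A f B hα hf e hA hp
    rcases hs.append with rfl | ⟨x, rfl⟩
    · exact ih A f B hα hf e hA hp
    rcases List.eq_nil_or_concat' B with rfl | ⟨B, y, rfl⟩
    · obtain ⟨rfl, h1⟩ := List.append_inj' hα rfl
      simp only [List.cons.injEq, and_true] at h1
      subst h1
      obtain ⟨q, π, s, -, h1 | h1⟩ := hs.cases
      · have h2 : x = ⟨q, π, .inv⟩ := by simpa using h1.2.2.2
        rcases he.statusInv.ended e hA with h3 | h3 | h3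
        · rw [hp, h2, h1.1] at h3
          simp at h3
        · exact Or.inl (h3.mono (List.subset_append_left _ _))
        · exact Or.inr (h3.mono (List.subset_append_left _ _))
      · exfalso
        rcases h1.2 with ⟨-, ⟨r, h2⟩ | h2⟩ | ⟨-, h2 | ⟨k, h2, h3, -⟩⟩
        · have h2 : x = ⟨q, π, .res r⟩ := by simpa using h2
          rw [h2] at hf; cases hf
        · have h2 : x = ⟨q, π, .abort⟩ := by simpa using h2
          rw [h2] at hf; cases hf
        · simp at h2
        · have h2 : x = ⟨q, π, k⟩ := by simpa using h2
          rw [h2] at hf; exact h3 hf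
    · rw [← List.cons_append, ← List.append_assoc] at hα
      obtain ⟨h1, -⟩ := List.append_inj' hα rfl
      rcases ih A f B h1 hf e hA hp with h3 | h3
      · exact Or.inl (h3.mono (List.subset_append_left _ _))
      · exact Or.inr (h3.mono (List.subset_append_left _ _))

end Impl

theorem exported_eq_self {α : List (Event D n)} (h : ∀ e ∈ α, e.kind ≠ .abort) :
    exported α = α := by
  induction α with
  | nil => rfl
  | cons e α ih =>
    rw [exported, if_neg, ih fun x hx => h x (List.mem_cons_of_mem _ hx)]
    rintro ⟨e', h1, h2⟩
    exact h e' (List.mem_cons_of_mem _ (List.mem_of_find?_eq_some h1)) h2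

/-! ### Pessimistic implementations -/

namespace Impl

/-- In a deadlock-free pessimistic implementation, a process that executes an operation while all
other processes are idle completes it. -/
theorem exists_solo_completion {I : Impl D n} (hP : I.Pessimistic) (hdf : I.DeadlockFree)
    {α : List (Event D n)} {c : I.Config} (h : I.Exec α c) {p : Fin n} {π : D.Op} {rs : D.Vw}
    {w : ℕ} {b : Bool} (hp : c.st p = .running π rs w b) (hq : ∀ q ≠ p, c.st q = .idle) :
    ∃ β c', I.Exec (α ++ β) c' ∧ (∀ e ∈ β, e.op = π ∧ e.proc = p) ∧ Done (α ++ β) π := by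
  by_contra hcon
  push Not at hcon
  -- otherwise `p` could take steps forever, staying in the middle of `π`
  let Good : List (Event D n) × I.Config → Prop := fun s => ∃ β, s.1 = α ++ β ∧ I.Exec s.1 s.2 ∧
    (∀ e ∈ β, e.op = π ∧ e.proc = p) ∧ (∃ rs w b, s.2.st p = .running π rs w b) ∧
    ∀ q ≠ p, s.2.st q = .idle
  have hstep : ∀ s : {s // Good s}, ∃ s' : {s // Good s},
      I.Step s.1.1 s.1.2 (.step p) s'.1.1 s'.1.2 := by
    rintro ⟨⟨H, c₁⟩, β, hHβ, he, hβ, ⟨rs, w, b, hs⟩, hi⟩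
    obtain rfl : H = α ++ β := hHβ
    have h1 : I.Step (α ++ β) c₁ (.step p) _ _ := .step hs
    have he' := he.snoc h1
    obtain ⟨o, h2, h3⟩ := I.stepResult_fst c₁ p π rs w b
    rw [h2] at h1 he'
    have hβ' : ∀ e ∈ β ++ (react π rs w b o).1.map (fun k => (⟨p, π, k⟩ : Event D n)),
        e.op = π ∧ e.proc = p := by
      intro e he
      rcases List.mem_append.1 he with he | he
      · exact hβ e he
      · obtain ⟨k, -, rfl⟩ := List.mem_map.1 he
        exact ⟨rfl, rfl⟩
    refine ⟨⟨(_, _), _, List.append_assoc _ _ _, he', hβ', ?_, ?_⟩, h1⟩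
    · simp only [h3, Function.update_self]
      rcases react_cases π rs w b o with ⟨-, ⟨r, h4⟩ | h4⟩ | ⟨h4, -⟩
      · rw [List.append_assoc] at he'
        exact absurd ⟨⟨p, π, .res r⟩, by simp [h4], rfl, r, rfl⟩ (hcon _ _ he' hβ')
      · exact absurd rfl (hP _ _ he' ⟨p, π, .abort⟩ (by simp [h4]))
      · exact h4
    · intro q hqp
      simp only [h3, Function.update_of_ne hqp]
      exact hi q hqp
  choose nxt hnxt using hstep
  let s₀ : {s // Good s} := ⟨(α, c), [], by simp, h, by simp, ⟨_, _, _, hp⟩, hq⟩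
  let s : ℕ → {s // Good s} := fun t => nxt^[t] s₀
  have hs : ∀ t, s (t + 1) = nxt (s t) := fun t => Function.iterate_succ_apply' _ _ _
  obtain ⟨t, -, q, ρ, r, ht⟩ := hdf (fun t => (s t).1.1) (fun t => (s t).1.2) (fun _ => .step p) h
    (fun t => by simp only [hs]; exact hnxt _)
    (fun q t hne => ⟨t, le_rfl, by
      by_contra hqp
      obtain ⟨β, -, -, -, -, h1⟩ := (s t).2
      exact hne (h1 q fun h2 => hqp (by rw [h2]))⟩)
    p 0 (by simp [s, s₀, hp])
  obtain ⟨β, h1, h2, h3, -, -⟩ := (s (t + 1)).2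
  rw [h1] at h2
  refine hcon β _ h2 h3 ⟨⟨q, ρ, .res r⟩, ?_, ?_, r, rfl⟩
  · rw [← h1, ht]
    simp
  · obtain ⟨β', h4, -⟩ := (s t).2
    have h5 : β = β' ++ [⟨q, ρ, .res r⟩] := by
      rw [h1, h4, List.append_assoc] at ht
      exact List.append_cancel_left ht
    exact (h3 ⟨q, ρ, .res r⟩ (by simp [h5])).1

end Impl

/-! ### Counting responses -/

/-- The event is a normal response of an operation whose call satisfies `P`. -/
def Event.isResOf (P : Call D.V → Bool) (e : Event D n) : Bool :=
  match e.kind with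
  | .res _ => P e.op.call
  | _ => false

/-- The response `true` of an operation whose call satisfies `P` and has key `k`. -/
def isSuccess (P : Call D.V → Bool) (k : ℕ) (o : D.Op) (r : D.R) : Bool :=
  match r with
  | .bool b => b && P o.call && o.call.key == k
  | _ => false

/-- The event is a response `true` of an operation whose call satisfies `P` and has key `k`. -/
def Event.isSuccessOf (P : Call D.V → Bool) (k : ℕ) (e : Event D n) : Bool :=
  match e.kind with
  | .res r => isSuccess P k e.op r
  | _ => false

/-- In a legal run of the dictionary, the successful inserts of a key exceed its successful deletes
by one if the key is present at the end, and are equally many otherwise. -/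
theorem SearchData.dict_count {l : List (D.Op × D.R)} {q : ℕ → Option D.E}
    (h : D.dict.Runs l q) (k : ℕ) :
    l.countP (fun x => isSuccess Call.isInsert k x.1 x.2) =
      l.countP (fun x => isSuccess Call.isDelete k x.1 x.2) + (if q k = none then 0 else 1) := by
  have key : ∀ (l : List (D.dict.Op × D.dict.Res)) (q : D.dict.St), D.dict.Runs l q →
      l.countP (fun x : D.dict.Op × D.dict.Res => isSuccess (D := D) Call.isInsert k x.1 x.2) =
        l.countP (fun x : D.dict.Op × D.dict.Res => isSuccess (D := D) Call.isDelete k x.1 x.2) +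
          (if (q : ℕ → Option D.E) k = none then 0 else 1) := by
    intro l q h
    induction h with
    | nil => simp [SearchData.dict]
    | @snoc l q q' o r _ hd ih =>
      rw [List.countP_append, List.countP_append, ih]
      simp only [List.countP_singleton]
      change OpInst D.V D.C at o
      change Resp D.S at r
      change ℕ → Option D.E at q
      change ℕ → Option D.E at q'
      simp only [SearchData.dict] at hd
      obtain ⟨id, call, coin⟩ := o
      cases call with
      | insert k' v =>
        rcases hd with ⟨h1, rfl, rfl⟩ | ⟨h1, rfl, rfl⟩
        · by_cases hk : k = k'
          · subst hk
            simp [isSuccess, Call.isInsert, Call.isDelete, Call.key, h1]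
          · simp [isSuccess, Call.isInsert, Call.isDelete, Call.key, Function.update_of_ne hk,
              Ne.symm hk]
        · simp [isSuccess]
      | delete k' =>
        rcases hd with ⟨h1, rfl, rfl⟩ | ⟨h1, rfl, rfl⟩
        · by_cases hk : k = k'
          · subst hk
            simp [isSuccess, Call.isInsert, Call.isDelete, Call.key, h1]
          · simp [isSuccess, Call.isInsert, Call.isDelete, Call.key, Function.update_of_ne hk,
              Ne.symm hk]
        · simp [isSuccess]
      | find k' =>
        obtain ⟨rfl, ⟨x, -, rfl⟩ | ⟨-, rfl⟩⟩ := hd <;> simp [isSuccess]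
  exact key l q h

theorem perm_of_procSub_eq {H H' : List (Event D n)} (h : ∀ p, procSub H p = procSub H' p) :
    H.Perm H' := by
  classical
  rw [List.perm_iff_count]
  intro e
  have h1 : ∀ X : List (Event D n), X.count e = (procSub X e.proc).count e := by
    intro X
    rw [procSub, List.count_filter (by simp)]
  rw [h1 H, h1 H', h]

theorem countP_highSeq (P : Call D.V → Bool) (k : ℕ) (l : List (Fin n × D.Op × D.R)) :
    (highSeq l).countP (Event.isSuccessOf P k) =
      (l.map Prod.snd).countP (fun x => isSuccess P k x.1 x.2) := by
  induction l with
  | nil => rfl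
  | cons x l ih =>
    simp only [highSeq, List.flatMap_cons, List.countP_append, List.map_cons, List.countP_cons]
    rw [show List.countP _ (l.flatMap _) = _ from ih]
    simp [Event.isSuccessOf, Nat.add_comm]
    rfl

theorem Event.isSuccessOf_res {P : Call D.V → Bool} {k : ℕ} {e : Event D n}
    (h : e.isSuccessOf P k = true) : ∃ r, e.kind = .res r := by
  unfold Event.isSuccessOf at h
  split at h
  · exact ⟨_, by assumption⟩
  · cases h

/-- In a linearizable history all of whose operations are complete, the successful inserts of a key
exceed its successful deletes by at most one. -/
theorem Linearizable.count_le {H : List (Event D n)} (h : Linearizable (highLevel H))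
    (hna : ∀ e ∈ H, e.kind ≠ .abort) (hd : ∀ e ∈ H, Done H e.op) (k : ℕ) :
    H.countP (Event.isSuccessOf Call.isInsert k) ≤
      H.countP (Event.isSuccessOf Call.isDelete k) + 1 := by
  classical
  have hab : ∀ π, ¬ Aborted H π := fun π ⟨e, he, _, h1⟩ => hna e he h1
  have hres : ∀ e ∈ H, (∃ r, e.kind = .res r) → e ∈ highLevel H := by
    intro e he hr
    simp [highLevel, he, hab, hr]
  have hsub : ∀ e ∈ highLevel H, e ∈ H := fun e he => List.mem_of_mem_filter he
  have hdone : ∀ e ∈ highLevel H, Done (highLevel H) e.op := by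
    intro e he
    obtain ⟨f, hf, h1, h2⟩ := hd e (hsub e he)
    exact ⟨f, hres f hf h2, h1, h2⟩
  obtain ⟨E, -, hE, l, q, hl, hp, -⟩ := h
  have hE0 : E = [] := by
    cases E with
    | nil => rfl
    | cons e E =>
      obtain ⟨-, h1, f, hf, h2, -⟩ := hE e (by simp)
      exact absurd (h2 ▸ hdone f hf) h1
  subst hE0
  rw [List.append_nil] at hp
  have hcount : ∀ P, (l.map Prod.snd).countP (fun x => isSuccess P k x.1 x.2) =
      H.countP (Event.isSuccessOf P k) := by
    intro P
    rw [← countP_highSeq, (perm_of_procSub_eq hp).countP_eq, completePart, List.countP_filter,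
      highLevel, List.countP_filter]
    apply List.countP_congr
    intro e he
    simp only [Bool.and_eq_true, decide_eq_true_eq, and_assoc]
    refine ⟨fun h => h.1, fun h => ⟨h, ?_, hab _, Or.inr (Event.isSuccessOf_res h)⟩⟩
    exact hdone e (hres e he (Event.isSuccessOf_res h))
  have h1 : H.countP (Event.isSuccessOf Call.isInsert k) =
      H.countP (Event.isSuccessOf Call.isDelete k) +
        (if (q : ℕ → Option D.E) k = none then 0 else 1) := by
    rw [← hcount, ← hcount]
    exact SearchData.dict_count hl k
  rw [h1]
  split <;> omega

theorem mem_opEvents_op {p : Fin n} {π : D.Op} {rs : D.Vw} {e : Event D n}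
    (h : e ∈ opEvents p π rs) : e.op = π ∧ e.proc = p := by
  simp only [opEvents, List.mem_map] at h
  obtain ⟨k, -, rfl⟩ := h
  exact ⟨rfl, rfl⟩

/-- In a locally serializable history, an operation that writes can only respond `true`. -/
theorem LocallySerializable.resp_eq_true {H : List (Event D n)} (h : LocallySerializable H)
    {e e' : Event D n} (he : e ∈ H) (he' : e' ∈ H) (hop : e'.op = e.op) {r : D.R}
    (hr : e.kind = .res r) {x : D.E} {c : D.N} (hw : e'.kind = .writeInv x c) :
    r = .bool true := by
  classical
  obtain ⟨S, ⟨l, M, p, π, rs, T, hrun, hf, ht, hT, rfl⟩, hS⟩ := h e he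
  have hrun' := hrun.snoc hf ht
  have hmem : ∀ f ∈ H, f.op = e.op → f.kind ≠ .abort →
      ∃ p' rs', (e.op, rs') ∈ l.map Prod.snd ++ [(π, rs)] ∧ f ∈ opEvents p' e.op rs' := by
    intro f hf' h1 h2
    have h3 : f ∈ localSub H e.op := by simp [localSub, hf', h1, h2]
    rw [hS, opSub, List.mem_filter] at h3
    rcases List.mem_append.1 h3.1 with h4 | h4
    · obtain ⟨⟨p', π', rs'⟩, h5, h6⟩ := List.mem_flatMap.1 h4
      have h7 := (mem_opEvents_op h6).1
      simp only at h7
      rw [h1] at h7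
      subst h7
      exact ⟨p', rs', List.mem_append_left _ (List.mem_map.2 ⟨_, h5, rfl⟩), h6⟩
    · have h6 := hT.subset h4
      have h7 := (mem_opEvents_op h6).1
      rw [h1] at h7
      subst h7
      exact ⟨p, rs, by simp, h6⟩
  obtain ⟨p₁, rs₁, h1, h2⟩ := hmem e he rfl (by rw [hr]; simp)
  obtain ⟨p₂, rs₂, h3, h4⟩ := hmem e' he' hop (by rw [hw]; simp)
  have h5 := hrun'.eq_of_id_eq _ h1 _ h3 rfl
  simp only [Prod.mk.injEq, true_and] at h5
  subst h5
  have h6 : D.writes e.op rs₁ ≠ [] := by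
    intro h0
    simp only [opEvents, List.mem_map] at h4
    obtain ⟨k', hk, rfl⟩ := h4
    simp only at hw
    simp [h0, hw] at hk
  simp only [opEvents, List.mem_map] at h2
  obtain ⟨k', hk, hk'⟩ := h2
  have h7 : k' = .res r := by rw [← hr, ← hk']
  rw [h7] at hk
  have h8 : r = D.resp e.op rs₁ := by simpa using hk
  rw [h8, D.resp_of_writes_ne_nil h6]

theorem skel_eq_mem {H H' : List (Event D n)} (h : skel H = skel H') {e : Event D n} (he : e ∈ H) :
    ∃ e' ∈ H', e'.proc = e.proc ∧ e'.op = e.op ∧ e'.kind.skel = e.kind.skel := by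
  have h1 : (e.proc, e.op, e.kind.skel) ∈ skel H := List.mem_map.2 ⟨e, he, rfl⟩
  rw [h] at h1
  obtain ⟨e', h2, h3⟩ := List.mem_map.1 h1
  simp only [Prod.mk.injEq] at h3
  exact ⟨e', h2, h3⟩

theorem Kind.skel_eq_inv {k : Kind D} (h : k.skel = .inv) : k = .inv := by
  cases k <;> simp_all [Kind.skel]

theorem Kind.skel_eq_res {k : Kind D} {r : D.R} (h : k.skel = (Kind.res r).skel) :
    ∃ r', k = .res r' := by
  cases k <;> simp_all [Kind.skel]

theorem Kind.skel_eq_writeInv {k : Kind D} {x : D.E} {c : D.N}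
    (h : k.skel = (Kind.writeInv x c).skel) : k = .writeInv x c := by
  cases k <;> simp_all [Kind.skel]

theorem Done.of_skel_eq {H H' : List (Event D n)} (h : skel H = skel H') {π : D.Op}
    (hd : Done H π) : Done H' π := by
  obtain ⟨e, he, rfl, r, hr⟩ := hd
  obtain ⟨e', he', -, h2, h3⟩ := skel_eq_mem h he
  rw [hr] at h3
  exact ⟨e', he', h2, Kind.skel_eq_res h3⟩

theorem countP_isResOf_congr (P : Call D.V → Bool) {H H' : List (Event D n)}
    (h : skel H = skel H') : H.countP (Event.isResOf P) = H'.countP (Event.isResOf P) := by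
  have key : ∀ X : List (Event D n), X.countP (Event.isResOf P) =
      (skel X).countP (fun x => match x.2.2 with | .res => P x.2.1.call | _ => false) := by
    intro X
    rw [skel, List.countP_map]
    apply List.countP_congr
    rintro ⟨p, π, k⟩ -
    cases k <;> simp [Event.isResOf, Kind.skel]
  rw [key, key, h]

/-- A schedule that no pessimistic implementation accepts: after its part `H₁`, an insert `π` of `k`
has started writing but has not returned, and the inserts of `k` that returned already exceed the
deletes by one. In a pessimistic implementation `π` could run on alone; it would return `true`, and
the inserts would exceed the deletes by two. As every process invokes an operation in `H₂`, no
further, forever incomplete operation can be hidden in `H₁`. -/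
theorem Impl.ClassP.not_accepts {I : Impl D n} (hI : I.ClassP) {H₁ H₂ : List (Event D n)} {k : ℕ}
    {π : D.Op} {p : Fin n} (hinv : ∀ q, ∃ f ∈ H₂, f.proc = q ∧ f.kind = .inv)
    (hwrite : ∀ e ∈ H₁, ∃ e' ∈ H₁, e'.op = e.op ∧ ∃ x c, e'.kind = .writeInv x c)
    (hdone : ∀ e ∈ H₁, e.op ≠ π → Done H₁ e.op) (hnd : ¬ Done H₁ π)
    (hproc : ∀ e ∈ H₁, e.op = π → e.proc = p) (hex : ∃ e ∈ H₁, e.op = π)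
    (hkey : ∀ e ∈ H₁, e.op.call.key = k) (hπ : π.call.isInsert = true)
    (hcount : H₁.countP (Event.isResOf Call.isInsert) =
      H₁.countP (Event.isResOf Call.isDelete) + 1) : ¬ I.Accepts (skel (H₁ ++ H₂)) := by
  classical
  rintro ⟨α, c, hα, hσ⟩
  obtain ⟨hlsl, hpess, hdf⟩ := hI
  rw [exported_eq_self (hpess α c hα), completePart] at hσ
  simp only [skel, List.map_append] at hσ
  obtain ⟨X, Y, hXY, hX, hY⟩ := List.map_eq_append_iff.1 hσ
  obtain ⟨A, B, rfl, hA, hB⟩ := List.filter_eq_append_iff.1 hXY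
  have hnoab : ∀ ρ, ¬ Aborted (A ++ B) ρ := fun ρ ⟨e, he, _, h1⟩ => hpess _ _ hα e he h1
  -- the process of an operation that starts in `A` invokes another one in `B`, hence completes it
  have hAdone : ∀ e ∈ A, Done (A ++ B) e.op := by
    intro e he
    obtain ⟨f, hf, h1, h2⟩ := hinv e.proc
    obtain ⟨f', hf', h3, -, h5⟩ := skel_eq_mem (H := H₂) (H' := Y) (by simp only [skel, hY]) hf
    rw [h2] at h5
    have h6 : f' ∈ B := by
      rw [← hB] at hf'
      exact List.mem_of_mem_filter hf'
    obtain ⟨B₁, B₂, rfl⟩ := List.append_of_mem h6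
    rcases hα.ended_of_inv (A ++ B₁) f' B₂ (by simp) (Kind.skel_eq_inv h5) e (by simp [he])
      (by rw [h3, h1]) with h7 | h7
    · exact h7
    · exact absurd h7 (hnoab _)
  have hXA : X = A := by
    rw [← hA, List.filter_eq_self]
    simpa using hAdone
  subst hXA
  have hsk : skel X = skel H₁ := hX
  obtain ⟨c₁, hc₁⟩ := hα.of_prefix X (List.prefix_append _ _)
  have hst := hc₁.statusInv
  have hndX : ¬ Done X π := fun h => hnd (h.of_skel_eq hsk)
  have hnoabX : ∀ ρ, ¬ Aborted X ρ := fun ρ h => hnoab ρ (h.mono (List.subset_append_left _ _))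
  have hdoneX : ∀ e ∈ X, e.op ≠ π → Done X e.op := by
    intro e he hne
    obtain ⟨e', he', -, h2, -⟩ := skel_eq_mem hsk he
    exact h2 ▸ (hdone e' he' (h2 ▸ hne)).of_skel_eq hsk.symm
  have hprocX : ∀ e ∈ X, e.op = π → e.proc = p := by
    intro e he h1
    obtain ⟨e', he', h2, h3, -⟩ := skel_eq_mem hsk he
    rw [← h2]
    exact hproc e' he' (h3.trans h1)
  obtain ⟨rs, w, b, hp⟩ : ∃ rs w b, c₁.st p = .running π rs w b := by
    obtain ⟨e, he, h1⟩ := hex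
    obtain ⟨e', he', h2, h3, -⟩ := skel_eq_mem hsk.symm he
    rw [h1] at h3
    rcases hst.ended e' he' with h4 | h4 | h4
    · rwa [h3, hprocX e' he' h3] at h4
    · exact absurd (h3 ▸ h4) hndX
    · exact absurd h4 (hnoabX _)
  have hq : ∀ q ≠ p, c₁.st q = .idle := by
    intro q hqp
    cases h1 : c₁.st q with
    | idle => rfl
    | running ρ rs w b =>
      obtain ⟨⟨e, he, h2, h3⟩, h4⟩ := hst.running q ρ rs w b h1
      by_cases h5 : e.op = π
      · exact absurd (h2.symm.trans (hprocX e he h5)) hqp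
      · exact absurd (h3 ▸ hdoneX e he h5) h4
  -- after `X`, only `π` is in progress, and so `p` can complete it alone
  obtain ⟨β, c', hc', hβ, hβd⟩ := exists_solo_completion hpess hdf hc₁ hp hq
  have hna := hpess _ _ hc'
  have hl := hlsl _ _ hc'
  rw [exported_eq_self hna] at hl
  have hdG : ∀ e ∈ X ++ β, Done (X ++ β) e.op := by
    intro e he
    by_cases h1 : e.op = π
    · rw [h1]; exact hβd
    · rcases List.mem_append.1 he with he | he
      · exact (hdoneX e he h1).mono (List.subset_append_left _ _)
      · exact absurd (hβ e he).1 h1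
  have hopG : ∀ e ∈ X ++ β, ∃ e' ∈ H₁, e'.op = e.op := by
    intro e he
    rcases List.mem_append.1 he with he | he
    · obtain ⟨e', he', -, h2, -⟩ := skel_eq_mem hsk he
      exact ⟨e', he', h2⟩
    · rw [(hβ e he).1]; exact hex
  -- every operation has invoked a write, so that it can only respond `true`
  have htrue : ∀ e ∈ X ++ β, ∀ r, e.kind = .res r → r = .bool true := by
    intro e he r hr
    obtain ⟨e₁, he₁, h1⟩ := hopG e he
    obtain ⟨e₂, he₂, h2, x, c, h3⟩ := hwrite e₁ he₁
    obtain ⟨e₃, he₃, -, h4, h5⟩ := skel_eq_mem hsk.symm he₂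
    rw [h3] at h5
    exact hl.1.resp_eq_true he (List.mem_append_left _ he₃) (by rw [h4, h2, h1]) hr
      (Kind.skel_eq_writeInv h5)
  have hcountG : ∀ P, (X ++ β).countP (Event.isSuccessOf P k) =
      H₁.countP (Event.isResOf P) + β.countP (Event.isResOf P) := by
    intro P
    rw [← countP_isResOf_congr P hsk, ← List.countP_append]
    apply List.countP_congr
    intro e he
    obtain ⟨e₁, he₁, h1⟩ := hopG e he
    have h2 := hkey e₁ he₁
    rw [h1] at h2
    have h3 := htrue e he
    unfold Event.isSuccessOf Event.isResOf
    cases h4 : e.kind with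
    | res r => rw [h3 r h4]; simp [isSuccess, h2]
    | _ => simp
  have hle := hl.2.count_le hna hdG k
  rw [hcountG, hcountG, hcount] at hle
  have h1 : 0 < β.countP (Event.isResOf Call.isInsert) := by
    obtain ⟨e, he, h1, r, h2⟩ := hβd
    rcases List.mem_append.1 he with he | he
    · exact absurd ⟨e, he, h1, r, h2⟩ hndX
    · exact List.countP_pos_iff.2 ⟨e, he, by simp [Event.isResOf, h2, h1, hπ]⟩
  have h2 : β.countP (Event.isResOf Call.isDelete) = 0 := by
    rw [List.countP_eq_zero]
    intro e he
    unfold Event.isResOf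
    rw [(hβ e he).1]
    have h3 : π.call.isDelete = false := by
      cases h4 : π.call <;> simp_all [Call.isInsert, Call.isDelete]
    split <;> simp [h3]
  omega

end Executions

/-! ### Legal histories and sequential runs -/

section Histories

variable {D : SearchData} {n : ℕ}

/-- The writes of a history. -/
def writesOf (H : List (Event D n)) : List (D.E × D.N) :=
  H.filterMap (fun e => match e.kind with
    | .writeInv x c => some (x, c)
    | _ => none)

/-- Legality of a history that starts in the memory `M`. -/
def LegalFrom (M : D.Mem) (H : List (Event D n)) : Prop :=
  ∀ A e B x c, H = A ++ e :: B → e.kind = .readRes x c → c = applyWrites M (writesOf A) x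

theorem legal_iff_legalFrom (H : List (Event D n)) : Legal H ↔ LegalFrom D.initMem H := Iff.rfl

theorem legalFrom_nil (M : D.Mem) : LegalFrom M ([] : List (Event D n)) := by
  intro A e B x c h
  simp at h

theorem legalFrom_cons (M : D.Mem) (e : Event D n) (H : List (Event D n)) :
    LegalFrom M (e :: H) ↔ (∀ x c, e.kind = .readRes x c → c = M x) ∧
      LegalFrom (applyWrites M (writesOf [e])) H := by
  constructor
  · intro h
    refine ⟨fun x c hk => h [] e H x c rfl hk, fun A f B x c hH hk => ?_⟩
    rw [← applyWrites_append]
    have := h (e :: A) f B x c (by rw [hH]; rfl) hk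
    rwa [show e :: A = [e] ++ A from rfl, writesOf, List.filterMap_append] at this
  · rintro ⟨h1, h2⟩ A f B x c hH hk
    cases A with
    | nil =>
      simp only [List.nil_append, List.cons.injEq] at hH
      rw [← hH.1] at hk
      exact h1 x c hk
    | cons g A =>
      simp only [List.cons_append, List.cons.injEq] at hH
      obtain ⟨rfl, hH⟩ := hH
      have := h2 A f B x c hH hk
      rw [← applyWrites_append] at this
      rwa [show e :: A = [e] ++ A from rfl, writesOf, List.filterMap_append]

theorem legalFrom_append (M : D.Mem) (H H' : List (Event D n)) :
    LegalFrom M (H ++ H') ↔ LegalFrom M H ∧ LegalFrom (applyWrites M (writesOf H)) H' := by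
  induction H generalizing M with
  | nil => simp [legalFrom_nil, writesOf]
  | cons e H ih =>
    rw [List.cons_append, legalFrom_cons, legalFrom_cons, ih, and_assoc, ← applyWrites_append,
      show e :: H = [e] ++ H from rfl, writesOf, writesOf, writesOf, List.filterMap_append]

theorem LegalFrom.of_prefix {M : D.Mem} {H H' : List (Event D n)} (h : LegalFrom M H')
    (hp : H <+: H') : LegalFrom M H := by
  obtain ⟨t, rfl⟩ := hp
  exact ((legalFrom_append _ _ _).1 h).1

/-- Without writes, legality means that all reads return what the memory holds. -/
theorem legalFrom_of_reads {M : D.Mem} {H : List (Event D n)} (hw : writesOf H = [])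
    (hr : ∀ e ∈ H, ∀ x c, e.kind = .readRes x c → c = M x) : LegalFrom M H := by
  intro A e B x c hH hk
  rw [hH, writesOf, List.filterMap_append, List.append_eq_nil_iff] at hw
  rw [writesOf, hw.1, applyWrites_nil]
  exact hr e (by rw [hH]; simp) x c hk

theorem legalFrom_of_no_read {M : D.Mem} {H : List (Event D n)}
    (hr : ∀ e ∈ H, ∀ x c, e.kind ≠ .readRes x c) : LegalFrom M H :=
  fun A e B x c hH hk => absurd hk (hr e (by rw [hH]; simp) x c)

/-- The interface events of completed reads. -/
def readKinds (rs : D.Vw) : List (Kind D) :=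
  rs.flatMap (fun e : D.E × D.N => [Kind.readInv e.1, Kind.readRes e.1 e.2])

/-- The interface events of completed writes. -/
def writeKinds (ws : List (D.E × D.N)) : List (Kind D) :=
  ws.flatMap (fun w : D.E × D.N => [Kind.writeInv w.1 w.2, Kind.writeRes w.1])

theorem opEvents_eq (p : Fin n) (π : D.Op) (rs : D.Vw) :
    opEvents p π rs = ([Kind.inv] ++ readKinds rs ++ writeKinds (D.writes π rs) ++
      [Kind.res (D.resp π rs)]).map (Event.mk p π) := rfl

theorem mem_readKinds {rs : D.Vw} {k : Kind D} :
    k ∈ readKinds rs ↔ ∃ e ∈ rs, k = .readInv e.1 ∨ k = .readRes e.1 e.2 := by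
  simp only [readKinds, List.mem_flatMap, List.mem_cons, List.not_mem_nil, or_false]

theorem mem_writeKinds {ws : List (D.E × D.N)} {k : Kind D} :
    k ∈ writeKinds ws ↔ ∃ e ∈ ws, k = .writeInv e.1 e.2 ∨ k = .writeRes e.1 := by
  simp only [writeKinds, List.mem_flatMap, List.mem_cons, List.not_mem_nil, or_false]

theorem writesOf_readKinds (p : Fin n) (π : D.Op) (rs : D.Vw) :
    writesOf ((readKinds rs).map (Event.mk p π)) = [] := by
  induction rs with
  | nil => rfl
  | cons e rs ih => exact ih

theorem writesOf_writeKinds (p : Fin n) (π : D.Op) (ws : List (D.E × D.N)) :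
    writesOf ((writeKinds ws).map (Event.mk p π)) = ws := by
  induction ws with
  | nil => rfl
  | cons e ws ih => exact congrArg (e :: ·) ih

theorem writesOf_append (H H' : List (Event D n)) :
    writesOf (H ++ H') = writesOf H ++ writesOf H' := List.filterMap_append

theorem writesOf_opEvents (p : Fin n) (π : D.Op) (rs : D.Vw) :
    writesOf (opEvents p π rs) = D.writes π rs := by
  rw [opEvents_eq]
  simp only [List.map_append, writesOf_append, writesOf_readKinds, writesOf_writeKinds]
  simp [writesOf]

theorem legalFrom_opEvents {M : D.Mem} {p : Fin n} {π : D.Op} {rs : D.Vw}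
    (h : D.PartialTraversal M π rs) : LegalFrom M (opEvents p π rs) := by
  rw [opEvents_eq, List.append_assoc, List.map_append, legalFrom_append]
  constructor
  · apply legalFrom_of_reads
    · rw [List.map_append, writesOf_append, writesOf_readKinds]
      rfl
    · rintro e he x c hk
      obtain ⟨k, hk', rfl⟩ := List.mem_map.1 he
      simp only at hk
      subst hk
      simp only [List.singleton_append, List.mem_cons, reduceCtorEq, mem_readKinds, false_or,
        Kind.readRes.injEq] at hk'
      obtain ⟨e, he', rfl, rfl⟩ := hk'
      exact h.val e he'
  · apply legalFrom_of_no_read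
    rintro e he x c hk
    obtain ⟨k, hk', rfl⟩ := List.mem_map.1 he
    simp only at hk
    subst hk
    simp [mem_writeKinds] at hk'

/-- The sequential history of a sequential run is legal and leads to the same memory. -/
theorem SearchData.SeqRun.legal {l : List (Fin n × D.Op × D.Vw)} {M : D.Mem}
    (h : D.SeqRun (l.map Prod.snd) M) :
    Legal (l.flatMap fun e => opEvents e.1 e.2.1 e.2.2) ∧
      applyWrites D.initMem (writesOf (l.flatMap fun e => opEvents e.1 e.2.1 e.2.2)) = M := by
  generalize hl : l.map Prod.snd = l' at h
  induction h generalizing l with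
  | nil =>
    rw [List.map_eq_nil_iff] at hl
    subst hl
    exact ⟨legalFrom_nil _, rfl⟩
  | @snoc l' M π rs _ _ ht ih =>
    obtain ⟨l₁, l₂, rfl, h1, h2⟩ := List.map_eq_append_iff.1 hl
    obtain ⟨⟨p, π', rs'⟩, rfl⟩ : ∃ x, l₂ = [x] := by
      cases l₂ with
      | nil => simp at h2
      | cons x l₂ =>
        cases l₂ with
        | nil => exact ⟨x, rfl⟩
        | cons => simp at h2
    simp only [List.map_cons, List.map_nil, List.cons.injEq, and_true, Prod.mk.injEq] at h2
    obtain ⟨rfl, rfl⟩ := h2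
    obtain ⟨h3, h4⟩ := ih h1
    simp only [List.flatMap_append, List.flatMap_cons, List.flatMap_nil, List.append_nil]
    rw [legal_iff_legalFrom, legalFrom_append, writesOf_append, applyWrites_append, h4,
      writesOf_opEvents]
    exact ⟨⟨h3, legalFrom_opEvents ht.1⟩, rfl⟩

/-! ### Histories serialized in the order of their responses -/

theorem opSub_append (H H' : List (Event D n)) (π : D.Op) :
    opSub (H ++ H') π = opSub H π ++ opSub H' π := List.filter_append _ _

theorem opSub_eq_self {H : List (Event D n)} {π : D.Op} (h : ∀ e ∈ H, e.op = π) :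
    opSub H π = H := by
  rw [opSub, List.filter_eq_self]
  simpa using h

theorem opSub_eq_nil {H : List (Event D n)} {π : D.Op} (h : ∀ e ∈ H, e.op ≠ π) :
    opSub H π = [] := by
  rw [opSub, List.filter_eq_nil_iff]
  simpa using h

theorem mem_opSub {H : List (Event D n)} {π : D.Op} {e : Event D n} :
    e ∈ opSub H π ↔ e ∈ H ∧ e.op = π := by
  simp [opSub]

theorem localSub_eq (H : List (Event D n)) (π : D.Op) : localSub H π = by
    classical exact (opSub H π).filter (fun e => decide (e.kind ≠ .abort)) := by
  classical
  simp only [localSub, opSub, List.filter_filter]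
  congr
  funext e
  rw [Bool.eq_iff_iff]
  simp [and_comm]

theorem done_iff_opSub {H : List (Event D n)} {π : D.Op} :
    Done H π ↔ ∃ e ∈ opSub H π, ∃ r, e.kind = .res r := by
  simp only [Done, mem_opSub, and_assoc]

theorem aborted_iff_opSub {H : List (Event D n)} {π : D.Op} :
    Aborted H π ↔ ∃ e ∈ opSub H π, e.kind = .abort := by
  simp only [Aborted, mem_opSub, and_assoc]

theorem res_mem_opEvents (p : Fin n) (π : D.Op) (rs : D.Vw) :
    (⟨p, π, .res (D.resp π rs)⟩ : Event D n) ∈ opEvents p π rs := by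
  rw [opEvents_eq]
  simp

theorem inv_mem_opEvents (p : Fin n) (π : D.Op) (rs : D.Vw) :
    (⟨p, π, .inv⟩ : Event D n) ∈ opEvents p π rs := by
  rw [opEvents_eq]
  simp

theorem abort_not_mem_opEvents {p : Fin n} {π : D.Op} {rs : D.Vw} {e : Event D n}
    (h : e ∈ opEvents p π rs) : e.kind ≠ .abort := by
  rw [opEvents_eq] at h
  obtain ⟨k, hk, rfl⟩ := List.mem_map.1 h
  rintro rfl
  simp [mem_readKinds, mem_writeKinds] at hk

/-- The events of `π` in `H`, perhaps followed by `⊥`, are an initial part of what `π` does when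
it is executed after some operations that are complete in `H`. -/
def SafelySerialized (H : List (Event D n)) (π : D.Op) : Prop :=
  ∃ (p : Fin n) (rs : D.Vw) (l : List (Fin n × D.Op × D.Vw)) (M : D.Mem) (T : List (Event D n)),
    D.SeqRun (l.map Prod.snd) M ∧ D.Fresh (l.map Prod.snd) π ∧ D.Traversal M π rs ∧
    T <+: opEvents p π rs ∧ (∀ x ∈ l, opSub H x.2.1 = opEvents x.1 x.2.1 x.2.2) ∧
    (opSub H π = T ∨ opSub H π = T ++ [⟨p, π, .abort⟩])

/-- `l` lists the complete operations of `H` with their processes and reads; executed in this order,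
they do the same reads and lead to the memory `M`. -/
structure Serialization (H : List (Event D n)) (M : D.Mem) (l : List (Fin n × D.Op × D.Vw)) :
    Prop where
  run : D.SeqRun (l.map Prod.snd) M
  opSub_eq : ∀ x ∈ l, opSub H x.2.1 = opEvents x.1 x.2.1 x.2.2
  mem_of_done : ∀ π, Done H π → ∃ x ∈ l, x.2.1 = π
  procSub_eq : ∀ p, procSub (completePart H) p =
    (l.filter fun x => decide (x.1 = p)).flatMap fun x => opEvents x.1 x.2.1 x.2.2
  order : ∀ π ρ, Precedes H π ρ → Done H ρ → [π, ρ].Sublist (l.map fun x => x.2.1)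
  safe : ∀ A e B, H = A ++ e :: B → SafelySerialized (A ++ [e]) e.op

theorem precedes_flatMap {ι : Type*} (f : ι → List (Event D n)) {l : List ι} {x y : ι}
    (h : [x, y].Sublist l) {e e' : Event D n} (he : e ∈ f x) (hr : ∃ r, e.kind = .res r)
    (he' : e' ∈ f y) (hi : e'.kind = .inv) : Precedes (l.flatMap f) e.op e'.op := by
  refine ⟨e, e', ?_, rfl, hr, rfl, hi⟩
  have h1 : ([e] ++ [e']).Sublist (f x ++ f y) :=
    (List.singleton_sublist.2 he).append (List.singleton_sublist.2 he')
  have h2 : (f x ++ f y).Sublist (l.flatMap f) := by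
    simpa using h.flatMap f
  exact h1.trans h2

theorem sublist_pair_or {ι : Type*} {l : List ι} {x y : ι} (hx : x ∈ l) (hy : y ∈ l)
    (hxy : x ≠ y) : [x, y].Sublist l ∨ [y, x].Sublist l := by
  obtain ⟨s, t, rfl⟩ := List.append_of_mem hx
  rcases List.mem_append.1 hy with hy | hy
  · right
    have : ([y] ++ [x]).Sublist (s ++ x :: t) :=
      (List.singleton_sublist.2 hy).append (List.singleton_sublist.2 (by simp))
    exact this
  · left
    have hy : y ∈ t := by simpa [Ne.symm hxy] using hy
    exact ((List.singleton_sublist.2 hy).cons_cons x).trans (List.sublist_append_right _ _)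

theorem precedes_opEvents {l : List (Fin n × D.Op × D.Vw)} {x y : Fin n × D.Op × D.Vw}
    (h : [x, y].Sublist l) :
    Precedes (l.flatMap fun x => opEvents x.1 x.2.1 x.2.2) x.2.1 y.2.1 :=
  precedes_flatMap (fun x : Fin n × D.Op × D.Vw => opEvents x.1 x.2.1 x.2.2) h
    (res_mem_opEvents x.1 x.2.1 x.2.2) ⟨_, rfl⟩ (inv_mem_opEvents y.1 y.2.1 y.2.2) rfl

/-- An event of an operation is followed by its last event. -/
theorem exists_last_event {H : List (Event D n)} {π : D.Op} (h : ∃ e ∈ H, e.op = π) :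
    ∃ A e B, H = A ++ e :: B ∧ e.op = π ∧ ∀ e' ∈ B, e'.op ≠ π := by
  induction H with
  | nil => simp at h
  | cons f H ih =>
    by_cases h1 : ∃ e ∈ H, e.op = π
    · obtain ⟨A, e, B, rfl, h2, h3⟩ := ih h1
      exact ⟨f :: A, e, B, rfl, h2, h3⟩
    · push Not at h1
      obtain ⟨e, he, h2⟩ := h
      rcases List.mem_cons.1 he with rfl | he
      · exact ⟨[], e, H, rfl, h2, h1⟩
      · exact absurd h2 (h1 e he)

namespace Serialization

variable {H : List (Event D n)} {M : D.Mem} {l : List (Fin n × D.Op × D.Vw)}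

theorem done (h : Serialization H M l) {x : Fin n × D.Op × D.Vw} (hx : x ∈ l) :
    Done H x.2.1 := by
  rw [done_iff_opSub, h.opSub_eq x hx]
  exact ⟨_, res_mem_opEvents _ _ _, _, rfl⟩

theorem not_aborted (h : Serialization H M l) {π : D.Op} (hπ : Done H π) : ¬ Aborted H π := by
  obtain ⟨x, hx, rfl⟩ := h.mem_of_done π hπ
  rw [aborted_iff_opSub, h.opSub_eq x hx]
  rintro ⟨e, he, h1⟩
  exact abort_not_mem_opEvents he h1

theorem pair_sublist (h : Serialization H M l) {π ρ : D.Op} (hp : Precedes H π ρ)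
    (hd : Done H ρ) : ∃ x y, [x, y].Sublist l ∧ x.2.1 = π ∧ y.2.1 = ρ := by
  obtain ⟨l', h1, h2⟩ := List.sublist_map_iff.1 (h.order π ρ hp hd)
  match l', h2 with
  | [x, y], h2 =>
    simp only [List.map_cons, List.map_nil, List.cons.injEq, and_true] at h2
    exact ⟨x, y, h1, h2.1.symm, h2.2.symm⟩

theorem strictlySerializable (h : Serialization H M l) : StrictlySerializable H := by
  classical
  refine ⟨l.flatMap fun x => opEvents x.1 x.2.1 x.2.2, ?_, h.run.legal.1, ?_, ?_⟩
  · intro e he e' he' hne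
    obtain ⟨x, hx, hex⟩ := List.mem_flatMap.1 he
    obtain ⟨y, hy, hey⟩ := List.mem_flatMap.1 he'
    have h1 := (mem_opEvents_op hex).1
    have h2 := (mem_opEvents_op hey).1
    have hxy : x ≠ y := by
      rintro rfl
      exact hne (h1.trans h2.symm)
    rw [h1, h2]
    rcases sublist_pair_or hx hy hxy with h3 | h3
    · exact Or.inl (precedes_opEvents h3)
    · exact Or.inr (precedes_opEvents h3)
  · intro p
    rw [h.procSub_eq, procSub]
    clear h
    induction l with
    | nil => rfl
    | cons x l ih =>
      rw [List.flatMap_cons, List.filter_append, ih]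
      by_cases hp : x.1 = p
      · rw [List.filter_cons_of_pos (by simpa using hp), List.flatMap_cons, List.filter_eq_self.2]
        intro e he
        simp [(mem_opEvents_op he).2, hp]
      · rw [List.filter_cons_of_neg (by simpa using hp), List.filter_eq_nil_iff.2, List.nil_append]
        intro e he
        simp [(mem_opEvents_op he).2, hp]
  · rintro π ρ ⟨e, e', h1, rfl, hr, rfl, hi⟩
    have h2 : [e, e'].Sublist H := h1.trans List.filter_sublist
    have h3 : Done H e'.op := by
      have := h1.subset (show e' ∈ [e, e'] by simp)
      simpa using (List.mem_filter.1 this).2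
    obtain ⟨x, y, h4, h5, h6⟩ := h.pair_sublist ⟨e, e', h2, rfl, hr, rfl, hi⟩ h3
    rw [← h5, ← h6]
    exact precedes_opEvents h4

theorem linearizable (hD : IsSearchStructure D) (h : Serialization H M l) :
    Linearizable (highLevel H) := by
  classical
  refine ⟨[], by simp, by simp, ?_⟩
  obtain ⟨q, hq, -⟩ := hD.correct _ _ h.run
  have hdone : ∀ π, Done (highLevel H) π ↔ Done H π := by
    intro π
    refine ⟨fun hd => hd.mono fun e he => List.mem_of_mem_filter he, fun hd => ?_⟩
    obtain ⟨e, he, rfl, hr⟩ := id hd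
    exact ⟨e, List.mem_filter.2 ⟨he, by simp [h.not_aborted hd, hr]⟩, rfl, hr⟩
  have hcp : completePart (highLevel H ++ []) =
      (completePart H).filter fun e => decide (e.kind = .inv ∨ ∃ r, e.kind = .res r) := by
    simp only [List.append_nil, completePart, hdone]
    simp only [highLevel, List.filter_filter]
    apply List.filter_congr
    intro e _
    rw [Bool.eq_iff_iff]
    simp only [Bool.and_eq_true, decide_eq_true_eq]
    exact ⟨fun h => ⟨h.2.2, h.1⟩, fun h1 => ⟨h1.2, h.not_aborted h1.2, h1.1⟩⟩
  rw [hcp]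
  refine ⟨l.map fun x => (x.1, x.2.1, D.resp x.2.1 x.2.2), q, ?_, ?_, ?_⟩
  · have h1 : (l.map Prod.snd).map (fun e : D.Op × D.Vw => (e.1, D.resp e.1 e.2)) =
        (l.map fun x => (x.1, x.2.1, D.resp x.2.1 x.2.2)).map Prod.snd := by
      rw [List.map_map, List.map_map]
      rfl
    exact Eq.subst (motive := fun z : List (D.dict.Op × D.dict.Res) => D.dict.Runs z q) h1 hq
  · intro p
    have hcomm : procSub ((completePart H).filter fun e =>
        decide (e.kind = .inv ∨ ∃ r, e.kind = .res r)) p = (procSub (completePart H) p).filter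
          fun e => decide (e.kind = .inv ∨ ∃ r, e.kind = .res r) := by
      simp only [procSub, List.filter_filter]
      apply List.filter_congr
      intro e _
      rw [Bool.and_comm]
    rw [hcomm, h.procSub_eq, procSub]
    clear h hq hdone hcp hcomm
    have hop : ∀ x : Fin n × D.Op × D.Vw, (opEvents x.1 x.2.1 x.2.2).filter
        (fun e => decide (e.kind = .inv ∨ ∃ r, e.kind = .res r)) =
          [⟨x.1, x.2.1, .inv⟩, ⟨x.1, x.2.1, .res (D.resp x.2.1 x.2.2)⟩] := by
      intro x
      rw [opEvents_eq]
      simp only [List.map_append, List.filter_append]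
      have h1 : ((readKinds x.2.2).map (Event.mk x.1 x.2.1)).filter
          (fun e => decide (e.kind = .inv ∨ ∃ r, e.kind = .res r)) = [] := by
        rw [List.filter_eq_nil_iff]
        intro e he
        obtain ⟨k, hk, rfl⟩ := List.mem_map.1 he
        obtain ⟨f, -, rfl | rfl⟩ := mem_readKinds.1 hk <;> simp
      have h2 : ((writeKinds (D.writes x.2.1 x.2.2)).map (Event.mk x.1 x.2.1)).filter
          (fun e => decide (e.kind = .inv ∨ ∃ r, e.kind = .res r)) = [] := by
        rw [List.filter_eq_nil_iff]
        intro e he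
        obtain ⟨k, hk, rfl⟩ := List.mem_map.1 he
        obtain ⟨f, -, rfl | rfl⟩ := mem_writeKinds.1 hk <;> simp
      rw [h1, h2]
      simp
    induction l with
    | nil => rfl
    | cons x l ih =>
      simp only [highSeq, List.map_cons, List.flatMap_cons, List.filter_append] at ih ⊢
      rw [ih]
      by_cases hp : x.1 = p
      · have hc : (x :: l).filter (fun x => decide (x.1 = p)) =
            x :: l.filter (fun x => decide (x.1 = p)) :=
          List.filter_cons_of_pos (by simpa using hp)
        rw [hc, List.flatMap_cons, List.filter_append, hop]
        simp [hp]
      · have hc : (x :: l).filter (fun x => decide (x.1 = p)) =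
            l.filter (fun x => decide (x.1 = p)) :=
          List.filter_cons_of_neg (by simpa using hp)
        rw [hc]
        simp [hp]
  · rintro π ρ ⟨e, e', h1, rfl, hr, rfl, hi⟩
    have h1 := h1.trans List.filter_sublist
    have h2 : [e, e'].Sublist H := h1.trans List.filter_sublist
    have h3 : Done H e'.op := by
      have := h1.subset (show e' ∈ [e, e'] by simp)
      simpa using (List.mem_filter.1 this).2
    obtain ⟨x, y, h4, h5, h6⟩ := h.pair_sublist ⟨e, e', h2, rfl, hr, rfl, hi⟩ h3
    rw [← h5, ← h6]
    exact precedes_flatMap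
      (fun e : Fin n × D.Op × D.R => [⟨e.1, e.2.1, .inv⟩, ⟨e.1, e.2.1, .res e.2.2⟩])
      (h4.map fun x => (x.1, x.2.1, D.resp x.2.1 x.2.2))
      (e := ⟨x.1, x.2.1, .res (D.resp x.2.1 x.2.2)⟩) (e' := ⟨y.1, y.2.1, .inv⟩)
      (by simp) ⟨_, rfl⟩ (by simp) rfl

theorem locallySerializable (h : Serialization H M l) : LocallySerializable H := by
  classical
  intro f hf
  obtain ⟨A, e, B, hH, he, hB⟩ := exists_last_event ⟨f, hf, rfl⟩
  obtain ⟨p, rs, l₁, M₁, T, h1, h2, h3, h4, h5, h6⟩ := h.safe A e B hH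
  rw [he] at h2 h3 h4 h6
  refine ⟨_, ⟨l₁, M₁, p, f.op, rs, T, h1, h2, h3, h4, rfl⟩, ?_⟩
  have h7 : opSub H f.op = opSub (A ++ [e]) f.op := by
    rw [hH, List.append_cons, opSub_append _ B, opSub_eq_nil hB, List.append_nil]
  have h8 : T.filter (fun e => decide (e.kind ≠ .abort)) = T := by
    rw [List.filter_eq_self]
    intro e he
    simpa using abort_not_mem_opEvents (h4.subset he)
  rw [opSub_append, opSub_eq_nil, opSub_eq_self, List.nil_append, localSub_eq, h7]
  · rcases h6 with h6 | h6
    · rw [h6]; exact h8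
    · rw [h6, List.filter_append, h8]
      simp
  · exact fun e he => (mem_opEvents_op (h4.subset he)).1
  · intro e he
    obtain ⟨x, hx, h9⟩ := List.mem_flatMap.1 he
    rw [(mem_opEvents_op h9).1]
    intro h10
    exact h2 x.2 (List.mem_map.2 ⟨x, hx, rfl⟩) (by rw [h10])

theorem safeStrictSerializable (h : Serialization H M l) : SafeStrictSerializable H := by
  refine ⟨h.strictlySerializable, fun A e B hH _ => ?_⟩
  obtain ⟨p, rs, l₁, M₁, T, h1, h2, h3, h4, h5, h6⟩ := h.safe A e B hH
  refine ⟨l₁.map fun x => x.2.1, ?_, ?_, ?_, ?_⟩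
  · have := h1.nodup
    rwa [List.map_map] at this
  · intro hmem
    obtain ⟨x, hx, h7⟩ := List.mem_map.1 hmem
    exact h2 x.2 (List.mem_map.2 ⟨x, hx, rfl⟩) (by rw [h7])
  · intro ρ hρ
    obtain ⟨x, hx, rfl⟩ := List.mem_map.1 hρ
    rw [done_iff_opSub, h5 x hx]
    exact ⟨_, res_mem_opEvents _ _ _, _, rfl⟩
  · have h7 : (l₁.map fun x => x.2.1).flatMap (opSub (A ++ [e])) =
        l₁.flatMap fun x => opEvents x.1 x.2.1 x.2.2 := by
      rw [List.flatMap_map]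
      exact List.flatMap_congr h5
    rw [h7, legal_iff_legalFrom, legalFrom_append, h1.legal.2]
    refine ⟨h1.legal.1, ?_⟩
    have h8 := (legalFrom_opEvents (p := p) h3.1).of_prefix h4
    rcases h6 with h6 | h6
    · rw [h6]; exact h8
    · rw [h6, legalFrom_append]
      exact ⟨h8, legalFrom_of_no_read (by simp)⟩

theorem ne_of_not_done (h : Serialization H M l) {π : D.Op} (hπ : ¬ Done H π)
    {x : Fin n × D.Op × D.Vw} (hx : x ∈ l) : x.2.1 ≠ π := fun h1 => hπ (h1 ▸ h.done hx)

end Serialization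

theorem done_concat {H : List (Event D n)} {e : Event D n} {π : D.Op} :
    Done (H ++ [e]) π ↔ Done H π ∨ (e.op = π ∧ ∃ r, e.kind = .res r) := by
  simp only [Done, List.mem_append, List.mem_singleton]
  constructor
  · rintro ⟨f, hf | rfl, h1, h2⟩
    · exact Or.inl ⟨f, hf, h1, h2⟩
    · exact Or.inr ⟨h1, h2⟩
  · rintro (⟨f, hf, h1, h2⟩ | ⟨h1, h2⟩)
    · exact ⟨f, Or.inl hf, h1, h2⟩
    · exact ⟨e, Or.inr rfl, h1, h2⟩

theorem sublist_pair_concat {ι : Type*} {l : List ι} {x y z : ι} (h : [x, y].Sublist (l ++ [z])) :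
    [x, y].Sublist l ∨ (y = z ∧ x ∈ l) := by
  obtain ⟨l₁, l₂, h1, h2, h3⟩ := List.sublist_append_iff.1 h
  match l₁, l₂ with
  | [], l₂ =>
    rw [List.nil_append] at h1
    have := h3.length_le
    rw [← h1] at this
    simp at this
  | [a], l₂ =>
    simp only [List.singleton_append, List.cons.injEq] at h1
    rw [← h1.2, List.singleton_sublist, List.mem_singleton] at h3
    rw [h1.1]
    exact Or.inr ⟨h3, List.singleton_sublist.1 h2⟩
  | a :: b :: l₁, l₂ =>
    simp only [List.cons_append, List.cons.injEq] at h1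
    obtain ⟨rfl, rfl, h1⟩ := h1
    have h4 := List.append_eq_nil_iff.1 h1.symm
    rw [h4.1] at h2
    exact Or.inl h2

theorem Precedes.of_concat {H : List (Event D n)} {e : Event D n} {π ρ : D.Op}
    (h : Precedes (H ++ [e]) π ρ) :
    Precedes H π ρ ∨ (e.op = ρ ∧ e.kind = .inv) := by
  obtain ⟨f, f', h1, h2, h3, h4, h5⟩ := h
  rcases sublist_pair_concat h1 with h6 | ⟨rfl, -⟩
  · exact Or.inl ⟨f, f', h6, h2, h3, h4, h5⟩
  · exact Or.inr ⟨h4, h5⟩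

theorem Precedes.done {H : List (Event D n)} {π ρ : D.Op} (h : Precedes H π ρ) : Done H π := by
  obtain ⟨f, f', h1, h2, h3, -⟩ := h
  exact ⟨f, h1.subset (by simp), h2, h3⟩

theorem concat_eq_append_cons {ι : Type*} {l A B : List ι} {x y : ι}
    (h : l ++ [x] = A ++ y :: B) : (A = l ∧ y = x) ∨ ∃ B', l = A ++ y :: B' := by
  rcases List.eq_nil_or_concat' B with rfl | ⟨B, z, rfl⟩
  · obtain ⟨rfl, h1⟩ := List.append_inj' h rfl
    simp only [List.cons.injEq, and_true] at h1
    exact Or.inl ⟨rfl, h1.symm⟩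
  · rw [← List.cons_append, ← List.append_assoc] at h
    exact Or.inr ⟨B, (List.append_inj' h rfl).1⟩

theorem SafelySerialized.congr {H H' : List (Event D n)} {π : D.Op} (h : SafelySerialized H π)
    (hπ : opSub H' π = opSub H π) (hd : ∀ ρ, Done H ρ → opSub H' ρ = opSub H ρ) :
    SafelySerialized H' π := by
  obtain ⟨p, rs, l₁, M₁, T, h1, h2, h3, h4, h5, h6⟩ := h
  refine ⟨p, rs, l₁, M₁, T, h1, h2, h3, h4, fun x hx => ?_, hπ ▸ h6⟩
  rw [hd, h5 x hx]
  rw [done_iff_opSub, h5 x hx]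
  exact ⟨_, res_mem_opEvents _ _ _, _, rfl⟩

namespace Serialization

variable {H : List (Event D n)} {M : D.Mem} {l : List (Fin n × D.Op × D.Vw)}

/-- Appending an event, other than a response, of an incomplete operation. -/
theorem append_event (h : Serialization H M l) {e : Event D n} (hnd : ¬ Done H e.op)
    (hk : ∀ r, e.kind ≠ .res r) (hs : SafelySerialized (H ++ [e]) e.op) :
    Serialization (H ++ [e]) M l := by
  classical
  have hd : ∀ π, Done (H ++ [e]) π ↔ Done H π := by
    intro π
    rw [done_concat]
    exact ⟨fun h => h.elim id fun ⟨_, r, h1⟩ => absurd h1 (hk r), Or.inl⟩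
  refine ⟨h.run, ?_, ?_, ?_, ?_, ?_⟩
  · intro x hx
    rw [opSub_append, h.opSub_eq x hx, opSub_eq_nil, List.append_nil]
    simpa using (h.ne_of_not_done hnd hx).symm
  · intro π hπ
    exact h.mem_of_done π ((hd π).1 hπ)
  · intro p
    rw [← h.procSub_eq p, completePart, completePart]
    simp only [hd, List.filter_append]
    simp [hnd]
  · intro π ρ hp hρ
    rw [hd] at hρ
    rcases hp.of_concat with h1 | ⟨rfl, -⟩
    · exact h.order π ρ h1 hρ
    · exact absurd hρ hnd
  · intro A f B hH
    rcases concat_eq_append_cons hH with ⟨rfl, rfl⟩ | ⟨B', h1⟩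
    · exact hs
    · exact h.safe A f B' h1

/-- Removing an event, other than a response, of an incomplete operation. -/
theorem remove_event {X Y : List (Event D n)} {e : Event D n}
    (h : Serialization (X ++ e :: Y) M l) (hnd : ¬ Done (X ++ e :: Y) e.op)
    (hY : ∀ f ∈ Y, f.op ≠ e.op) : Serialization (X ++ Y) M l := by
  classical
  have hsub : (X ++ Y).Sublist (X ++ e :: Y) :=
    List.Sublist.append (List.Sublist.refl X) (List.sublist_cons_self e Y)
  have hop : ∀ (Z : List (Event D n)) π, π ≠ e.op → opSub (X ++ Z) π = opSub (X ++ e :: Z) π := by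
    intro Z π hπ
    rw [opSub_append, opSub_append, show e :: Z = [e] ++ Z from rfl, opSub_append [e],
      opSub_eq_nil (H := [e]), List.nil_append]
    simpa using hπ.symm
  have hd : ∀ π, Done (X ++ Y) π ↔ Done (X ++ e :: Y) π := by
    intro π
    by_cases hπ : π = e.op
    · subst hπ
      exact ⟨fun h1 => absurd (h1.mono hsub.subset) hnd, fun h1 => absurd h1 hnd⟩
    · rw [done_iff_opSub, hop Y π hπ, ← done_iff_opSub]
  refine ⟨h.run, ?_, ?_, ?_, ?_, ?_⟩
  · intro x hx
    rw [hop Y _ (h.ne_of_not_done hnd hx), h.opSub_eq x hx]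
  · intro π hπ
    exact h.mem_of_done π ((hd π).1 hπ)
  · intro p
    rw [← h.procSub_eq p, completePart, completePart]
    simp only [hd, List.filter_append, List.filter_cons, hnd, decide_false, Bool.false_eq_true,
      if_false]
  · rintro π ρ ⟨f, f', h1, h2⟩ hρ
    exact h.order π ρ ⟨f, f', h1.trans hsub, h2⟩ ((hd ρ).1 hρ)
  · intro A f B hH
    rcases List.append_eq_append_iff.1 hH with ⟨Z, rfl, h1⟩ | ⟨Z, rfl, h1⟩
    · have hf : f ∈ Y := by rw [h1]; simp
      have h2 := h.safe (X ++ e :: Z) f B (by rw [h1]; simp)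
      rw [List.append_assoc] at h2 ⊢
      refine h2.congr (hop (Z ++ [f]) _ (hY f hf)) fun ρ hρ => hop (Z ++ [f]) ρ ?_
      rintro rfl
      refine hnd (hρ.mono ?_)
      rw [h1]
      intro g hg
      simp only [List.cons_append, List.mem_append, List.mem_cons, List.not_mem_nil,
        or_false] at hg ⊢
      tauto
    · cases Z with
      | nil =>
        simp only [List.nil_append] at h1
        have hf : f ∈ Y := by rw [← h1]; simp
        have h2 := h.safe (A ++ [e]) f B (by rw [← h1]; simp)
        rw [List.append_nil, List.append_assoc] at *
        refine h2.congr (hop [f] _ (hY f hf)) fun ρ hρ => hop [f] ρ ?_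
        rintro rfl
        refine hnd (hρ.mono ?_)
        rw [← h1]
        intro g hg
        simp only [List.cons_append, List.mem_append, List.mem_cons, List.not_mem_nil,
          or_false, List.nil_append] at hg ⊢
        tauto
      | cons g Z =>
        simp only [List.cons_append, List.cons.injEq] at h1
        obtain ⟨rfl, -⟩ := h1
        exact h.safe A f (Z ++ e :: Y) (by simp)

/-- Appending the response of an operation that has done a traversal of the current memory. -/
theorem append_res (h : Serialization H M l) {p : Fin n} {π : D.Op} {rs : D.Vw}
    {P T : List (Event D n)} (hnd : ¬ Done H π) (hf : D.Fresh (l.map Prod.snd) π)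
    (ht : D.Traversal M π rs)
    (hT : T ++ [⟨p, π, .res (D.resp π rs)⟩] = opEvents p π rs) (hop : opSub H π = T)
    (hproc : procSub H p = P ++ T) (hP : ∀ e ∈ P, e.op ≠ π) :
    Serialization (H ++ [⟨p, π, .res (D.resp π rs)⟩]) (applyWrites M (D.writes π rs))
      (l ++ [(p, π, rs)]) := by
  classical
  have hTop : ∀ e ∈ T, e.op = π ∧ e.proc = p := fun e he =>
    mem_opEvents_op (rs := rs) (by rw [← hT]; simp [he])
  have hopπ : opSub (H ++ [⟨p, π, .res (D.resp π rs)⟩]) π = opEvents p π rs := by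
    rw [opSub_append, hop, ← hT, opSub_eq_self (H := [_])]
    simp
  have hopne : ∀ ρ, ρ ≠ π → opSub (H ++ [⟨p, π, .res (D.resp π rs)⟩]) ρ = opSub H ρ := by
    intro ρ hρ
    rw [opSub_append, opSub_eq_nil (H := [_]), List.append_nil]
    simpa using hρ.symm
  have hd : ∀ ρ, Done (H ++ [⟨p, π, .res (D.resp π rs)⟩]) ρ ↔ Done H ρ ∨ π = ρ := by
    intro ρ
    rw [done_concat]
    simp
  have hopl : ∀ x ∈ l, opSub (H ++ [⟨p, π, .res (D.resp π rs)⟩]) x.2.1 =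
      opEvents x.1 x.2.1 x.2.2 := by
    intro x hx
    rw [hopne _ (h.ne_of_not_done hnd hx), h.opSub_eq x hx]
  refine ⟨?_, ?_, ?_, ?_, ?_, ?_⟩
  · rw [List.map_append]
    exact h.run.snoc hf ht
  · intro x hx
    rcases List.mem_append.1 hx with hx | hx
    · exact hopl x hx
    · rw [List.mem_singleton.1 hx]
      exact hopπ
  · intro ρ hρ
    rcases (hd ρ).1 hρ with h1 | rfl
    · obtain ⟨x, hx, rfl⟩ := h.mem_of_done ρ h1
      exact ⟨x, List.mem_append_left _ hx, rfl⟩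
    · exact ⟨(p, π, rs), by simp, rfl⟩
  · intro q
    have h1 : ∀ X : List (Event D n), procSub (X.filter fun e => decide (Done H e.op)) q =
        (procSub X q).filter fun e => decide (Done H e.op) := by
      intro X
      simp only [procSub, List.filter_filter]
      apply List.filter_congr
      intro e _
      rw [Bool.and_comm]
    have h2 : procSub (completePart (H ++ [⟨p, π, .res (D.resp π rs)⟩])) q =
        (procSub H q).filter (fun e => decide (Done H e.op ∨ π = e.op)) ++
          procSub [⟨p, π, .res (D.resp π rs)⟩] q := by
      simp only [completePart, hd, procSub, List.filter_filter, List.filter_append]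
      congr 1
      · apply List.filter_congr
        intro e _
        rw [Bool.and_comm]
      · by_cases hq : p = q <;> simp [hq]
    have h3 := h.procSub_eq q
    rw [completePart, h1] at h3
    rw [h2, List.filter_append, List.flatMap_append, ← h3]
    by_cases hq : p = q
    · subst hq
      rw [hproc, List.filter_append, List.filter_append]
      have h4 : T.filter (fun e => decide (Done H e.op)) = [] := by
        rw [List.filter_eq_nil_iff]
        intro e he
        simpa [(hTop e he).1] using hnd
      have h5 : T.filter (fun e => decide (Done H e.op ∨ π = e.op)) = T := by
        rw [List.filter_eq_self]
        intro e he
        simp [(hTop e he).1]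
      have h6 : P.filter (fun e => decide (Done H e.op ∨ π = e.op)) =
          P.filter (fun e => decide (Done H e.op)) := by
        apply List.filter_congr
        intro e he
        simp [(hP e he).symm]
      rw [h4, h5, h6, List.append_nil, List.append_assoc]
      simp [procSub, hT]
    · have h4 : (procSub H q).filter (fun e => decide (Done H e.op ∨ π = e.op)) =
          (procSub H q).filter (fun e => decide (Done H e.op)) := by
        apply List.filter_congr
        intro e he
        have h5 : π ≠ e.op := by
          intro h5
          have h6 : e ∈ T := by
            rw [← hop, mem_opSub]
            exact ⟨List.mem_of_mem_filter he, h5.symm⟩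
          have h7 : e.proc = q := by simpa using (List.mem_filter.1 he).2
          exact hq ((hTop e h6).2.symm.trans h7)
        simp [h5]
      rw [h4]
      simp [procSub, hq]
  · intro ρ ρ' hp hρ
    rw [List.map_append]
    have hp : Precedes H ρ ρ' := by
      rcases hp.of_concat with h1 | ⟨-, h1⟩
      · exact h1
      · cases h1
    by_cases h1 : Done H ρ'
    · exact (h.order ρ ρ' hp h1).trans (List.sublist_append_left _ _)
    · obtain rfl : π = ρ' := by simpa [h1] using (hd ρ').1 hρ
      obtain ⟨x, hx, rfl⟩ := h.mem_of_done ρ hp.done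
      have h2 : x.2.1 ∈ l.map fun x => x.2.1 := List.mem_map.2 ⟨x, hx, rfl⟩
      exact (List.singleton_sublist.2 h2).append (List.Sublist.refl [π])
  · intro A f B hH
    rcases concat_eq_append_cons hH with ⟨rfl, rfl⟩ | ⟨B', h1⟩
    · exact ⟨p, rs, l, M, _, h.run, hf, ht, List.prefix_refl _, hopl, Or.inl hopπ⟩
    · exact h.safe A f B' h1

end Serialization

/-! ### The exported history -/

theorem exported_subset {α : List (Event D n)} : exported α ⊆ α := by
  classical
  induction α with
  | nil => simp [exported]
  | cons e α ih =>
    rw [exported]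
    split
    · exact fun x hx => List.mem_cons_of_mem _ (ih hx)
    · exact List.cons_subset_cons _ ih

theorem exported_append {α : List (Event D n)} {f : Event D n} (hf : f.kind ≠ .abort) :
    exported (α ++ [f]) = exported α ++ [f] := by
  classical
  induction α with
  | nil => simp [exported]
  | cons e α ih =>
    rw [List.cons_append, exported, exported, ih]
    have h1 : (∃ e', (α ++ [f]).find? (fun g => decide (g.op = e.op)) = some e' ∧
        e'.kind = .abort) ↔ ∃ e', α.find? (fun g => decide (g.op = e.op)) = some e' ∧
          e'.kind = .abort := by
      rw [List.find?_append]
      cases α.find? (fun g => decide (g.op = e.op)) with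
      | some x => simp
      | none =>
        by_cases h : f.op = e.op <;> simp [h, hf]
    simp only [h1]
    split <;> rfl

theorem exported_append_of_forall_ne {α : List (Event D n)} {f : Event D n}
    (hf : ∀ e ∈ α, e.op ≠ f.op) : exported (α ++ [f]) = exported α ++ [f] := by
  classical
  induction α with
  | nil => simp [exported]
  | cons e α ih =>
    rw [List.cons_append, exported, exported, ih fun x hx => hf x (List.mem_cons_of_mem _ hx)]
    have h1 : (α ++ [f]).find? (fun g => decide (g.op = e.op)) =
        α.find? (fun g => decide (g.op = e.op)) := by
      rw [List.find?_append]
      simp [Ne.symm (hf e (by simp))]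
    rw [h1]
    split <;> rfl

/-- A response `⊥` removes the pending invocation from the exported history. -/
theorem exported_append_abort {α : List (Event D n)} {f : Event D n} (hf : f.kind = .abort)
    (hα : ∃ e ∈ α, e.op = f.op) : ∃ X e Y, exported α = X ++ e :: Y ∧ e.op = f.op ∧
      (∀ e' ∈ Y, e'.op ≠ f.op) ∧ exported (α ++ [f]) = X ++ Y ++ [f] := by
  classical
  induction α with
  | nil => simp at hα
  | cons e α ih =>
    rw [List.cons_append, exported, exported]
    by_cases h1 : ∃ e ∈ α, e.op = f.op
    · obtain ⟨X, e₁, Y, h2, h3, h4, h5⟩ := ih h1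
      have h6 : (α ++ [f]).find? (fun g => decide (g.op = e.op)) =
          α.find? (fun g => decide (g.op = e.op)) := by
        rw [List.find?_append]
        cases h7 : α.find? (fun g => decide (g.op = e.op)) with
        | some x => simp
        | none =>
          have h8 : f.op ≠ e.op := by
            obtain ⟨e', h9, h10⟩ := h1
            rw [List.find?_eq_none] at h7
            rw [← h10]
            simpa using h7 e' h9
          simp [h8]
      rw [h6, h2, h5]
      split
      · exact ⟨X, e₁, Y, rfl, h3, h4, rfl⟩
      · exact ⟨e :: X, e₁, Y, rfl, h3, h4, rfl⟩
    · push Not at h1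
      have he : e.op = f.op := by
        obtain ⟨e', h2, h3⟩ := hα
        rcases List.mem_cons.1 h2 with rfl | h2
        · exact h3
        · exact absurd h3 (h1 e' h2)
      have h2 : α.find? (fun g => decide (g.op = e.op)) = none := by
        rw [List.find?_eq_none]
        intro x hx
        simpa [he] using h1 x hx
      rw [List.find?_append, h2, exported_append_of_forall_ne h1]
      refine ⟨[], e, exported α, ?_, he, ?_, ?_⟩
      · rw [if_neg (by simp)]
        rfl
      · intro x hx
        exact h1 x (exported_subset hx)
      · rw [if_pos ⟨f, by simp [he], hf⟩]
        rfl

end Histories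

/-! ### An optimistic implementation -/

/-- The shared state of the optimistic implementation: the memory as left by the complete
operations, and the process that is about to commit, if any. -/
structure TMState (D : SearchData) (n : ℕ) where
  mem : D.Mem
  lock : Option (Fin n)

section Optimistic

variable {D : SearchData} {n : ℕ}

/-- The reads `rs` agree with the memory `M`. -/
def Current (M : D.Mem) (rs : D.Vw) : Prop := ∀ e ∈ rs, e.2 = M e.1

/-- The operation has done all its reads and writes nothing. -/
def ReadOnlyEnd (π : D.Op) (rs : D.Vw) : Prop := D.nextRead π rs = none ∧ D.writes π rs = []

/-- One step of the optimistic implementation. A read or write takes effect only if the lock is free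
(or owned) and all earlier reads of the operation are still current, and aborts otherwise. With its
last access that can abort (the first write, or the last read of an operation that writes nothing)
an operation takes the lock. Its writes are applied, and the lock is released, when it returns. -/
noncomputable def optimisticStep (p : Fin n) (π : D.Op) (rs : D.Vw) (w : ℕ) (pending : Bool)
    (s : TMState D n) : TMState D n × Out D := by
  classical
  exact match pending, D.next π rs w with
    | false, .done _ => (⟨applyWrites s.mem (D.writes π rs), none⟩, .next)
    | false, _ => (s, .next)
    | true, .read x =>
      if s.lock = none ∧ Current s.mem rs then
        (⟨s.mem, if ReadOnlyEnd π (rs ++ [(x, s.mem x)]) then some p else none⟩, .ret (s.mem x))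
      else (s, .abort)
    | true, .write _ c =>
      if s.lock = some p ∨ (s.lock = none ∧ Current s.mem rs) then (⟨s.mem, some p⟩, .ret c)
      else (s, .abort)
    | true, .done _ => (s, .silent)

/-- The optimistic implementation, with a single base object and no local states. -/
noncomputable def optimistic (D : SearchData) (n : ℕ) : Impl D n where
  Obj := Unit
  Val := fun _ => TMState D n
  initVal := fun _ => ⟨D.initMem, none⟩
  Loc := Unit
  initLoc := fun _ => ()
  prog := fun p st _ => ⟨(), fun s => match st with
    | .idle => (s, (), .silent)
    | .running π rs w b => ((optimisticStep p π rs w b s).1, (), (optimisticStep p π rs w b s).2)⟩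

theorem optimistic_stepResult (c : (optimistic D n).Config) (p : Fin n) (π : D.Op) (rs : D.Vw)
    (w : ℕ) (b : Bool) :
    ((optimistic D n).stepResult c p π rs w b).1 =
      (react π rs w b (optimisticStep p π rs w b (c.mem ())).2).1.map (Event.mk p π) ∧
    ((optimistic D n).stepResult c p π rs w b).2.mem () =
      (optimisticStep p π rs w b (c.mem ())).1 ∧
    ((optimistic D n).stepResult c p π rs w b).2.st =
      Function.update c.st p (react π rs w b (optimisticStep p π rs w b (c.mem ())).2).2 :=
  ⟨rfl, dif_pos rfl, rfl⟩

/-! ### The events of an operation in progress -/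

/-- The invocation that is pending if the next action of the code has been invoked. -/
def pendingKinds : D.Action → List (Kind D)
  | .read x => [.readInv x]
  | .write x c => [.writeInv x c]
  | .done _ => []

/-- The events of `π`, run by `p`, after the reads `rs` and the first `w` writes, with the next
read or write invoked or not. -/
noncomputable def partEvents (p : Fin n) (π : D.Op) (rs : D.Vw) (w : ℕ) (pending : Bool) :
    List (Event D n) :=
  ([Kind.inv] ++ readKinds rs ++ writeKinds ((D.writes π rs).take w) ++
    (if pending then pendingKinds (D.next π rs w) else [])).map (Event.mk p π)

theorem mem_partEvents {p : Fin n} {π : D.Op} {rs : D.Vw} {w : ℕ} {b : Bool} {e : Event D n}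
    (h : e ∈ partEvents p π rs w b) :
    e.op = π ∧ e.proc = p ∧ e.kind ≠ .abort ∧ ∀ r, e.kind ≠ .res r := by
  obtain ⟨k, hk, rfl⟩ := List.mem_map.1 h
  refine ⟨rfl, rfl, ?_⟩
  simp only [List.mem_append, List.mem_singleton, mem_readKinds, mem_writeKinds] at hk
  rcases hk with ((rfl | ⟨e, -, rfl | rfl⟩) | ⟨e, -, rfl | rfl⟩) | hk
  iterate 5 simp
  split at hk
  · cases h : D.next π rs w <;> rw [h] at hk <;> simp [pendingKinds] at hk <;> simp [hk]
  · simp at hk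

theorem inv_mem_partEvents (p : Fin n) (π : D.Op) (rs : D.Vw) (w : ℕ) (b : Bool) :
    (⟨p, π, .inv⟩ : Event D n) ∈ partEvents p π rs w b := by
  simp [partEvents]

theorem partEvents_pending (p : Fin n) (π : D.Op) (rs : D.Vw) (w : ℕ) :
    partEvents p π rs w true =
      partEvents p π rs w false ++ (pendingKinds (D.next π rs w)).map (Event.mk p π) := by
  simp [partEvents]

theorem next_eq_read {π : D.Op} {rs : D.Vw} {w : ℕ} {x : D.E} (h : D.next π rs w = .read x) :
    D.nextRead π rs = some x := by
  unfold SearchData.next at h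
  split at h
  · simp_all
  · split at h <;> cases h

theorem next_eq_write {π : D.Op} {rs : D.Vw} {w : ℕ} {x : D.E} {c : D.N}
    (h : D.next π rs w = .write x c) :
    D.nextRead π rs = none ∧ (D.writes π rs)[w]? = some (x, c) := by
  unfold SearchData.next at h
  split at h
  · cases h
  · split at h
    · next xc h1 => cases h; exact ⟨by assumption, h1⟩
    · cases h

theorem next_eq_done {π : D.Op} {rs : D.Vw} {w : ℕ} {r : D.R} (h : D.next π rs w = .done r) :
    D.nextRead π rs = none ∧ (D.writes π rs).length ≤ w ∧ r = D.resp π rs := by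
  unfold SearchData.next at h
  split at h
  · cases h
  · split at h
    · cases h
    · next h2 => cases h; exact ⟨by assumption, List.getElem?_eq_none_iff.1 h2, rfl⟩

theorem partEvents_readRes (p : Fin n) {π : D.Op} {rs : D.Vw} {x : D.E}
    (h : D.next π rs 0 = .read x) (c : D.N) :
    partEvents p π (rs ++ [(x, c)]) 0 false =
      partEvents p π rs 0 true ++ [⟨p, π, .readRes x c⟩] := by
  simp [partEvents, readKinds, writeKinds, h, pendingKinds]

theorem partEvents_writeRes (p : Fin n) {π : D.Op} {rs : D.Vw} {w : ℕ} {x : D.E} {c : D.N}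
    (h : D.next π rs w = .write x c) :
    partEvents p π rs (w + 1) false = partEvents p π rs w true ++ [⟨p, π, .writeRes x⟩] := by
  simp [partEvents, writeKinds, h, pendingKinds, List.take_add_one, (next_eq_write h).2]

theorem partEvents_res (p : Fin n) {π : D.Op} {rs : D.Vw} {w : ℕ} {r : D.R}
    (h : D.next π rs w = .done r) :
    partEvents p π rs w false ++ [⟨p, π, .res (D.resp π rs)⟩] = opEvents p π rs := by
  rw [opEvents_eq]
  simp [partEvents, List.take_of_length_le (next_eq_done h).2.1]

/-- What an operation has done is an initial part of what it does when run alone, if its reads so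
far are those that it does when run alone. -/
theorem partEvents_prefix {M : D.Mem} {p : Fin n} {π : D.Op} {rs rs' : D.Vw} {w : ℕ} {b : Bool}
    (h : D.PartialTraversal M π rs) (h' : D.Traversal M π rs')
    (hw : 0 < w → D.nextRead π rs = none) : partEvents p π rs w b <+: opEvents p π rs' := by
  obtain ⟨t, rfl⟩ := h.prefix_traversal h'
  rw [opEvents_eq, partEvents]
  apply List.IsPrefix.map
  cases t with
  | cons e t =>
    have h1 := h'.1 rs e ⟨t, by simp⟩
    have hw0 : w = 0 := by
      by_contra h2
      have := hw (Nat.pos_of_ne_zero h2)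
      rw [h1.1] at this
      cases this
    subst hw0
    have h2 : readKinds (rs ++ e :: t) =
        readKinds rs ++ Kind.readInv e.1 :: Kind.readRes e.1 e.2 :: readKinds t := by
      simp [readKinds]
    have h3 : D.next π rs 0 = .read e.1 := by
      unfold SearchData.next
      rw [h1.1]
    rw [h2, h3]
    cases b
    · exact ⟨Kind.readInv e.1 :: Kind.readRes e.1 e.2 :: readKinds t ++
        writeKinds (D.writes π (rs ++ e :: t)) ++ [Kind.res (D.resp π (rs ++ e :: t))],
        by simp [writeKinds]⟩
    · exact ⟨Kind.readRes e.1 e.2 :: readKinds t ++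
        writeKinds (D.writes π (rs ++ e :: t)) ++ [Kind.res (D.resp π (rs ++ e :: t))],
        by simp [writeKinds, pendingKinds]⟩
  | nil =>
    rw [List.append_nil] at h' ⊢
    simp only [List.append_assoc]
    rw [List.prefix_append_right_inj, List.prefix_append_right_inj]
    obtain ⟨ws, hws⟩ : ∃ ws, D.writes π rs = ws := ⟨_, rfl⟩
    have h2 : writeKinds ws = writeKinds (ws.take w) ++ writeKinds (ws.drop w) := by
      rw [writeKinds, writeKinds, writeKinds, ← List.flatMap_append, List.take_append_drop]
    rw [hws, h2, List.append_assoc, List.prefix_append_right_inj]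
    cases b
    · exact List.nil_prefix
    · rw [if_pos rfl]
      cases h3 : D.next π rs w with
      | read x =>
        have := next_eq_read h3
        rw [h'.2] at this
        cases this
      | write x c =>
        have h4 := (next_eq_write h3).2
        rw [hws] at h4
        obtain ⟨h5, h6⟩ := List.getElem?_eq_some_iff.1 h4
        rw [List.drop_eq_getElem_cons h5, h6]
        exact ⟨Kind.writeRes x :: writeKinds (ws.drop (w + 1)) ++ [Kind.res (D.resp π rs)],
          by simp [pendingKinds, writeKinds]⟩
      | done r => exact List.nil_prefix

/-! ### The invariant of the optimistic implementation -/

/-- What is known about an operation in progress: its events, that its reads are those that it would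
do alone after some of the complete operations, and that it owns the lock exactly if none of its
further steps can abort, in which case its reads are current. -/
structure InProgress (H : List (Event D n)) (s : TMState D n) (l : List (Fin n × D.Op × D.Vw))
    (p : Fin n) (π : D.Op) (rs : D.Vw) (w : ℕ) (b : Bool) : Prop where
  opSub_eq : opSub H π = partEvents p π rs w b
  procSub_eq : ∃ P, procSub H p = P ++ partEvents p π rs w b ∧ ∀ e ∈ P, e.op ≠ π
  writing : 0 < w → D.nextRead π rs = none
  pending : b = true → ∀ r, D.next π rs w ≠ .done r
  lock_iff : s.lock = some p ↔ D.nextRead π rs = none ∧ (0 < w ∨ D.writes π rs = [])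
  current : s.lock = some p → D.Traversal s.mem π rs
  seen : ∃ l₁ M₁, l₁ <+: l ∧ D.SeqRun (l₁.map Prod.snd) M₁ ∧ D.PartialTraversal M₁ π rs

/-- The invariant: `l` lists the complete operations in the order of their responses, which is an
order in which they can be serialized. -/
structure OptimisticInv (H : List (Event D n)) (s : TMState D n) (st : Fin n → Status D)
    (l : List (Fin n × D.Op × D.Vw)) : Prop where
  serialization : Serialization H s.mem l
  ids : ∀ e ∈ H, ∀ e' ∈ H, e.op.id = e'.op.id → e.op = e'.op
  inProgress : ∀ p π rs w b, st p = .running π rs w b → InProgress H s l p π rs w b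
  lock_running : ∀ p, s.lock = some p → st p ≠ .idle

theorem InProgress.not_done {H : List (Event D n)} {s : TMState D n}
    {l : List (Fin n × D.Op × D.Vw)} {p : Fin n} {π : D.Op} {rs : D.Vw} {w : ℕ} {b : Bool}
    (h : InProgress H s l p π rs w b) : ¬ Done H π := by
  rw [done_iff_opSub, h.opSub_eq]
  rintro ⟨e, he, r, hr⟩
  exact (mem_partEvents he).2.2.2 r hr

/-- Steps of other processes keep what is known about an operation in progress. -/
theorem InProgress.of_other {H H' : List (Event D n)} {s s' : TMState D n}
    {l l' : List (Fin n × D.Op × D.Vw)} {p : Fin n} {π : D.Op} {rs : D.Vw} {w : ℕ} {b : Bool}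
    (h : InProgress H s l p π rs w b) (hop : opSub H' π = opSub H π)
    (hproc : procSub H' p = procSub H p) (hl : l <+: l')
    (hlock : s'.lock = some p ↔ s.lock = some p) (hmem : s'.lock = some p → s'.mem = s.mem) :
    InProgress H' s' l' p π rs w b where
  opSub_eq := hop ▸ h.opSub_eq
  procSub_eq := hproc ▸ h.procSub_eq
  writing := h.writing
  pending := h.pending
  lock_iff := hlock.trans h.lock_iff
  current := fun h1 => by rw [hmem h1]; exact h.current (hlock.1 h1)
  seen := by
    obtain ⟨l₁, M₁, h1, h2⟩ := h.seen
    exact ⟨l₁, M₁, h1.trans hl, h2⟩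

theorem procSub_append_of_ne (H : List (Event D n)) {e : Event D n} {p : Fin n} (h : e.proc ≠ p) :
    procSub (H ++ [e]) p = procSub H p := by
  simp [procSub, h]

theorem procSub_append_of_eq (H : List (Event D n)) {e : Event D n} {p : Fin n} (h : e.proc = p) :
    procSub (H ++ [e]) p = procSub H p ++ [e] := by
  simp [procSub, h]

theorem opSub_append_of_ne (H : List (Event D n)) {e : Event D n} {π : D.Op} (h : e.op ≠ π) :
    opSub (H ++ [e]) π = opSub H π := by
  rw [opSub_append, opSub_eq_nil (H := [e]) (by simpa using h), List.append_nil]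

theorem opSub_append_of_eq (H : List (Event D n)) {e : Event D n} {π : D.Op} (h : e.op = π) :
    opSub (H ++ [e]) π = opSub H π ++ [e] := by
  rw [opSub_append, opSub_eq_self (H := [e]) (by simpa using h)]

namespace OptimisticInv

variable {H : List (Event D n)} {s : TMState D n} {st : Fin n → Status D}
  {l : List (Fin n × D.Op × D.Vw)}

theorem mem_of_running (h : OptimisticInv H s st l) {p : Fin n} {π : D.Op} {rs : D.Vw} {w : ℕ}
    {b : Bool} (hr : st p = .running π rs w b) : (⟨p, π, .inv⟩ : Event D n) ∈ H := by
  have h1 := inv_mem_partEvents p π rs w b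
  rw [← (h.inProgress p π rs w b hr).opSub_eq, mem_opSub] at h1
  exact h1.1

theorem op_ne_of_ne (h : OptimisticInv H s st l) {p q : Fin n} {π π' : D.Op} {rs rs' : D.Vw}
    {w w' : ℕ} {b b' : Bool} (hp : st p = .running π rs w b) (hq : st q = .running π' rs' w' b')
    (hpq : q ≠ p) : π ≠ π' := by
  rintro rfl
  have h1 := inv_mem_partEvents p π rs w b
  rw [← (h.inProgress p π rs w b hp).opSub_eq, (h.inProgress q π _ _ _ hq).opSub_eq] at h1
  exact hpq (mem_partEvents h1).2.1.symm

theorem mem_of_done (h : OptimisticInv H s st l) {x : Fin n × D.Op × D.Vw} (hx : x ∈ l) :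
    ∃ e ∈ H, e.op = x.2.1 := by
  obtain ⟨e, he, h1, -⟩ := h.serialization.done hx
  exact ⟨e, he, h1⟩

theorem fresh (h : OptimisticInv H s st l) {p : Fin n} {π : D.Op} {rs : D.Vw} {w : ℕ} {b : Bool}
    (hr : st p = .running π rs w b) : D.Fresh (l.map Prod.snd) π := by
  intro ρ hρ hid
  obtain ⟨x, hx, rfl⟩ := List.mem_map.1 hρ
  obtain ⟨e, he, h1⟩ := h.mem_of_done hx
  have h2 := h.ids e he _ (h.mem_of_running hr) (by rw [h1, hid])
  rw [h1] at h2
  simp only at h2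
  exact (h.inProgress p π rs w b hr).not_done (h2 ▸ h.serialization.done hx)

/-- Whatever an operation has seen can be extended to a sequential execution of it. -/
theorem safelySerialized (hD : IsSearchStructure D) {H' : List (Event D n)}
    (hl : ∀ x ∈ l, opSub H' x.2.1 = opEvents x.1 x.2.1 x.2.2) {p : Fin n} {π : D.Op} {rs : D.Vw}
    {w : ℕ} {b : Bool} (hf : D.Fresh (l.map Prod.snd) π)
    (hseen : ∃ l₁ M₁, l₁ <+: l ∧ D.SeqRun (l₁.map Prod.snd) M₁ ∧ D.PartialTraversal M₁ π rs)
    (hw : 0 < w → D.nextRead π rs = none)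
    (hop : opSub H' π = partEvents p π rs w b ∨
      opSub H' π = partEvents p π rs w b ++ [⟨p, π, .abort⟩]) : SafelySerialized H' π := by
  obtain ⟨l₁, M₁, h1, h2, h3⟩ := hseen
  have hf₁ : D.Fresh (l₁.map Prod.snd) π := fun ρ hρ => hf ρ ((h1.map Prod.snd).subset hρ)
  obtain ⟨rs', h4⟩ := hD.terminates _ M₁ h2 π hf₁
  exact ⟨p, rs', l₁, M₁, _, h2, hf₁, h4, partEvents_prefix h3 h4 hw,
    fun x hx => hl x (h1.subset hx), hop⟩

theorem init : OptimisticInv ([] : List (Event D n)) ⟨D.initMem, none⟩ (fun _ => .idle) [] where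
  serialization := by
    refine ⟨.nil, by simp, ?_, fun _ => rfl, ?_, by simp⟩
    · rintro π ⟨e, he, -⟩
      simp at he
    · rintro π ρ ⟨e, e', h1, -⟩
      simp at h1
  ids := by simp
  inProgress := by simp
  lock_running := by simp

theorem invoke (hD : IsSearchStructure D) (h : OptimisticInv H s st l) {p : Fin n} {π : D.Op}
    (hidle : st p = .idle) (hf : ∀ e ∈ H, e.op.id ≠ π.id) :
    OptimisticInv (H ++ [⟨p, π, .inv⟩]) s (Function.update st p (.running π [] 0 false)) l := by
  have hlock : s.lock ≠ some p := fun h1 => h.lock_running p h1 hidle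
  have hop : opSub H π = [] := opSub_eq_nil fun e he h1 => hf e he (by rw [h1])
  have hnd : ¬ Done H π := by
    rw [done_iff_opSub, hop]
    simp
  have hfl : D.Fresh (l.map Prod.snd) π := by
    intro ρ hρ
    obtain ⟨x, hx, rfl⟩ := List.mem_map.1 hρ
    obtain ⟨e, he, h1⟩ := h.mem_of_done hx
    rw [← h1]
    exact hf e he
  have hpart : partEvents p π [] 0 false = [(⟨p, π, .inv⟩ : Event D n)] := by
    simp [partEvents, readKinds, writeKinds]
  have hop' : opSub (H ++ [⟨p, π, .inv⟩]) π = partEvents p π [] 0 false := by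
    rw [opSub_append_of_eq _ rfl, hop, hpart]
    rfl
  have hseen : ∃ l₁ M₁, l₁ <+: l ∧ D.SeqRun (l₁.map Prod.snd) M₁ ∧
      D.PartialTraversal M₁ π [] :=
    ⟨l, _, List.prefix_refl _, h.serialization.run, .nil _ _⟩
  refine ⟨?_, ?_, ?_, ?_⟩
  · refine h.serialization.append_event hnd (by simp) ?_
    refine safelySerialized hD ?_ hfl hseen (by simp) (Or.inl hop')
    intro x hx
    rw [opSub_append_of_ne _ (h.serialization.ne_of_not_done hnd hx).symm]
    exact h.serialization.opSub_eq x hx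
  · intro e he e' he' hid
    rcases List.mem_append.1 he with he | he <;> rcases List.mem_append.1 he' with he' | he'
    · exact h.ids e he e' he' hid
    · rw [List.mem_singleton.1 he'] at hid
      exact absurd hid (hf e he)
    · rw [List.mem_singleton.1 he] at hid
      exact absurd hid.symm (hf e' he')
    · rw [List.mem_singleton.1 he, List.mem_singleton.1 he']
  · intro q ρ rs w b hq
    by_cases hqp : q = p
    · subst hqp
      rw [Function.update_self] at hq
      cases hq
      refine ⟨hop', ⟨procSub H q, ?_, ?_⟩, by simp, by simp, ?_, ?_, hseen⟩
      · rw [procSub_append_of_eq _ rfl, hpart]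
      · intro e he h1
        exact hf e (List.mem_of_mem_filter he) (by rw [h1])
      · simp [hlock, SearchData.nextRead_nil]
      · exact fun h1 => absurd h1 hlock
    · rw [Function.update_of_ne hqp] at hq
      have h1 : π ≠ ρ := by
        rintro rfl
        exact hf _ (h.mem_of_running hq) rfl
      exact (h.inProgress q ρ rs w b hq).of_other (opSub_append_of_ne _ h1)
        (procSub_append_of_ne _ (Ne.symm hqp)) (List.prefix_refl _) Iff.rfl (fun _ => rfl)
  · intro q hq
    by_cases hqp : q = p
    · rw [hqp, Function.update_self]
      simp
    · rw [Function.update_of_ne hqp]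
      exact h.lock_running q hq

/-- An event in the middle of an operation. -/
theorem progress (hD : IsSearchStructure D) (h : OptimisticInv H s st l) {p : Fin n} {π : D.Op}
    {rs rs' : D.Vw} {w w' : ℕ} {b b' : Bool} (hr : st p = .running π rs w b) {k : Kind D}
    {lock' : Option (Fin n)}
    (hpart : partEvents p π rs' w' b' = partEvents p π rs w b ++ [⟨p, π, k⟩])
    (hk : ∀ r, k ≠ .res r) (hw : 0 < w' → D.nextRead π rs' = none)
    (hpend : b' = true → ∀ r, D.next π rs' w' ≠ .done r)
    (hlock_iff : lock' = some p ↔ D.nextRead π rs' = none ∧ (0 < w' ∨ D.writes π rs' = []))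
    (hcur : lock' = some p → D.Traversal s.mem π rs')
    (hseen : ∃ l₁ M₁, l₁ <+: l ∧ D.SeqRun (l₁.map Prod.snd) M₁ ∧ D.PartialTraversal M₁ π rs')
    (hlock : ∀ q ≠ p, lock' = some q ↔ s.lock = some q) :
    OptimisticInv (H ++ [⟨p, π, k⟩]) ⟨s.mem, lock'⟩
      (Function.update st p (.running π rs' w' b')) l := by
  have hip := h.inProgress p π rs w b hr
  have hnd := hip.not_done
  have hop' : opSub (H ++ [⟨p, π, k⟩]) π = partEvents p π rs' w' b' := by
    rw [opSub_append_of_eq _ rfl, hip.opSub_eq, hpart]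
  refine ⟨?_, ?_, ?_, ?_⟩
  · refine h.serialization.append_event hnd hk ?_
    refine safelySerialized hD ?_ (h.fresh hr) hseen hw (Or.inl hop')
    intro x hx
    rw [opSub_append_of_ne _ (h.serialization.ne_of_not_done hnd hx).symm]
    exact h.serialization.opSub_eq x hx
  · have h1 : ∀ e ∈ H ++ [(⟨p, π, k⟩ : Event D n)], ∃ f ∈ H, f.op = e.op := by
      intro e he
      rcases List.mem_append.1 he with he | he
      · exact ⟨e, he, rfl⟩
      · rw [List.mem_singleton.1 he]
        exact ⟨_, h.mem_of_running hr, rfl⟩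
    intro e he e' he' hid
    obtain ⟨f, hf, h2⟩ := h1 e he
    obtain ⟨f', hf', h3⟩ := h1 e' he'
    rw [← h2, ← h3] at hid ⊢
    exact h.ids f hf f' hf' hid
  · intro q ρ rs₁ w₁ b₁ hq
    by_cases hqp : q = p
    · subst hqp
      rw [Function.update_self] at hq
      cases hq
      obtain ⟨P, h1, h2⟩ := hip.procSub_eq
      refine ⟨hop', ⟨P, ?_, h2⟩, hw, hpend, hlock_iff, hcur, hseen⟩
      rw [procSub_append_of_eq _ rfl, h1, hpart, List.append_assoc]
    · rw [Function.update_of_ne hqp] at hq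
      exact (h.inProgress q ρ _ _ _ hq).of_other (opSub_append_of_ne _ (h.op_ne_of_ne hr hq hqp))
        (procSub_append_of_ne _ (Ne.symm hqp)) (List.prefix_refl _) (hlock q hqp) (fun _ => rfl)
  · intro q hq
    by_cases hqp : q = p
    · rw [hqp, Function.update_self]
      simp
    · rw [Function.update_of_ne hqp]
      exact h.lock_running q ((hlock q hqp).1 hq)

/-- The response of an operation. -/
theorem respond (h : OptimisticInv H s st l) {p : Fin n} {π : D.Op} {rs : D.Vw} {w : ℕ} {r : D.R}
    (hr : st p = .running π rs w false) (hdone : D.next π rs w = .done r) :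
    OptimisticInv (H ++ [⟨p, π, .res (D.resp π rs)⟩]) ⟨applyWrites s.mem (D.writes π rs), none⟩
      (Function.update st p .idle) (l ++ [(p, π, rs)]) := by
  have hip := h.inProgress p π rs w false hr
  have hnd := hip.not_done
  obtain ⟨h1, h2, -⟩ := next_eq_done hdone
  have hlock : s.lock = some p := by
    refine hip.lock_iff.2 ⟨h1, ?_⟩
    rcases Nat.eq_zero_or_pos w with rfl | hw
    · exact Or.inr (List.length_eq_zero_iff.1 (Nat.le_zero.1 h2))
    · exact Or.inl hw
  obtain ⟨P, h3, h4⟩ := hip.procSub_eq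
  refine ⟨?_, ?_, ?_, by simp⟩
  · exact h.serialization.append_res hnd (h.fresh hr) (hip.current hlock) (partEvents_res p hdone)
      hip.opSub_eq h3 h4
  · have h1 : ∀ e ∈ H ++ [(⟨p, π, .res (D.resp π rs)⟩ : Event D n)], ∃ f ∈ H, f.op = e.op := by
      intro e he
      rcases List.mem_append.1 he with he | he
      · exact ⟨e, he, rfl⟩
      · rw [List.mem_singleton.1 he]
        exact ⟨_, h.mem_of_running hr, rfl⟩
    intro e he e' he' hid
    obtain ⟨f, hf, h2⟩ := h1 e he
    obtain ⟨f', hf', h3⟩ := h1 e' he'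
    rw [← h2, ← h3] at hid ⊢
    exact h.ids f hf f' hf' hid
  · intro q ρ rs₁ w₁ b₁ hq
    by_cases hqp : q = p
    · subst hqp
      rw [Function.update_self] at hq
      cases hq
    · rw [Function.update_of_ne hqp] at hq
      refine (h.inProgress q ρ _ _ _ hq).of_other (opSub_append_of_ne _ (h.op_ne_of_ne hr hq hqp))
        (procSub_append_of_ne _ (Ne.symm hqp)) (List.prefix_append _ _) ?_ (by simp)
      rw [hlock]
      simp [Ne.symm hqp]

/-- The response `⊥`, which removes the pending invocation from the exported history. -/
theorem abort (hD : IsSearchStructure D) {X Y : List (Event D n)} {e : Event D n}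
    (h : OptimisticInv (X ++ e :: Y) s st l) {p : Fin n} {π : D.Op} {rs : D.Vw} {w : ℕ}
    (hr : st p = .running π rs w true) (hlock : s.lock ≠ some p) (he : e.op = π) (hY : ∀ f ∈ Y, f.op ≠ π) :
    OptimisticInv (X ++ Y ++ [⟨p, π, .abort⟩]) s (Function.update st p .idle) l := by
  subst he
  have hip := h.inProgress p _ rs w true hr
  have hnd := hip.not_done
  have hep : e.proc = p := by
    have h1 : e ∈ opSub (X ++ e :: Y) e.op := by simp [mem_opSub]
    rw [hip.opSub_eq] at h1
    exact (mem_partEvents h1).2.1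
  have hsub : (X ++ Y).Sublist (X ++ e :: Y) :=
    List.Sublist.append (List.Sublist.refl X) (List.sublist_cons_self e Y)
  have hop : opSub (X ++ Y) e.op = partEvents p e.op rs w false := by
    have h1 := hip.opSub_eq
    rw [partEvents_pending, opSub_append, show e :: Y = [e] ++ Y from rfl, opSub_append [e],
      opSub_eq_nil hY, opSub_eq_self (H := [e]) (by simp), List.append_nil] at h1
    rw [opSub_append, opSub_eq_nil hY, List.append_nil]
    have h2 : ∃ k : Kind D, pendingKinds (D.next e.op rs w) = [k] := by
      cases h3 : D.next e.op rs w with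
      | read x => exact ⟨_, rfl⟩
      | write x c => exact ⟨_, rfl⟩
      | done r => exact absurd h3 (hip.pending rfl r)
    obtain ⟨k, h2⟩ := h2
    rw [h2] at h1
    exact (List.append_inj' h1 rfl).1
  have hser := h.serialization.remove_event hnd hY
  have hnd' : ¬ Done (X ++ Y) e.op := fun h1 => hnd (h1.mono hsub.subset)
  refine ⟨?_, ?_, ?_, ?_⟩
  · refine hser.append_event hnd' (by simp) ?_
    refine safelySerialized hD (p := p) (w := w) (b := false) ?_ (h.fresh hr) hip.seen
      hip.writing (Or.inr ?_)
    · intro x hx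
      rw [opSub_append_of_ne (e := ⟨p, e.op, .abort⟩) _ (hser.ne_of_not_done hnd' hx).symm]
      exact hser.opSub_eq x hx
    · rw [opSub_append_of_eq _ rfl, hop]
  · have h1 : ∀ f ∈ X ++ Y ++ [(⟨p, e.op, .abort⟩ : Event D n)],
        ∃ g ∈ X ++ e :: Y, g.op = f.op := by
      intro f hf
      rcases List.mem_append.1 hf with hf | hf
      · exact ⟨f, hsub.subset hf, rfl⟩
      · rw [List.mem_singleton.1 hf]
        exact ⟨e, by simp, rfl⟩
    intro f hf f' hf' hid
    obtain ⟨g, hg, h2⟩ := h1 f hf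
    obtain ⟨g', hg', h3⟩ := h1 f' hf'
    rw [← h2, ← h3] at hid ⊢
    exact h.ids g hg g' hg' hid
  · intro q ρ rs₁ w₁ b₁ hq
    by_cases hqp : q = p
    · subst hqp
      rw [Function.update_self] at hq
      cases hq
    · rw [Function.update_of_ne hqp] at hq
      have hne := h.op_ne_of_ne hr hq hqp
      refine (h.inProgress q ρ _ _ _ hq).of_other ?_ ?_ (List.prefix_refl _) Iff.rfl (fun _ => rfl)
      · rw [opSub_append_of_ne (e := ⟨p, e.op, .abort⟩) _ hne, opSub_append, opSub_append,
          show e :: Y = [e] ++ Y from rfl, opSub_append [e], opSub_eq_nil (H := [e]) (by simpa using hne), List.nil_append]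
      · rw [procSub_append_of_ne _ (Ne.symm hqp)]
        have : e.proc ≠ q := fun h1 => hqp (h1.symm.trans hep)
        simp [procSub, this]
  · intro q hq
    by_cases hqp : q = p
    · exact absurd (hqp ▸ hq) hlock
    · rw [Function.update_of_ne hqp]
      exact h.lock_running q hq

end OptimisticInv

/-- Every step of the optimistic implementation keeps the invariant of the exported history. -/
theorem OptimisticInv.step (hD : IsSearchStructure D) {α : List (Event D n)} {s : TMState D n}
    {st : Fin n → Status D} {l : List (Fin n × D.Op × D.Vw)}
    (h : OptimisticInv (exported α) s st l) {p : Fin n} {π : D.Op} {rs : D.Vw} {w : ℕ} {b : Bool}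
    (hr : st p = .running π rs w b) : ∃ l', OptimisticInv
      (exported (α ++ (react π rs w b (optimisticStep p π rs w b s).2).1.map (Event.mk p π)))
      (optimisticStep p π rs w b s).1
      (Function.update st p (react π rs w b (optimisticStep p π rs w b s).2).2) l' := by
  classical
  have hip := h.inProgress p π rs w b hr
  have habort : b = true → s.lock ≠ some p →
      OptimisticInv (exported (α ++ [⟨p, π, .abort⟩])) s (Function.update st p .idle) l := by
    rintro rfl hlock
    obtain ⟨X, e, Y, h1, h2, h3, h4⟩ := exported_append_abort (f := (⟨p, π, .abort⟩ : Event D n)) rfl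
      ⟨_, exported_subset (h.mem_of_running hr), rfl⟩
    rw [h4]
    rw [h1] at h
    exact h.abort hD hr hlock h2 h3
  cases b with
  | false =>
    -- the next action of the sequential code is invoked; only a response changes the memory
    cases hn : D.next π rs w with
    | read x =>
      have hstep : optimisticStep p π rs w false s = (s, .next) := by
        simp [optimisticStep, hn]
      have hreact : react π rs w false (.next : Out D) = ([.readInv x], .running π rs w true) := by
        simp [react, hn]
      rw [hstep, hreact]
      refine ⟨l, ?_⟩
      rw [List.map_singleton, exported_append (by simp)]
      refine h.progress hD hr (lock' := s.lock) ?_ (by simp) hip.writing (by simp [hn])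
        hip.lock_iff hip.current hip.seen (fun _ _ => Iff.rfl)
      rw [partEvents_pending, hn]
      rfl
    | write x c =>
      have hstep : optimisticStep p π rs w false s = (s, .next) := by
        simp [optimisticStep, hn]
      have hreact : react π rs w false (.next : Out D) =
          ([.writeInv x c], .running π rs w true) := by
        simp [react, hn]
      rw [hstep, hreact]
      refine ⟨l, ?_⟩
      rw [List.map_singleton, exported_append (by simp)]
      refine h.progress hD hr (lock' := s.lock) ?_ (by simp) hip.writing (by simp [hn])
        hip.lock_iff hip.current hip.seen (fun _ _ => Iff.rfl)
      rw [partEvents_pending, hn]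
      rfl
    | done r =>
      have hstep : optimisticStep p π rs w false s =
          (⟨applyWrites s.mem (D.writes π rs), none⟩, .next) := by
        simp [optimisticStep, hn]
      have hreact : react π rs w false (.next : Out D) = ([.res r], .idle) := by
        simp [react, hn]
      rw [hstep, hreact]
      refine ⟨l ++ [(p, π, rs)], ?_⟩
      rw [List.map_singleton, exported_append (by simp), (next_eq_done hn).2.2]
      exact h.respond hr hn
  | true =>
    cases hn : D.next π rs w with
    | read x =>
      have hnr := next_eq_read hn
      have hw : w = 0 := by
        by_contra h1
        rw [hip.writing (Nat.pos_of_ne_zero h1)] at hnr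
        cases hnr
      subst hw
      by_cases hc : s.lock = none ∧ Current s.mem rs
      · have hstep : optimisticStep p π rs 0 true s =
            (⟨s.mem, if ReadOnlyEnd π (rs ++ [(x, s.mem x)]) then some p else none⟩,
              .ret (s.mem x)) := by
          simp only [optimisticStep, hn]
          rw [if_pos hc]
        have hreact : react π rs 0 true (.ret (s.mem x) : Out D) =
            ([.readRes x (s.mem x)], .running π (rs ++ [(x, s.mem x)]) 0 false) := by
          simp [react, hn]
        have hpt : D.PartialTraversal s.mem π (rs ++ [(x, s.mem x)]) := by
          obtain ⟨l₁, M₁, -, -, h1⟩ := hip.seen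
          exact (h1.congr hc.2).snoc hnr rfl
        rw [hstep, hreact]
        refine ⟨l, ?_⟩
        rw [List.map_singleton, exported_append (by simp)]
        refine h.progress hD hr (partEvents_readRes p hn _) (by simp) (by simp) (by simp) ?_ ?_
          ⟨l, _, List.prefix_refl _, h.serialization.run, hpt⟩ ?_
        · by_cases h1 : ReadOnlyEnd π (rs ++ [(x, s.mem x)])
          · simp only [if_pos h1, true_iff]
            exact ⟨h1.1, Or.inr h1.2⟩
          · simp only [if_neg h1, reduceCtorEq, false_iff]
            rintro ⟨h2, h3⟩
            exact h1 ⟨h2, h3.resolve_left (lt_irrefl 0)⟩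
        · intro h1
          by_cases h2 : ReadOnlyEnd π (rs ++ [(x, s.mem x)])
          · exact ⟨hpt, h2.1⟩
          · simp [h2] at h1
        · intro q hq
          rw [hc.1]
          split <;> simp [Ne.symm hq]
      · have hstep : optimisticStep p π rs 0 true s = (s, .abort) := by
          simp only [optimisticStep, hn]
          rw [if_neg hc]
        have hreact : react π rs 0 true (.abort : Out D) = ([.abort], .idle) := by
          simp [react]
        rw [hstep, hreact]
        refine ⟨l, habort rfl fun h1 => ?_⟩
        rw [(hip.lock_iff.1 h1).1] at hnr
        cases hnr
    | write x c =>
      obtain ⟨hnr, hwr⟩ := next_eq_write hn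
      by_cases hc : s.lock = some p ∨ (s.lock = none ∧ Current s.mem rs)
      · have hstep : optimisticStep p π rs w true s = (⟨s.mem, some p⟩, .ret c) := by
          simp only [optimisticStep, hn]
          rw [if_pos hc]
        have hreact : react π rs w true (.ret c : Out D) =
            ([.writeRes x], .running π rs (w + 1) false) := by
          simp [react, hn]
        rw [hstep, hreact]
        refine ⟨l, ?_⟩
        rw [List.map_singleton, exported_append (by simp)]
        refine h.progress hD hr (partEvents_writeRes p hn) (by simp) (fun _ => hnr) (by simp)
          (by simp [hnr]) ?_ hip.seen ?_
        · intro _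
          rcases hc with h1 | h1
          · exact hip.current h1
          · obtain ⟨l₁, M₁, -, -, h2⟩ := hip.seen
            exact ⟨h2.congr h1.2, hnr⟩
        · intro q hq
          rcases hc with h1 | h1 <;> simp [h1, Ne.symm hq]
      · have hstep : optimisticStep p π rs w true s = (s, .abort) := by
          simp only [optimisticStep, hn]
          rw [if_neg hc]
        have hreact : react π rs w true (.abort : Out D) = ([.abort], .idle) := by
          simp [react]
        rw [hstep, hreact]
        exact ⟨l, habort rfl fun h1 => hc (Or.inl h1)⟩
    | done r => exact absurd hn (hip.pending rfl r)

theorem optimistic_inv (hD : IsSearchStructure D) {α : List (Event D n)}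
    {c : (optimistic D n).Config} (h : (optimistic D n).Exec α c) :
    ∃ l, OptimisticInv (exported α) (c.mem ()) c.st l := by
  induction h with
  | init => exact ⟨[], .init⟩
  | snoc he hs ih =>
    obtain ⟨l, ih⟩ := ih
    cases hs with
    | invoke hi hf =>
      refine ⟨l, ?_⟩
      rw [exported_append (by simp)]
      exact ih.invoke hD hi fun e he => hf e (exported_subset he)
    | @step p π rs w b hr =>
      obtain ⟨h1, h2, h3⟩ := optimistic_stepResult _ p π rs w b
      rw [h1, h2, h3]
      exact ih.step hD hr

theorem optimistic_classSM (hD : IsSearchStructure D) : (optimistic D n).ClassSM := by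
  constructor
  · intro α c h
    obtain ⟨l, h1⟩ := optimistic_inv hD h
    exact ⟨h1.serialization.locallySerializable, h1.serialization.linearizable hD⟩
  · intro α c h
    obtain ⟨l, h1⟩ := optimistic_inv hD h
    exact h1.serialization.safeStrictSerializable

end Optimistic

/-! ### Runs of the optimistic implementation without aborts -/

section Accepting

variable {D : SearchData} {n : ℕ}

/-- The optimistic implementation can reach the shared state `s` and the statuses `st` with the
events `H`. -/
def Reach (H : List (Event D n)) (s : TMState D n) (st : Fin n → Status D) : Prop :=
  ∃ c, (optimistic D n).Exec H c ∧ c.mem () = s ∧ c.st = st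

theorem next_eq_write_of_writes {π : D.Op} {rs : D.Vw} {ws ws' : List (D.E × D.N)}
    {e : D.E × D.N} (hn : D.nextRead π rs = none) (hw : D.writes π rs = ws ++ e :: ws') :
    D.next π rs ws.length = .write e.1 e.2 := by
  simp [SearchData.next, hn, hw]

namespace Reach

variable {H : List (Event D n)} {s : TMState D n} {st : Fin n → Status D} {p : Fin n} {π : D.Op}
  {rs : D.Vw} {w : ℕ} {b : Bool} {M : D.Mem}

theorem init : Reach ([] : List (Event D n)) ⟨D.initMem, none⟩ (fun _ => .idle) :=
  ⟨_, .init, rfl, rfl⟩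

theorem invoke (h : Reach H s st) (hp : st p = .idle) (hf : ∀ e ∈ H, e.op.id ≠ π.id) :
    Reach (H ++ [⟨p, π, .inv⟩]) s (Function.update st p (.running π [] 0 false)) := by
  obtain ⟨c, h1, rfl, rfl⟩ := h
  exact ⟨_, h1.snoc (.invoke hp hf), rfl, rfl⟩

theorem step (h : Reach H s (Function.update st p (.running π rs w b))) :
    Reach (H ++ (react π rs w b (optimisticStep p π rs w b s).2).1.map (Event.mk p π))
      (optimisticStep p π rs w b s).1
      (Function.update st p (react π rs w b (optimisticStep p π rs w b s).2).2) := by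
  obtain ⟨c, h1, rfl, h2⟩ := h
  have h3 : c.st p = .running π rs w b := by rw [h2, Function.update_self]
  obtain ⟨h4, h5, h6⟩ := optimistic_stepResult c p π rs w b
  have h7 := h1.snoc (.step h3)
  rw [h4] at h7
  exact ⟨_, h7, h5, by rw [h6, h2, Function.update_idem]⟩

/-- A step that invokes the next read or write. -/
theorem next (h : Reach H s (Function.update st p (.running π rs w false)))
    (hn : ∀ r, D.next π rs w ≠ .done r) :
    Reach (H ++ (pendingKinds (D.next π rs w)).map (Event.mk p π)) s
      (Function.update st p (.running π rs w true)) := by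
  have h1 := h.step
  cases hx : D.next π rs w with
  | done r => exact absurd hx (hn r)
  | read x => simpa [optimisticStep, react, hx, pendingKinds] using h1
  | write x c => simpa [optimisticStep, react, hx, pendingKinds] using h1

/-- A read of a process that finds the lock free and its earlier reads current. -/
theorem read {x : D.E} (h : Reach H ⟨M, none⟩ (Function.update st p (.running π rs 0 false)))
    (hn : D.nextRead π rs = some x) (hc : Current M rs) {lock : Option (Fin n)}
    (hro : ReadOnlyEnd π (rs ++ [(x, M x)]) → lock = some p)
    (hnro : ¬ ReadOnlyEnd π (rs ++ [(x, M x)]) → lock = none) :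
    Reach (H ++ (readKinds [(x, M x)]).map (Event.mk p π)) ⟨M, lock⟩
      (Function.update st p (.running π (rs ++ [(x, M x)]) 0 false)) := by
  classical
  have hx : D.next π rs 0 = .read x := by simp [SearchData.next, hn]
  have h1 := (h.next (by simp [hx])).step
  have h2 : optimisticStep p π rs 0 true ⟨M, none⟩ = (⟨M, lock⟩, .ret (M x)) := by
    simp only [optimisticStep, hx]
    rw [if_pos ⟨trivial, hc⟩]
    by_cases h3 : ReadOnlyEnd π (rs ++ [(x, M x)])
    · rw [if_pos h3, hro h3]
    · rw [if_neg h3, hnro h3]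
  rw [h2] at h1
  simpa [react, hx, pendingKinds, readKinds] using h1

/-- The rest of a traversal; an operation that writes nothing ends up with the lock. -/
theorem reads {rs' : D.Vw} (hne : rs' ≠ []) (ht : D.Traversal M π (rs ++ rs'))
    (h : Reach H ⟨M, none⟩ (Function.update st p (.running π rs 0 false))) {lock : Option (Fin n)}
    (hro : D.writes π (rs ++ rs') = [] → lock = some p)
    (hnro : D.writes π (rs ++ rs') ≠ [] → lock = none) :
    Reach (H ++ (readKinds rs').map (Event.mk p π)) ⟨M, lock⟩
      (Function.update st p (.running π (rs ++ rs') 0 false)) := by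
  induction rs' generalizing H rs with
  | nil => exact absurd rfl hne
  | cons e rs' ih =>
    obtain ⟨x, c⟩ := e
    have h1 := ht.1 rs (x, c) ⟨rs', by simp⟩
    have hc : Current M rs := (ht.1.of_prefix (List.prefix_append _ _)).val
    obtain ⟨h1, rfl⟩ : D.nextRead π rs = some x ∧ c = M x := h1
    have h3 : readKinds ((x, M x) :: rs') = readKinds [(x, M x)] ++ readKinds rs' := by
      simp [readKinds]
    cases rs' with
    | nil =>
      refine h.read h1 hc (fun h2 => hro h2.2) fun h2 => hnro fun h3 => h2 ⟨?_, h3⟩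
      exact ht.2
    | cons e' rs' =>
      have h2 := h.read (lock := none) h1 hc
        (fun h2 => by
          have h4 := (ht.1 (rs ++ [(x, M x)]) e' ⟨rs', by simp⟩).1
          rw [h2.1] at h4
          cases h4) (fun _ => rfl)
      have h4 := ih (rs := rs ++ [(x, M x)]) (by simp) (by simpa using ht) h2 (by simpa using hro)
        (by simpa using hnro)
      rw [h3, List.map_append, ← List.append_assoc]
      simpa using h4

/-- The effect of a pending write of a process that owns the lock, or finds it free and its reads
current. -/
theorem write {x : D.E} {c : D.N} {lock : Option (Fin n)}
    (h : Reach H ⟨M, lock⟩ (Function.update st p (.running π rs w true)))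
    (hx : D.next π rs w = .write x c) (hl : lock = some p ∨ (lock = none ∧ Current M rs)) :
    Reach (H ++ [⟨p, π, .writeRes x⟩]) ⟨M, some p⟩
      (Function.update st p (.running π rs (w + 1) false)) := by
  classical
  have h1 := h.step
  have h2 : optimisticStep p π rs w true ⟨M, lock⟩ = (⟨M, some p⟩, .ret c) := by
    simp only [optimisticStep, hx]
    rw [if_pos hl]
  rw [h2] at h1
  simpa [react, hx] using h1

/-- The rest of the update phase. -/
theorem writes {ws ws' : List (D.E × D.N)} (hn : D.nextRead π rs = none)
    (hw : D.writes π rs = ws ++ ws') {lock : Option (Fin n)}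
    (h : Reach H ⟨M, lock⟩ (Function.update st p (.running π rs ws.length false)))
    (hl : lock = some p ∨ (lock = none ∧ Current M rs)) :
    ∃ lock', Reach (H ++ (writeKinds ws').map (Event.mk p π)) ⟨M, lock'⟩
      (Function.update st p (.running π rs (D.writes π rs).length false)) := by
  induction ws' generalizing H ws lock with
  | nil =>
    rw [List.append_nil] at hw
    exact ⟨lock, by simpa [writeKinds, hw] using h⟩
  | cons e ws' ih =>
    have hx := next_eq_write_of_writes hn hw
    have h1 := (h.next (by simp [hx])).write hx hl
    have h2 := ih (ws := ws ++ [e]) (by simp [hw]) (by simpa using h1) (Or.inl rfl)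
    obtain ⟨lock', h2⟩ := h2
    refine ⟨lock', ?_⟩
    simpa [hx, pendingKinds, writeKinds] using h2

theorem respond {lock : Option (Fin n)} (hn : D.nextRead π rs = none)
    (h : Reach H ⟨M, lock⟩
      (Function.update st p (.running π rs (D.writes π rs).length false))) :
    Reach (H ++ [⟨p, π, .res (D.resp π rs)⟩]) ⟨applyWrites M (D.writes π rs), none⟩
      (Function.update st p .idle) := by
  have h1 := h.step
  have h2 : D.next π rs (D.writes π rs).length = .done (D.resp π rs) := by
    simp [SearchData.next, hn]
  simpa [optimisticStep, react, h2] using h1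

/-- The invocation of an operation and its traversal. -/
theorem traversal (h : Reach H ⟨M, none⟩ st) (hp : st p = .idle)
    (hf : ∀ e ∈ H, e.op.id ≠ π.id) (ht : D.Traversal M π rs) {lock : Option (Fin n)}
    (hro : D.writes π rs = [] → lock = some p) (hnro : D.writes π rs ≠ [] → lock = none) :
    Reach (H ++ ([Kind.inv] ++ readKinds rs).map (Event.mk p π)) ⟨M, lock⟩
      (Function.update st p (.running π rs 0 false)) := by
  have h1 := (h.invoke hp hf).reads (rs := []) ht.ne_nil ht hro hnro
  simpa using h1

/-- An operation is executed alone. -/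
theorem op (h : Reach H ⟨M, none⟩ st) (hp : st p = .idle) (hf : ∀ e ∈ H, e.op.id ≠ π.id)
    (ht : D.Traversal M π rs) :
    Reach (H ++ opEvents p π rs) ⟨applyWrites M (D.writes π rs), none⟩ st := by
  classical
  have h1 := h.traversal hp hf ht (lock := if D.writes π rs = [] then some p else none)
    (fun h1 => by rw [if_pos h1]) (fun h1 => by rw [if_neg h1])
  obtain ⟨lock', h2⟩ := h1.writes (ws := []) (ws' := D.writes π rs) ht.2 rfl (by
    by_cases h2 : D.writes π rs = []
    · exact Or.inl (by rw [if_pos h2])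
    · exact Or.inr ⟨by rw [if_neg h2], ht.1.val⟩)
  have h3 := h2.respond ht.2
  rw [← hp, Function.update_eq_self] at h3
  rw [opEvents_eq]
  simpa using h3

end Reach

theorem SearchData.SeqRun.of_concat {l : List (D.Op × D.Vw)} {x : D.Op × D.Vw} {M : D.Mem}
    (h : D.SeqRun (l ++ [x]) M) : ∃ M', D.SeqRun l M' ∧ D.Fresh l x.1 ∧ D.Traversal M' x.1 x.2 ∧
      M = applyWrites M' (D.writes x.1 x.2) := by
  generalize hl : l ++ [x] = l' at h
  cases h with
  | nil => simp at hl
  | snoc h hf ht =>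
    obtain ⟨rfl, h2⟩ := List.append_inj' hl rfl
    simp only [List.cons.injEq, and_true] at h2
    subst h2
    exact ⟨_, h, hf, ht, rfl⟩

theorem SearchData.SeqRun.unique {l : List (D.Op × D.Vw)} {M M' : D.Mem} (h : D.SeqRun l M)
    (h' : D.SeqRun l M') : M = M' := by
  induction h generalizing M' with
  | nil =>
    generalize hl : ([] : List (D.Op × D.Vw)) = l' at h'
    cases h' with
    | nil => rfl
    | snoc => simp at hl
  | snoc _ _ _ ih =>
    obtain ⟨M'', h1, -, -, rfl⟩ := h'.of_concat
    rw [ih h1]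

/-- A sequential run is executed by one process. -/
theorem Reach.run {H : List (Event D n)} {st : Fin n → Status D} {p : Fin n}
    {l l' : List (D.Op × D.Vw)} {M M' : D.Mem} (hl : D.SeqRun l M) (hl' : D.SeqRun (l ++ l') M')
    (h : Reach H ⟨M, none⟩ st) (hp : st p = .idle) (hf : ∀ x ∈ l', ∀ e ∈ H, e.op.id ≠ x.1.id) :
    Reach (H ++ l'.flatMap fun x => opEvents p x.1 x.2) ⟨M', none⟩ st := by
  induction l' using List.reverseRecOn generalizing M' with
  | nil =>
    rw [List.append_nil] at hl'
    rw [hl'.unique hl]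
    simpa using h
  | append_singleton l' x ih =>
    rw [← List.append_assoc] at hl'
    obtain ⟨M'', h1, h2, h3, rfl⟩ := hl'.of_concat
    have h4 := ih h1 fun y hy => hf y (by simp [hy])
    have h5 := h4.op (π := x.1) (rs := x.2) hp (by
      intro e he
      rcases List.mem_append.1 he with he | he
      · exact hf x (by simp) e he
      · obtain ⟨y, hy, h6⟩ := List.mem_flatMap.1 he
        rw [(mem_opEvents_op h6).1]
        exact h2 y (by simp [hy])) h3
    simpa using h5

/-- Any processes can execute one more operation each, one after the other. -/
theorem Reach.exists_finds (hD : IsSearchStructure D) (k : ℕ) (coin : D.C) (ps : List (Fin n)) :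
    ∀ {H : List (Event D n)} {l : List (D.Op × D.Vw)} {M : D.Mem}, D.SeqRun l M →
      Reach H ⟨M, none⟩ (fun _ => .idle) → ∃ H' M', Reach (H ++ H') ⟨M', none⟩ (fun _ => .idle) ∧
        (∀ p ∈ ps, ∃ f ∈ H', f.proc = p ∧ f.kind = .inv) ∧ ∀ e ∈ H', e.kind ≠ .abort := by
  classical
  induction ps with
  | nil => exact fun {H l M} _ h => ⟨[], M, by simpa using h, by simp, by simp⟩
  | cons p ps ih =>
    intro H l M hl h
    obtain ⟨i, hi⟩ := Infinite.exists_notMem_finset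
      ((H.map fun e => e.op.id) ++ l.map fun ρ => ρ.1.id).toFinset
    simp only [List.mem_toFinset, List.mem_append, List.mem_map, not_or, not_exists,
      not_and] at hi
    obtain ⟨π, hπ⟩ : ∃ π : D.Op, π = ⟨i, .find k, coin⟩ := ⟨_, rfl⟩
    have hid : π.id = i := by rw [hπ]
    have hf : D.Fresh l π := fun ρ hρ => hid ▸ hi.2 ρ hρ
    obtain ⟨rs, ht⟩ := hD.terminates l M hl π hf
    have h1 := h.op (p := p) rfl (fun e he => hid ▸ hi.1 e he) ht
    obtain ⟨H', M', h2, h3, h4⟩ := ih (hl.snoc hf ht) h1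
    refine ⟨opEvents p π rs ++ H', M', by simpa using h2, ?_, ?_⟩
    · intro q hq
      rcases List.mem_cons.1 hq with rfl | hq
      · exact ⟨_, List.mem_append_left _ (inv_mem_opEvents _ _ _), rfl, rfl⟩
      · obtain ⟨f, hf, h5⟩ := h3 q hq
        exact ⟨f, List.mem_append_right _ hf, h5⟩
    · intro e he
      rcases List.mem_append.1 he with he | he
      · exact abort_not_mem_opEvents he
      · exact h4 e he

end Accepting

/-! ### The schedule -/

section Schedule

variable {D : SearchData} {n : ℕ}

theorem countP_isResOf_opEvents (P : Call D.V → Bool) (p : Fin n) (π : D.Op) (rs : D.Vw) :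
    (opEvents p π rs).countP (Event.isResOf P) = if P π.call then 1 else 0 := by
  rw [opEvents_eq, List.map_append, List.countP_append, List.countP_eq_zero.2]
  · simp [Event.isResOf, List.countP_singleton]
    rfl
  · intro e he
    obtain ⟨k, hk, rfl⟩ := List.mem_map.1 he
    simp only [List.mem_append, List.mem_singleton, mem_readKinds, mem_writeKinds] at hk
    rcases hk with (rfl | ⟨e, -, rfl | rfl⟩) | ⟨e, -, rfl | rfl⟩ <;> simp [Event.isResOf]

theorem countP_isResOf_flatMap (P : Call D.V → Bool) (p : Fin n) (l : List (D.Op × D.Vw)) :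
    (l.flatMap fun x => opEvents p x.1 x.2).countP (Event.isResOf P) =
      l.countP (fun x => P x.1.call) := by
  induction l with
  | nil => rfl
  | cons x l ih =>
    rw [List.flatMap_cons, List.countP_append, ih, countP_isResOf_opEvents, List.countP_cons,
      Nat.add_comm]

theorem exists_writeInv_mem_opEvents (p : Fin n) {π : D.Op} {rs : D.Vw}
    (h : D.writes π rs ≠ []) : ∃ x c, (⟨p, π, .writeInv x c⟩ : Event D n) ∈ opEvents p π rs := by
  obtain ⟨e, ws, hw⟩ := List.exists_cons_of_ne_nil h
  refine ⟨e.1, e.2, ?_⟩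
  rw [opEvents_eq, hw]
  simp [writeKinds]

/-- An execution of the optimistic implementation without aborts, after which all processes are
idle, shows that its order of events is a strictly serializable schedule that is accepted. -/
theorem Reach.accepts (hD : IsSearchStructure D) {H : List (Event D n)} {s : TMState D n}
    (h : Reach H s (fun _ => .idle)) (hna : ∀ e ∈ H, e.kind ≠ .abort) :
    StrictlySerializableSchedule (skel H) ∧ (optimistic D n).Accepts (skel H) := by
  classical
  obtain ⟨c, hc, -, hst⟩ := h
  have hex := exported_eq_self hna
  have hdone : ∀ e ∈ H, Done H e.op := by
    intro e he
    rcases hc.statusInv.ended e he with h1 | h1 | ⟨f, hf, -, h1⟩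
    · rw [hst] at h1
      simp at h1
    · exact h1
    · exact absurd h1 (hna f hf)
  have hlsl := (optimistic_classSM hD).1 H c hc
  have hss := ((optimistic_classSM hD).2 H c hc).1
  rw [hex] at hlsl hss
  refine ⟨⟨H, hdone, rfl, hlsl, hss⟩, H, c, hc, ?_⟩
  rw [hex, completePart, List.filter_eq_self.2 (by simpa using hdone)]

end Schedule

end ConcSearch

open ConcSearch in
theorem mainTheorem1 (D : ConcSearch.SearchData) (hD : ConcSearch.IsSearchStructure D)
    (n : ℕ) (hn : 2 ≤ n) :
    ∃ σ : ConcSearch.Schedule D n,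
      ConcSearch.StrictlySerializableSchedule σ ∧
      (∀ I : ConcSearch.Impl D n, I.ClassP → ¬ I.Accepts σ) ∧
      (∃ J : ConcSearch.Impl D n, J.ClassSM ∧ J.Accepts σ) := by
  obtain ⟨-, -, ⟨-, -, coin⟩, -, k, v, -⟩ := hD.nontrivial
  obtain ⟨l₁, a, d, l₂, M, M', hb, ha, hb', hMM⟩ := hD.exists_recurrent_state k v coin
  have hid : ∀ x ∈ l₁ ++ a :: d :: l₂, x.1.id ≠ 0 := fun x hx h0 => by
    have := (hb'.ids x hx).1
    omega
  have hmem₁ : ∀ x ∈ l₁, x ∈ l₁ ++ a :: d :: l₂ := fun x hx => List.mem_append_left _ hx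
  -- the insert that overlaps with the operations after the state `M`
  obtain ⟨π, hπ⟩ : ∃ π : D.Op, π = ⟨0, .insert k v, coin⟩ := ⟨_, rfl⟩
  have hπid : π.id = 0 := by rw [hπ]
  have hπc : π.call = .insert k v := by rw [hπ]
  have hf' : D.Fresh (l₁ ++ a :: d :: l₂) π := fun x hx => hπid ▸ hid x hx
  have hf : D.Fresh l₁ π := fun x hx => hf' x (hmem₁ x hx)
  obtain ⟨rs, ht⟩ := hD.terminates l₁ M hb.run π hf
  have ht' := hD.traversal_congr hb.run hMM ht
  obtain ⟨e₀, ws, hws⟩ := List.exists_cons_of_ne_nil (hD.insert_step hb.run hf ht hπc hb.absent).1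
  have hnext : D.next π rs 0 = .write e₀.1 e₀.2 :=
    next_eq_write_of_writes (ws := []) ht.2 hws
  obtain ⟨p, q, hpq⟩ : ∃ p q : Fin n, p ≠ q := ⟨⟨0, by omega⟩, ⟨1, by omega⟩, by simp⟩
  -- the run to `M` by `p`, and the start of `π` by `q`, up to the invocation of its first write
  obtain ⟨A, hA⟩ : ∃ A : List (Event D n), A = l₁.flatMap fun x => opEvents p x.1 x.2 := ⟨_, rfl⟩
  obtain ⟨B, hB⟩ : ∃ B : List (Event D n), B = partEvents q π rs 0 true := ⟨_, rfl⟩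
  have hAop : ∀ e ∈ A, ∃ x ∈ l₁, e ∈ opEvents p x.1 x.2 := by
    intro e he
    rw [hA] at he
    exact List.mem_flatMap.1 he
  have hBop : ∀ e ∈ B, e.op = π ∧ e.proc = q ∧ e.kind ≠ .abort ∧ ∀ r, e.kind ≠ .res r := by
    intro e he
    rw [hB] at he
    exact mem_partEvents he
  have h1 : Reach A ⟨M, none⟩ (fun _ => .idle) := by
    have := Reach.run (p := p) (l := []) .nil hb.run Reach.init rfl (by simp)
    simpa [hA] using this
  have h2 : Reach (A ++ B) ⟨M, none⟩
      (Function.update (fun _ => .idle) q (.running π rs 0 true)) := by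
    have h3 := (h1.traversal (p := q) (lock := none) rfl (fun e he => by
      obtain ⟨x, hx, h3⟩ := hAop e he
      rw [(mem_opEvents_op h3).1]
      exact hf x hx) ht (fun h3 => absurd h3 (by rw [hws]; simp)) (fun _ => rfl)).next
        (by simp [hnext])
    simpa [hB, partEvents, writeKinds] using h3
  -- `p` inserts and deletes `k` until the graph is again that of `M`, and `π` goes on
  have h3 : Reach (A ++ B ++ (a :: d :: l₂).flatMap fun x => opEvents p x.1 x.2)
      ⟨M', none⟩ (Function.update (fun _ => .idle) q (.running π rs 0 true)) := by
    refine Reach.run hb.run hb'.run h2 (Function.update_of_ne hpq _ _) ?_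
    intro x hx e he
    rcases List.mem_append.1 he with he | he
    · obtain ⟨y, hy, h4⟩ := hAop e he
      rw [(mem_opEvents_op h4).1]
      intro hxy
      have hyx := hb'.run.eq_of_id_eq y (hmem₁ y hy) x (List.mem_append_right _ hx) hxy
      have hnd := hb'.run.nodup
      rw [List.map_append, List.nodup_append] at hnd
      exact hnd.2.2 y.1 (List.mem_map.2 ⟨y, hy, rfl⟩) x.1 (List.mem_map.2 ⟨x, hx, rfl⟩)
        (by rw [hyx])
    · rw [(hBop e he).1, hπid]
      exact (hid x (List.mem_append_right _ hx)).symm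
  obtain ⟨lock, h4⟩ := (h3.write hnext (Or.inr ⟨rfl, ht'.1.val⟩)).writes (ws := [e₀]) ht.2 hws
    (Or.inl rfl)
  have h5 := h4.respond ht.2
  rw [Function.update_eq_self_iff.2 rfl] at h5
  obtain ⟨F, MF, h6, hF, hFna⟩ := h5.exists_finds hD k coin (List.finRange n)
    (hb'.run.snoc hf' ht')
  obtain ⟨H₁, hH₁⟩ : ∃ H₁ : List (Event D n), H₁ = A ++ B ++ opEvents p a.1 a.2 := ⟨_, rfl⟩
  obtain ⟨H₂, hH₂⟩ : ∃ H₂ : List (Event D n), H₂ =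
    ((d :: l₂).flatMap fun x => opEvents p x.1 x.2) ++ [⟨q, π, .writeRes e₀.1⟩] ++
      (writeKinds ws).map (Event.mk q π) ++ [⟨q, π, .res (D.resp π rs)⟩] ++ F := ⟨_, rfl⟩
  have h7 : Reach (H₁ ++ H₂) ⟨MF, none⟩ (fun _ => .idle) := by
    simpa [hH₁, hH₂] using h6
  have hH₁mem : ∀ e ∈ H₁, (∃ x ∈ l₁ ++ a :: d :: l₂, e ∈ opEvents p x.1 x.2 ∧
      ∀ f ∈ opEvents p x.1 x.2, f ∈ H₁) ∨ e ∈ B := by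
    intro e he
    rw [hH₁] at he ⊢
    simp only [List.mem_append] at he ⊢
    rcases he with (he | he) | he
    · obtain ⟨x, hx, h8⟩ := hAop e he
      refine Or.inl ⟨x, Or.inl hx, h8, fun f hf => Or.inl (Or.inl ?_)⟩
      rw [hA]
      exact List.mem_flatMap.2 ⟨x, hx, hf⟩
    · exact Or.inr he
    · exact Or.inl ⟨a, by simp, he, fun f hf => Or.inr hf⟩
  have hBH₁ : ∀ e ∈ B, e ∈ H₁ := fun e he => by rw [hH₁]; simp [he]
  have hBinv : (⟨q, π, .inv⟩ : Event D n) ∈ B := hB ▸ inv_mem_partEvents _ _ _ _ _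
  obtain ⟨hσ, hacc⟩ := h7.accepts hD (by
    intro e he
    rcases List.mem_append.1 he with he | he
    · rcases hH₁mem e he with ⟨x, -, h8, -⟩ | h8
      · exact abort_not_mem_opEvents h8
      · exact (hBop e h8).2.2.1
    · rw [hH₂] at he
      simp only [List.mem_append, List.mem_flatMap, List.mem_map, List.mem_singleton,
        mem_writeKinds] at he
      rcases he with (((⟨x, -, he⟩ | rfl) | ⟨_, ⟨y, -, rfl | rfl⟩, rfl⟩) | rfl) | he
      · exact abort_not_mem_opEvents he
      iterate 4 simp
      · exact hFna e he)
  have hne : ∀ x ∈ l₁ ++ a :: d :: l₂, x.1 ≠ π := fun x hx h8 => hid x hx (by rw [h8, hπid])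
  refine ⟨skel (H₁ ++ H₂), hσ, fun I hI => ?_, optimistic D n, optimistic_classSM hD, hacc⟩
  refine hI.not_accepts (k := k) (π := π) (p := q) ?_ ?_ ?_ ?_ ?_ ?_ ?_ ?_ ?_
  · intro r
    obtain ⟨f, hf, h8⟩ := hF r (List.mem_finRange r)
    exact ⟨f, by rw [hH₂]; simp [hf], h8⟩
  · intro e he
    rcases hH₁mem e he with ⟨x, hx, h8, h9⟩ | h8
    · obtain ⟨y, c, h10⟩ := exists_writeInv_mem_opEvents p (hb'.writes_ne x hx)
      exact ⟨_, h9 _ h10, (mem_opEvents_op h8).1.symm, y, c, rfl⟩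
    · refine ⟨⟨q, π, .writeInv e₀.1 e₀.2⟩, hBH₁ _ ?_, (hBop e h8).1.symm, _, _, rfl⟩
      rw [hB]
      simp [partEvents, hnext, pendingKinds]
  · intro e he h8
    rcases hH₁mem e he with ⟨x, hx, h9, h10⟩ | h9
    · exact ⟨_, h10 _ (res_mem_opEvents _ _ _), (mem_opEvents_op h9).1.symm, _, rfl⟩
    · exact absurd (hBop e h9).1 h8
  · rintro ⟨e, he, h8, r, h9⟩
    rcases hH₁mem e he with ⟨x, hx, h10, -⟩ | h10
    · exact hne x hx ((mem_opEvents_op h10).1.symm.trans h8)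
    · exact (hBop e h10).2.2.2 r h9
  · intro e he h8
    rcases hH₁mem e he with ⟨x, hx, h10, -⟩ | h10
    · exact absurd ((mem_opEvents_op h10).1.symm.trans h8) (hne x hx)
    · exact (hBop e h10).2.1
  · exact ⟨_, hBH₁ _ hBinv, rfl⟩
  · intro e he
    rcases hH₁mem e he with ⟨x, hx, h10, -⟩ | h10
    · rw [(mem_opEvents_op h10).1]
      rcases hb'.calls x hx with ⟨v', h11⟩ | h11 <;> rw [h11] <;> rfl
    · rw [(hBop e h10).1, hπc]
      rfl
  · rw [hπc]
    rfl
  · have hB0 : ∀ P, B.countP (Event.isResOf P) = 0 := by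
      intro P
      rw [List.countP_eq_zero]
      intro e he
      have h8 := (hBop e he).2.2.2
      unfold Event.isResOf
      split
      · next r h9 => exact absurd h9 (h8 r)
      · simp
    simp only [hH₁, List.countP_append, hB0, hA, countP_isResOf_flatMap, countP_isResOf_opEvents,
      hb.balanced, ha]
    simp [Call.isInsert, Call.isDelete]
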